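/- For Borel probability measures $p,q$ on $[0,1)$ (atoms are allowed) let $d_{TV}(p,q)=\sup_A |p(A)-q(A)|$, the supremum over measurable sets $A$. A distribution on $[0,1)$ is *$\ell$-flat* if it has a density that is constant on each interval of some partition of $[0,1)$ into $\ell$ intervals; $\mathrm{opt}_k(p)$ is the infimum of $d_{TV}(p,q)$ over all $k$-flat distributions $q$. The distribution $p$ is *$\kappa$-well-behaved* if $p(\{x\})\le\kappa$ for every $x\in[0,1)$. **Theorem.** There are a single algorithm (Learn-WB-small-opt-$k$-histogram), formalized as a program for a deterministic real random access machine with unit-cost instructions and an instruction that draws the next sample, and constants $C>0$ and $c\in\mathbb N$, such that the following holds for every integer $k\ge 1$ and every $0<\varepsilon<1$, which the program receives as input. (1) On every sequence of samples from $[0,1)$ the program halts after at most $C\,\frac{k}{\varepsilon^2}\bigl(1+\log\frac{k}{\varepsilon^2}\bigr)^c=\tilde O(k/\varepsilon^2)$ steps and draws at most that many samples. (2) Let $p$ be a probability distribution on $[0,1)$ that is $\frac{\varepsilon/\log(1/\varepsilon)}{384k}$-well-behaved and satisfies $\mathrm{opt}_k(p)\le\varepsilon$. If the samples are independent draws from $p$,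 then with probability at least $19/20$ the program outputs (as lists of breakpoints and heights) an $\ell$-flat distribution $h$ with $\ell\le C\,k\,(1+\log(1/\varepsilon))^2$ and $d_{TV}(p,h)\le 2\,\mathrm{opt}_k(p)+3\varepsilon$. Here $\log$ is the natural logarithm; the bound on $\ell$ is $O(k\log^2(1/\varepsilon))$ for $\varepsilon\le 1/2$. -/

import Mathlib

open Set MeasureTheory

noncomputable section

namespace HistLearn

/-! ## Distributions on `[0,1)` and histograms

A distribution on `[0,1)` is a Borel probability measure `p` on `ℝ` with `p (Ico 0 1) = 1`; it may
have atoms. -/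

/-- Total variation distance `sup_A |p(A) - q(A)|` over all measurable sets. -/
def tvDist (p q : Measure ℝ) : ℝ :=
  ⨆ A : {A : Set ℝ // MeasurableSet A}, |p.real A.1 - q.real A.1|

/-- `p` is `κ`-well-behaved: no point of `[0,1)` has mass more than `κ`. -/
def WellBehaved (κ : ℝ) (p : Measure ℝ) : Prop :=
  ∀ x ∈ Ico (0 : ℝ) 1, p.real {x} ≤ κ

/-- The numbers `0 = a 0 < a 1 < ⋯ < a k = 1` cut `[0,1)` into the `k` intervals
`[a i, a (i+1))`, and the nonnegative heights `c 0, …, c (k-1)` on these intervals integrate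
to one. Entries of `a` beyond `k` and of `c` beyond `k - 1` are irrelevant. -/
structure IsHistogram (k : ℕ) (a c : ℕ → ℝ) : Prop where
  left : a 0 = 0
  right : a k = 1
  lt : ∀ i < k, a i < a (i + 1)
  nonneg : ∀ i < k, 0 ≤ c i
  total : ∑ i ∈ Finset.range k, c i * (a (i + 1) - a i) = 1

/-- The function equal to `c i` on `[a i, a (i+1))` for `i < k`, and to zero elsewhere. -/
def histDensity (k : ℕ) (a c : ℕ → ℝ) (x : ℝ) : ℝ :=
  ∑ i ∈ Finset.range k, (Ico (a i) (a (i + 1))).indicator (fun _ => c i) x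

/-- The measure with density `histDensity k a c`. -/
def histMeasure (k : ℕ) (a c : ℕ → ℝ) : Measure ℝ :=
  volume.withDensity fun x => ENNReal.ofReal (histDensity k a c x)

/-- `q` is a `k`-flat distribution over `[0,1)`. -/
def IsFlat (k : ℕ) (q : Measure ℝ) : Prop :=
  ∃ a c : ℕ → ℝ, IsHistogram k a c ∧ q = histMeasure k a c

/-- `opt_k(p)`, the infimum of the distances from `p` to the `k`-flat distributions. -/
def opt (k : ℕ) (p : Measure ℝ) : ℝ :=
  sInf (tvDist p '' {q | IsFlat k q})

/-! ## A real random access machine with access to samples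

The machine has natural-number registers and real registers, and memory banks of natural numbers
and of reals, with indirect addressing. A program is a finite object, so it names only finitely many
registers and banks. Each instruction and each test costs one step. There is no rounding of reals
to integers, and natural numbers can only be added, subtracted (truncated at zero) and compared. -/

/-- A state of the machine; `drawn` counts the samples drawn so far. -/
structure State where
  nreg : ℕ → ℕ
  rreg : ℕ → ℝ
  nmem : ℕ → ℕ → ℕ
  rmem : ℕ → ℕ → ℝ
  drawn : ℕ

/-- Instructions. The arguments are literal constants, numbers of registers or numbers of banks.
The first argument of every instruction but `nstore` and `rstore` is the target register. -/
inductive Instr where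
  | nconst (d n : ℕ)
  | nadd (d i j : ℕ)
  | nsub (d i j : ℕ)
  | nload (d b i : ℕ)
  | nstore (b i s : ℕ)
  | rconst (d : ℕ) (r : ℚ)
  | rcast (d i : ℕ)
  | radd (d i j : ℕ)
  | rsub (d i j : ℕ)
  | rmul (d i j : ℕ)
  | rdiv (d i j : ℕ)
  | rload (d b i : ℕ)
  | rstore (b i s : ℕ)
  | draw (d : ℕ)

/-- Comparison tests between two registers. -/
inductive Test where
  | nlt (i j : ℕ)
  | nle (i j : ℕ)
  | rlt (i j : ℕ)
  | rle (i j : ℕ)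

/-- Programs. -/
inductive Prog where
  | instr (I : Instr)
  | seq (P Q : Prog)
  | cond (b : Test) (P Q : Prog)
  | loop (b : Test) (P : Prog)

/-- Write `v` to address `i` of bank `b`. -/
def writeMem {α : Type} (m : ℕ → ℕ → α) (b i : ℕ) (v : α) : ℕ → ℕ → α :=
  Function.update m b (Function.update (m b) i v)

/-- The effect of an instruction when the sequence of samples is `x`. -/
def Instr.run (x : ℕ → ℝ) (σ : State) : Instr → State
  | .nconst d n => { σ with nreg := Function.update σ.nreg d n }
  | .nadd d i j => { σ with nreg := Function.update σ.nreg d (σ.nreg i + σ.nreg j) }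
  | .nsub d i j => { σ with nreg := Function.update σ.nreg d (σ.nreg i - σ.nreg j) }
  | .nload d b i => { σ with nreg := Function.update σ.nreg d (σ.nmem b (σ.nreg i)) }
  | .nstore b i s => { σ with nmem := writeMem σ.nmem b (σ.nreg i) (σ.nreg s) }
  | .rconst d r => { σ with rreg := Function.update σ.rreg d (r : ℝ) }
  | .rcast d i => { σ with rreg := Function.update σ.rreg d (σ.nreg i : ℝ) }
  | .radd d i j => { σ with rreg := Function.update σ.rreg d (σ.rreg i + σ.rreg j) }
  | .rsub d i j => { σ with rreg := Function.update σ.rreg d (σ.rreg i - σ.rreg j) }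
  | .rmul d i j => { σ with rreg := Function.update σ.rreg d (σ.rreg i * σ.rreg j) }
  | .rdiv d i j => { σ with rreg := Function.update σ.rreg d (σ.rreg i / σ.rreg j) }
  | .rload d b i => { σ with rreg := Function.update σ.rreg d (σ.rmem b (σ.nreg i)) }
  | .rstore b i s => { σ with rmem := writeMem σ.rmem b (σ.nreg i) (σ.rreg s) }
  | .draw d => { σ with rreg := Function.update σ.rreg d (x σ.drawn), drawn := σ.drawn + 1 }

/-- The outcome of a test. -/
def Test.Holds (σ : State) : Test → Prop
  | .nlt i j => σ.nreg i < σ.nreg j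
  | .nle i j => σ.nreg i ≤ σ.nreg j
  | .rlt i j => σ.rreg i < σ.rreg j
  | .rle i j => σ.rreg i ≤ σ.rreg j

/-- `Exec x P σ t τ`: on the sequence of samples `x`, the program `P` started in the state `σ` halts
after exactly `t` steps in the state `τ`. -/
inductive Exec (x : ℕ → ℝ) : Prog → State → ℕ → State → Prop where
  | instr (I : Instr) (σ : State) : Exec x (.instr I) σ 1 (I.run x σ)
  | seq {P Q : Prog} {σ ρ τ : State} {s t : ℕ} :
      Exec x P σ s ρ → Exec x Q ρ t τ → Exec x (.seq P Q) σ (s + t) τ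
  | cond_true {b : Test} {P Q : Prog} {σ τ : State} {t : ℕ} :
      b.Holds σ → Exec x P σ t τ → Exec x (.cond b P Q) σ (t + 1) τ
  | cond_false {b : Test} {P Q : Prog} {σ τ : State} {t : ℕ} :
      ¬ b.Holds σ → Exec x Q σ t τ → Exec x (.cond b P Q) σ (t + 1) τ
  | loop_true {b : Test} {P : Prog} {σ ρ τ : State} {s t : ℕ} :
      b.Holds σ → Exec x P σ s ρ → Exec x (.loop b P) ρ t τ →
        Exec x (.loop b P) σ (s + t + 1) τ
  | loop_false {b : Test} {P : Prog} {σ : State} :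
      ¬ b.Holds σ → Exec x (.loop b P) σ 1 σ

/-- The machine is deterministic: running time and final state are determined by the program, the
initial state and the samples. -/
theorem Exec.unique {x : ℕ → ℝ} {P : Prog} {σ : State} {t t' : ℕ} {τ τ' : State}
    (h : Exec x P σ t τ) (h' : Exec x P σ t' τ') : t = t' ∧ τ = τ' := by
  induction h generalizing t' τ' with
  | instr I σ => cases h'; exact ⟨rfl, rfl⟩
  | seq _ _ ih₁ ih₂ =>
    cases h' with
    | seq h₁ h₂ =>
      obtain ⟨rfl, rfl⟩ := ih₁ h₁
      obtain ⟨rfl, rfl⟩ := ih₂ h₂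
      exact ⟨rfl, rfl⟩
  | cond_true hb _ ih =>
    cases h' with
    | cond_true _ h₁ => obtain ⟨rfl, rfl⟩ := ih h₁; exact ⟨rfl, rfl⟩
    | cond_false hb' _ => exact absurd hb hb'
  | cond_false hb _ ih =>
    cases h' with
    | cond_true hb' _ => exact absurd hb' hb
    | cond_false _ h₁ => obtain ⟨rfl, rfl⟩ := ih h₁; exact ⟨rfl, rfl⟩
  | loop_true hb _ _ ih₁ ih₂ =>
    cases h' with
    | loop_true _ h₁ h₂ =>
      obtain ⟨rfl, rfl⟩ := ih₁ h₁
      obtain ⟨rfl, rfl⟩ := ih₂ h₂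
      exact ⟨rfl, rfl⟩
    | loop_false hb' => exact absurd hb hb'
  | loop_false hb =>
    cases h' with
    | loop_true hb' _ _ => exact absurd hb' hb
    | loop_false _ => exact ⟨rfl, rfl⟩

/-- The initial state: natural-number register `0` holds `k`, real register `0` holds `ε`, everything
else is zero and no sample has been drawn. -/
def input (k : ℕ) (ε : ℝ) : State where
  nreg := Function.update (fun _ => 0) 0 k
  rreg := Function.update (fun _ => 0) 0 ε
  nmem := fun _ _ => 0
  rmem := fun _ _ => 0
  drawn := 0

/-- The output written in a final state: the number of pieces is in natural-number register `0`,
the breakpoints are in real bank `0` and the heights in real bank `1`. -/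
def State.size (σ : State) : ℕ := σ.nreg 0

/-- The breakpoints of the output. -/
def State.breaks (σ : State) : ℕ → ℝ := σ.rmem 0

/-- The heights of the output. -/
def State.heights (σ : State) : ℕ → ℝ := σ.rmem 1

/-- The output is an `ℓ`-flat distribution, where `ℓ` is its `size`, with `ℓ ≤ L`, and its total
variation distance from `p` is at most `δ`. -/
def State.Accurate (σ : State) (p : Measure ℝ) (L δ : ℝ) : Prop :=
  IsHistogram σ.size σ.breaks σ.heights ∧ (σ.size : ℝ) ≤ L ∧
    tvDist p (histMeasure σ.size σ.breaks σ.heights) ≤ δ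

end HistLearn

end

namespace HistLearn

noncomputable section

open ProbabilityTheory

/-! ## Concentration of the empirical measure on unions of few intervals -/

/-- The empirical measure of the first `n` samples. -/
def empMeasure (n : ℕ) (x : ℕ → ℝ) : Measure ℝ :=
  (n : ENNReal)⁻¹ • ∑ i ∈ Finset.range n, Measure.dirac (x i)

theorem empMeasure_real (n : ℕ) (x : ℕ → ℝ) {B : Set ℝ} (hB : MeasurableSet B) :
    (empMeasure n x).real B = (∑ i ∈ Finset.range n, B.indicator (fun _ => (1 : ℝ)) (x i)) / n := by
  rw [Measure.real, empMeasure, Measure.smul_apply, Measure.finsetSum_apply, smul_eq_mul,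
    ENNReal.toReal_mul, ENNReal.toReal_inv, ENNReal.toReal_natCast, ENNReal.toReal_sum]
  · rw [div_eq_inv_mul]
    congr 1
    refine Finset.sum_congr rfl fun i _ => ?_
    rw [Measure.dirac_apply' _ hB]
    by_cases h : x i ∈ B <;> simp [h]
  · intro i _
    exact measure_ne_top _ _

instance empMeasure_isFinite (n : ℕ) (x : ℕ → ℝ) : IsFiniteMeasure (empMeasure n x) := by
  rcases Nat.eq_zero_or_pos n with rfl | hn
  · constructor; simp [empMeasure]
  · constructor
    rw [empMeasure, Measure.smul_apply, Measure.finsetSum_apply, smul_eq_mul]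
    refine ENNReal.mul_lt_top ?_ ?_
    · simp [hn]
    · exact ENNReal.sum_lt_top.2 fun i _ => measure_lt_top _ _

theorem empMeasure_isProbability {n : ℕ} (hn : 0 < n) (x : ℕ → ℝ) :
    IsProbabilityMeasure (empMeasure n x) := by
  constructor
  rw [empMeasure, Measure.smul_apply, Measure.finsetSum_apply, smul_eq_mul]
  simp only [measure_univ, Finset.sum_const, Finset.card_range, nsmul_eq_mul, mul_one]
  exact ENNReal.inv_mul_cancel (by simpa using hn.ne') (by simp)

theorem measurable_empMeasure_real (n : ℕ) {B : Set ℝ} (hB : MeasurableSet B) :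
    Measurable fun x : ℕ → ℝ => (empMeasure n x).real B := by
  simp_rw [empMeasure_real n _ hB]
  refine Measurable.div_const (Finset.measurable_sum _ fun i _ => ?_) _
  exact (measurable_const.indicator hB).comp (measurable_pi_apply i)

theorem integral_sq_empMeasure_sub_le (p : Measure ℝ) [IsProbabilityMeasure p] {n : ℕ} (hn : 0 < n)
    {B : Set ℝ} (hB : MeasurableSet B) :
    ∫ x, ((empMeasure n x).real B - p.real B) ^ 2 ∂(Measure.infinitePi fun _ : ℕ => p)
      ≤ p.real B / n := by
  set P := Measure.infinitePi fun _ : ℕ => p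
  set f : ℝ → ℝ := B.indicator (fun _ => (1 : ℝ)) with hf
  have hfm : Measurable f := measurable_const.indicator hB
  set X : ℕ → (ℕ → ℝ) → ℝ := fun i x => f (x i) with hX
  have hXm : ∀ i, Measurable (X i) := fun i => hfm.comp (measurable_pi_apply i)
  have hbd : ∀ i x, X i x ∈ Icc (0 : ℝ) 1 := by
    intro i x
    simp only [hX, hf, indicator]
    split_ifs <;> simp
  have hL : ∀ i, MemLp (X i) 2 P := fun i =>
    memLp_of_bounded (Filter.Eventually.of_forall (hbd i)) (hXm i).aestronglyMeasurable 2
  have hind : iIndepFun X P := iIndepFun_infinitePi (X := fun _ => f) (fun _ => hfm)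
  have hint : ∀ g : ℝ → ℝ, Measurable g → ∀ i, ∫ x, g (x i) ∂P = ∫ y, g y ∂p := by
    intro g hg i
    have := (measurePreserving_eval_infinitePi (fun _ : ℕ => p) i)
    rw [← this.map_eq, integral_map (measurable_pi_apply i).aemeasurable hg.aestronglyMeasurable]
  have hE : ∀ i, ∫ x, X i x ∂P = p.real B := by
    intro i
    rw [hint f hfm i, hf, integral_indicator_const _ hB]; simp
  have hvar : ∀ i, variance (X i) P ≤ p.real B := by
    intro i
    refine (variance_le_expectation_sq (hXm i).aestronglyMeasurable).trans ?_
    rw [← hE i]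
    refine le_of_eq (integral_congr_ae (Filter.Eventually.of_forall fun x => ?_))
    simp only [hX, hf, indicator, Pi.pow_apply]
    split_ifs <;> simp
  have hsum : variance (∑ i ∈ Finset.range n, X i) P ≤ n * p.real B := by
    rw [IndepFun.variance_sum (fun i _ => hL i) (fun i _ j _ hij => hind.indepFun hij)]
    refine (Finset.sum_le_sum fun i _ => hvar i).trans ?_
    simp
  have hmean : ∫ x, (∑ i ∈ Finset.range n, X i) x ∂P = n * p.real B := by
    simp_rw [Finset.sum_apply]
    rw [integral_finsetSum _ fun i _ => (hL i).integrable (by norm_num)]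
    simp [hE]
  rw [variance_eq_integral (Finset.aemeasurable_sum _ fun i _ => (hXm i).aemeasurable), hmean]
    at hsum
  have hn' : (0 : ℝ) < n := by exact_mod_cast hn
  have : ∀ x, ((empMeasure n x).real B - p.real B) ^ 2 =
      ((∑ i ∈ Finset.range n, X i) x - n * p.real B) ^ 2 / (n : ℝ) ^ 2 := by
    intro x
    rw [empMeasure_real n x hB, Finset.sum_apply, ← div_pow]
    congr 1
    field_simp
    rfl
  simp_rw [this]
  rw [integral_div, div_le_div_iff₀ (by positivity) hn']
  nlinarith

/-- Every boundary crossing of `A` passes a point of `E`. -/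
def Cut (E : Finset ℝ) (A : Set ℝ) : Prop :=
  ∀ x ∈ A, ∀ y ∉ A, ∃ e ∈ E, e ∈ uIcc x y

theorem Cut.compl {E : Finset ℝ} {A : Set ℝ} (h : Cut E A) : Cut E Aᶜ := by
  intro x hx y hy
  obtain ⟨e, he, h⟩ := h y (not_not.1 hy) x hx
  exact ⟨e, he, by rwa [uIcc_comm]⟩

/-- The block of `2 ^ l` consecutive fibres of `φ` with number `j`. -/
def cell (φ : ℝ → ℕ) (l j : ℕ) : Set ℝ := {x | φ x / 2 ^ l = j}

theorem measurableSet_cell {φ : ℝ → ℕ} (hφ : Monotone φ) (l j : ℕ) :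
    MeasurableSet (cell φ l j) := by
  have : Measurable φ := hφ.measurable
  exact (this.div_const _) (measurableSet_singleton j)

theorem cell_ordConnected {φ : ℝ → ℕ} (hφ : Monotone φ) {l j : ℕ} {x y e : ℝ}
    (hx : x ∈ cell φ l j) (hy : y ∈ cell φ l j) (he : e ∈ uIcc x y) : e ∈ cell φ l j := by
  have hm : Monotone fun x => φ x / 2 ^ l := fun a b hab => Nat.div_le_div_right (hφ hab)
  have := hm.mapsTo_uIcc he
  simp only [cell, mem_ofPred_eq] at hx hy ⊢
  rw [hx, hy] at this
  simpa using this

/-- Sum of the squared deviations of the cells of level `l`. -/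
def levelDev (φ : ℝ → ℕ) (L : ℕ) (μ ν : Measure ℝ) (l : ℕ) : ℝ :=
  ∑ j ∈ Finset.range (2 ^ L), (μ.real (cell φ l j) - ν.real (cell φ l j)) ^ 2

theorem levelDev_nonneg (φ : ℝ → ℕ) (L : ℕ) (μ ν : Measure ℝ) (l : ℕ) :
    0 ≤ levelDev φ L μ ν l := Finset.sum_nonneg fun _ _ => sq_nonneg _

theorem sum_cell_dev_le (φ : ℝ → ℕ) (L : ℕ) (μ ν : Measure ℝ) (l R : ℕ) {K : Finset ℕ}
    (hK : K ⊆ Finset.range (2 ^ L)) (hR : K.card ≤ R) :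
    ∑ j ∈ K, (μ.real (cell φ l j) - ν.real (cell φ l j)) ≤ √(R * levelDev φ L μ ν l) := by
  refine Real.le_sqrt_of_sq_le ?_
  refine (sq_sum_le_card_mul_sum_sq).trans ?_
  refine mul_le_mul (by exact_mod_cast hR) ?_ (Finset.sum_nonneg fun _ _ => sq_nonneg _)
    (by positivity)
  exact Finset.sum_le_sum_of_subset_of_nonneg hK fun _ _ _ => sq_nonneg _

/-- The union of the cells of level `l` contained in `A`. -/
def innerCells (φ : ℝ → ℕ) (A : Set ℝ) (l : ℕ) : Set ℝ :=
  {x | cell φ l (φ x / 2 ^ l) ⊆ A}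

theorem mem_cell_self (φ : ℝ → ℕ) (l : ℕ) (x : ℝ) : x ∈ cell φ l (φ x / 2 ^ l) := rfl

theorem innerCells_subset (φ : ℝ → ℕ) (A : Set ℝ) (l : ℕ) : innerCells φ A l ⊆ A :=
  fun x hx => hx (mem_cell_self φ l x)

theorem cell_subset_cell_succ (φ : ℝ → ℕ) (l j : ℕ) : cell φ l j ⊆ cell φ (l + 1) (j / 2) := by
  intro x hx
  simp only [cell, mem_ofPred_eq] at hx ⊢
  rw [pow_succ, ← Nat.div_div_eq_div_mul, hx]

theorem innerCells_succ_subset (φ : ℝ → ℕ) (A : Set ℝ) (l : ℕ) :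
    innerCells φ A (l + 1) ⊆ innerCells φ A l := by
  intro x hx
  refine (cell_subset_cell_succ φ l _).trans ?_
  rw [Nat.div_div_eq_div_mul, ← pow_succ]
  exact hx

theorem measurableSet_innerCells {φ : ℝ → ℕ} (hφ : Monotone φ) (A : Set ℝ) (l : ℕ) :
    MeasurableSet (innerCells φ A l) := by
  have : Measurable fun x => φ x / 2 ^ l := (hφ.measurable).div_const _
  exact this (MeasurableSet.of_discrete (s := {j | cell φ l j ⊆ A}))

theorem measureReal_biUnion_cell {φ : ℝ → ℕ} (hφ : Monotone φ) (μ : Measure ℝ) [IsFiniteMeasure μ]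
    (l : ℕ) (K : Finset ℕ) :
    μ.real (⋃ j ∈ K, cell φ l j) = ∑ j ∈ K, μ.real (cell φ l j) := by
  refine measureReal_biUnion_finset (fun i _ j _ hij => ?_) fun j _ => measurableSet_cell hφ l j
  refine disjoint_left.2 fun x hx hy => hij ?_
  rw [← mem_ofPred.1 hx, ← mem_ofPred.1 hy]

theorem card_le_of_cut {φ : ℝ → ℕ} (hφ : Monotone φ) {E : Finset ℝ} {A : Set ℝ} (hA : Cut E A)
    (l : ℕ) {K : Finset ℕ}
    (hK : ∀ j ∈ K, (∃ x ∈ cell φ l j, x ∈ A) ∧ ∃ y ∈ cell φ l j, y ∉ A) : K.card ≤ E.card := by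
  classical
  have : K ⊆ E.image fun e => φ e / 2 ^ l := by
    intro j hj
    obtain ⟨⟨x, hx, hxA⟩, y, hy, hyA⟩ := hK j hj
    obtain ⟨e, he, hxy⟩ := hA x hxA y hyA
    exact Finset.mem_image.2 ⟨e, he, cell_ordConnected hφ hx hy hxy⟩
  exact (Finset.card_le_card this).trans Finset.card_image_le

theorem innerCells_step {φ : ℝ → ℕ} (hφ : Monotone φ) {L : ℕ} (hL : ∀ x, φ x < 2 ^ L)
    (μ ν : Measure ℝ) [IsFiniteMeasure μ] [IsFiniteMeasure ν] {E : Finset ℝ} {A : Set ℝ}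
    (hA : Cut E A) {R : ℕ} (hE : E.card ≤ R) (l : ℕ) :
    μ.real (innerCells φ A l) - ν.real (innerCells φ A l) ≤
      μ.real (innerCells φ A (l + 1)) - ν.real (innerCells φ A (l + 1)) +
        √(R * levelDev φ L μ ν l) := by
  classical
  set K := (Finset.range (2 ^ L)).filter fun j =>
    (cell φ l j).Nonempty ∧ cell φ l j ⊆ A ∧ ¬ cell φ (l + 1) (j / 2) ⊆ A with hKdef
  have hdiff : innerCells φ A l \ innerCells φ A (l + 1) = ⋃ j ∈ K, cell φ l j := by
    ext x
    simp only [hKdef, mem_sdiff, innerCells, mem_ofPred_eq, mem_iUnion, Finset.mem_filter,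
      Finset.mem_range, exists_prop]
    have hx : φ x / 2 ^ (l + 1) = φ x / 2 ^ l / 2 := by
      rw [pow_succ, Nat.div_div_eq_div_mul]
    constructor
    · rintro ⟨h1, h2⟩
      exact ⟨φ x / 2 ^ l, ⟨(Nat.div_le_self _ _).trans_lt (hL x), ⟨x, rfl⟩, h1, by rwa [← hx]⟩, rfl⟩
    · rintro ⟨j, ⟨_, _, h1, h2⟩, hj⟩
      simp only [cell, mem_ofPred_eq] at hj
      subst hj
      exact ⟨h1, by rwa [hx]⟩
  have hcard : K.card ≤ R := by
    have hinj : Set.InjOn (fun j => j / 2) (K : Set ℕ) := by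
      intro i hi j hj hij
      simp only [hKdef, Finset.coe_filter, Finset.mem_range, mem_ofPred_eq] at hi hj hij
      by_contra hne
      refine hi.2.2.2 fun x hx => ?_
      simp only [cell, mem_ofPred_eq, pow_succ, ← Nat.div_div_eq_div_mul] at hx
      have : φ x / 2 ^ l = i ∨ φ x / 2 ^ l = j := by omega
      rcases this with h | h
      · exact hi.2.2.1 h
      · exact hj.2.2.1 h
    rw [← Finset.card_image_of_injOn hinj]
    refine (card_le_of_cut hφ hA (l + 1) ?_).trans hE
    intro j hj
    obtain ⟨i, hi, rfl⟩ := Finset.mem_image.1 hj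
    obtain ⟨_, ⟨x, hx⟩, h1, h2⟩ := Finset.mem_filter.1 hi
    exact ⟨⟨x, cell_subset_cell_succ φ l i hx, h1 hx⟩, not_subset.1 h2⟩
  have key : ∀ ρ : Measure ℝ, IsFiniteMeasure ρ → ρ.real (innerCells φ A l) =
      ρ.real (innerCells φ A (l + 1)) + ∑ j ∈ K, ρ.real (cell φ l j) := by
    intro ρ _
    rw [← measureReal_biUnion_cell hφ, ← hdiff,
      measureReal_sdiff (innerCells_succ_subset φ A l) (measurableSet_innerCells hφ A _)]
    ring
  rw [key μ inferInstance, key ν inferInstance]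
  have := sum_cell_dev_le φ L μ ν l R (K := K) (Finset.filter_subset _ _) hcard
  rw [Finset.sum_sub_distrib] at this
  linarith

theorem innerCells_dev_le {φ : ℝ → ℕ} (hφ : Monotone φ) {L : ℕ} (hL : ∀ x, φ x < 2 ^ L)
    (μ ν : Measure ℝ) [IsProbabilityMeasure μ] [IsProbabilityMeasure ν] {E : Finset ℝ} {A : Set ℝ}
    (hA : Cut E A) {R : ℕ} (hE : E.card ≤ R) :
    μ.real (innerCells φ A 0) - ν.real (innerCells φ A 0) ≤
      ∑ l ∈ Finset.range L, √(R * levelDev φ L μ ν l) := by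
  have h : ∀ m, μ.real (innerCells φ A 0) - ν.real (innerCells φ A 0) ≤
      μ.real (innerCells φ A m) - ν.real (innerCells φ A m) +
        ∑ l ∈ Finset.range m, √(R * levelDev φ L μ ν l) := by
    intro m
    induction m with
    | zero => simp
    | succ m ih =>
      rw [Finset.sum_range_succ]
      linarith [innerCells_step hφ hL μ ν hA hE m]
  have htop : μ.real (innerCells φ A L) - ν.real (innerCells φ A L) = 0 := by
    have h0 : ∀ x, φ x / 2 ^ L = 0 := fun x => Nat.div_eq_of_lt (hL x)
    have hc : cell φ L 0 = univ := by ext x; simp [cell, h0]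
    by_cases hu : A = univ
    · have : innerCells φ A L = univ := by ext x; simp [innerCells, hu]
      simp [this]
    · have : innerCells φ A L = ∅ := by
        ext x
        simp only [innerCells, mem_ofPred_eq, h0, hc, univ_subset_iff, mem_empty_iff_false]
        exact iff_of_false hu id
      simp [this]
  linarith [h L]

theorem dev_le_of_cut {φ : ℝ → ℕ} (hφ : Monotone φ) {L : ℕ} (hL : ∀ x, φ x < 2 ^ L)
    (μ ν : Measure ℝ) [IsProbabilityMeasure μ] [IsProbabilityMeasure ν] {δ : ℝ} (hδ : 0 ≤ δ)
    (hφδ : ∀ v, (φ ⁻¹' {v}).Subsingleton ∨ μ.real (φ ⁻¹' {v}) ≤ δ)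
    {E : Finset ℝ} {A : Set ℝ} (hA : Cut E A) {R : ℕ} (hE : E.card ≤ R) :
    μ.real A - ν.real A ≤ R * δ + ∑ l ∈ Finset.range L, √(R * levelDev φ L μ ν l) := by
  classical
  set K := (Finset.range (2 ^ L)).filter fun j =>
    (∃ x ∈ cell φ 0 j, x ∈ A) ∧ ∃ y ∈ cell φ 0 j, y ∉ A with hKdef
  have hsub : A \ innerCells φ A 0 ⊆ ⋃ j ∈ K, cell φ 0 j := by
    rintro x ⟨hxA, hx⟩
    simp only [innerCells, mem_ofPred_eq, not_subset] at hx
    simp only [mem_iUnion, exists_prop]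
    exact ⟨φ x / 2 ^ 0, Finset.mem_filter.2 ⟨Finset.mem_range.2 (by simpa using hL x),
      ⟨x, rfl, hxA⟩, hx⟩, rfl⟩
  have hcard : K.card ≤ R := (card_le_of_cut hφ hA 0 fun j hj => (Finset.mem_filter.1 hj).2).trans hE
  have hsmall : μ.real (A \ innerCells φ A 0) ≤ R * δ := by
    refine (measureReal_mono hsub (measure_ne_top _ _)).trans ?_
    rw [measureReal_biUnion_cell hφ]
    have : ∀ j ∈ K, μ.real (cell φ 0 j) ≤ δ := by
      intro j hj
      obtain ⟨_, ⟨x, hx, hxA⟩, y, hy, hyA⟩ := Finset.mem_filter.1 hj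
      have he : cell φ 0 j = φ ⁻¹' {j} := by ext z; simp [cell]
      rw [he] at hx hy ⊢
      rcases hφδ j with h | h
      · exact absurd (h hx hy ▸ hxA) hyA
      · exact h
    refine (Finset.sum_le_card_nsmul _ _ _ this).trans ?_
    rw [nsmul_eq_mul]
    exact mul_le_mul_of_nonneg_right (by exact_mod_cast hcard) hδ
  rw [measureReal_sdiff (innerCells_subset φ A 0) (measurableSet_innerCells hφ A 0)] at hsmall
  have h1 := innerCells_dev_le hφ hL μ ν hA hE
  have h2 : ν.real (innerCells φ A 0) ≤ ν.real A := measureReal_mono (innerCells_subset φ A 0)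
  linarith

theorem abs_dev_le_of_cut {φ : ℝ → ℕ} (hφ : Monotone φ) {L : ℕ} (hL : ∀ x, φ x < 2 ^ L)
    (μ ν : Measure ℝ) [IsProbabilityMeasure μ] [IsProbabilityMeasure ν] {δ : ℝ} (hδ : 0 ≤ δ)
    (hφδ : ∀ v, (φ ⁻¹' {v}).Subsingleton ∨ μ.real (φ ⁻¹' {v}) ≤ δ)
    {E : Finset ℝ} {A : Set ℝ} (hAm : MeasurableSet A)
    (hA : Cut E A) {R : ℕ} (hE : E.card ≤ R) {D : ℝ}
    (hD : ∑ l ∈ Finset.range L, levelDev φ L μ ν l ≤ D) :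
    |ν.real A - μ.real A| ≤ R * δ + √(L * (R * D)) := by
  have hsqrt : ∑ l ∈ Finset.range L, √(R * levelDev φ L μ ν l) ≤ √(L * (R * D)) := by
    refine Real.le_sqrt_of_sq_le ?_
    refine (sq_sum_le_card_mul_sum_sq).trans ?_
    rw [Finset.card_range]
    refine mul_le_mul_of_nonneg_left ?_ (by positivity)
    rw [Finset.sum_congr rfl fun l _ => Real.sq_sqrt
      (mul_nonneg (Nat.cast_nonneg R) (levelDev_nonneg φ L μ ν l)), ← Finset.mul_sum]
    exact mul_le_mul_of_nonneg_left hD (by positivity)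
  have h1 := dev_le_of_cut hφ hL μ ν hδ hφδ hA hE
  have h2 := dev_le_of_cut hφ hL μ ν hδ hφδ hA.compl hE
  rw [probReal_compl_eq_one_sub hAm, probReal_compl_eq_one_sub hAm] at h2
  rw [abs_le]
  constructor <;> linarith

/-- A monotone map to the naturals all of whose fibres are single points or of small mass. -/
theorem exists_fibration (p : Measure ℝ) [IsProbabilityMeasure p] {M : ℕ} (hM : 0 < M) :
    ∃ φ : ℝ → ℕ, Monotone φ ∧ (∀ x, φ x ≤ 2 * M) ∧
      ∀ v, (φ ⁻¹' {v}).Subsingleton ∨ p.real (φ ⁻¹' {v}) ≤ 1 / M := by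
  have hM' : (0 : ℝ) < M := by exact_mod_cast hM
  set F : ℝ → ℝ := fun x => M * p.real (Iic x)
  set G : ℝ → ℝ := fun x => M * p.real (Iio x)
  have hF : Monotone F := fun x y h =>
    mul_le_mul_of_nonneg_left (measureReal_mono (Iic_subset_Iic.2 h)) hM'.le
  have hG : Monotone G := fun x y h =>
    mul_le_mul_of_nonneg_left (measureReal_mono (Iio_subset_Iio h)) hM'.le
  have hGF : ∀ x, G x ≤ F x := fun x =>
    mul_le_mul_of_nonneg_left (measureReal_mono Iio_subset_Iic_self) hM'.le
  have hFG : ∀ x y, x < y → F x ≤ G y := fun x y h =>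
    mul_le_mul_of_nonneg_left (measureReal_mono fun z hz => lt_of_le_of_lt hz h) hM'.le
  have hG0 : ∀ x, 0 ≤ G x := fun x => by positivity
  set φ : ℝ → ℕ := fun x => ⌊F x⌋₊ + ⌊G x⌋₊ with hφdef
  have hφ : Monotone φ := fun x y h =>
    add_le_add (Nat.floor_mono (hF h)) (Nat.floor_mono (hG h))
  refine ⟨φ, hφ, ?_, ?_⟩
  · intro x
    have h1 : ⌊F x⌋₊ ≤ M := by
      refine Nat.floor_le_of_le ?_
      exact mul_le_of_le_one_right hM'.le measureReal_le_one
    have h2 : ⌊G x⌋₊ ≤ M := (Nat.floor_mono (hGF x)).trans h1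
    simp only [hφdef]; omega
  · intro v
    by_cases hs : (φ ⁻¹' {v}).Subsingleton
    · exact Or.inl hs
    refine Or.inr ?_
    have hI : ∀ x ∈ φ ⁻¹' {v}, ∀ y ∈ φ ⁻¹' {v}, x < y → p.real (Icc x y) ≤ 1 / M := by
      intro x hx y hy hxy
      simp only [mem_preimage, mem_singleton_iff, hφdef] at hx hy
      have h1 := Nat.floor_mono (hF hxy.le)
      have h2 := Nat.floor_mono (hG hxy.le)
      have h3 := Nat.floor_mono (hGF x)
      have h4 := Nat.floor_mono (hFG x y hxy)
      have h5 : ⌊F y⌋₊ = ⌊G x⌋₊ := by omega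
      have h6 := Nat.lt_floor_add_one (F y)
      have h7 := Nat.floor_le (hG0 x)
      have h8 : F y - G x ≤ 1 := by rw [h5] at h6; linarith
      have h9 : p.real (Icc x y) = p.real (Iic y) - p.real (Iio x) := by
        rw [← measureReal_sdiff (Iio_subset_Iic hxy.le) measurableSet_Iio]
        congr 1; ext z; simp
      rw [h9, le_div_iff₀ hM']
      simp only [F, G] at h8
      linarith
    have hm : MeasurableSet (φ ⁻¹' {v}) := hφ.measurable (measurableSet_singleton v)
    have hle : p (φ ⁻¹' {v}) ≤ ENNReal.ofReal (1 / M) := by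
      rw [hm.measure_eq_iSup_isCompact]
      refine iSup_le fun K => iSup_le fun hKs => iSup_le fun hK => ?_
      obtain ⟨x, hx, y, hy, hxy⟩ := not_subsingleton_iff.1 hs
      have hK2 : IsCompact (insert x (insert y K)) := (hK.insert y).insert x
      have hne : (insert x (insert y K)).Nonempty := ⟨x, by simp⟩
      have hsub : insert x (insert y K) ⊆ φ ⁻¹' {v} := by
        intro z hz
        rcases hz with rfl | rfl | hz
        · exact hx
        · exact hy
        · exact hKs hz
      have hlt : sInf (insert x (insert y K)) < sSup (insert x (insert y K)) := by
        have a1 := csInf_le hK2.bddBelow (show x ∈ insert x (insert y K) by simp)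
        have a2 := csInf_le hK2.bddBelow (show y ∈ insert x (insert y K) by simp)
        have a3 := le_csSup hK2.bddAbove (show x ∈ insert x (insert y K) by simp)
        have a4 := le_csSup hK2.bddAbove (show y ∈ insert x (insert y K) by simp)
        rcases lt_or_gt_of_ne hxy with h | h <;> linarith
      have := hI _ (hsub (hK2.sInf_mem hne)) _ (hsub (hK2.sSup_mem hne)) hlt
      rw [← ofReal_measureReal]
      refine ENNReal.ofReal_le_ofReal ((measureReal_mono ?_).trans this)
      intro z hz
      exact ⟨csInf_le hK2.bddBelow (by simp [hz]), le_csSup hK2.bddAbove (by simp [hz])⟩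
    rw [Measure.real]
    exact ENNReal.toReal_le_of_le_ofReal (by positivity) hle

/-- With probability at least `19/20`, the empirical measure is close to `p` on all sets with few
boundary points. -/
theorem empMeasure_deviation (p : Measure ℝ) [IsProbabilityMeasure p] (m R : ℕ) :
    (Measure.infinitePi fun _ : ℕ => p)
      {x | ¬ ∀ (E : Finset ℝ) (A : Set ℝ), MeasurableSet A → Cut E A → E.card ≤ R →
        |(empMeasure (2 ^ m) x).real A - p.real A| ≤
          R / 2 ^ m + (m + 2) * √(20 * R / 2 ^ m)} ≤ 1 / 20 := by
  set n := 2 ^ m with hn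
  have hn0 : 0 < n := by positivity
  have hn' : (0 : ℝ) < n := by exact_mod_cast hn0
  set L := m + 2 with hLdef
  set P := Measure.infinitePi fun _ : ℕ => p
  obtain ⟨φ, hφ, hφle, hφs⟩ := exists_fibration p hn0
  have hφL : ∀ x, φ x < 2 ^ L := fun x => (hφle x).trans_lt (by rw [hLdef, pow_add]; omega)
  set D : (ℕ → ℝ) → ℝ := fun x => ∑ l ∈ Finset.range L, levelDev φ L p (empMeasure n x) l with hD
  have hterm : ∀ l j, Measurable fun x : ℕ → ℝ =>
      (p.real (cell φ l j) - (empMeasure n x).real (cell φ l j)) ^ 2 := fun l j =>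
    (measurable_const.sub (measurable_empMeasure_real n (measurableSet_cell hφ l j))).pow_const 2
  have hbd : ∀ (B : Set ℝ) x, |(empMeasure n x).real B - p.real B| ≤ 1 := by
    intro B x
    have := empMeasure_isProbability hn0 x
    have h1 : (empMeasure n x).real B ≤ 1 := measureReal_le_one
    have h2 : p.real B ≤ 1 := measureReal_le_one
    have h3 : 0 ≤ (empMeasure n x).real B := measureReal_nonneg
    have h4 : 0 ≤ p.real B := measureReal_nonneg
    rw [abs_le]; constructor <;> linarith
  have hint : ∀ l j, Integrable (fun x : ℕ → ℝ =>
      (p.real (cell φ l j) - (empMeasure n x).real (cell φ l j)) ^ 2) P := by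
    intro l j
    refine Integrable.of_bound (hterm l j).aestronglyMeasurable 1
      (Filter.Eventually.of_forall fun x => ?_)
    rw [Real.norm_eq_abs, abs_of_nonneg (sq_nonneg _), ← sq_abs, abs_sub_comm]
    exact pow_le_one₀ (abs_nonneg _) (hbd _ x)
  have hDint : Integrable D P :=
    integrable_finsetSum _ fun l _ => integrable_finsetSum _ fun j _ => hint l j
  have hlev : ∀ l, ∫ x, levelDev φ L p (empMeasure n x) l ∂P ≤ 1 / n := by
    intro l
    simp only [levelDev]
    rw [integral_finsetSum _ fun j _ => hint l j]
    have : ∀ j ∈ Finset.range (2 ^ L), ∫ x, (p.real (cell φ l j) -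
        (empMeasure n x).real (cell φ l j)) ^ 2 ∂P ≤ p.real (cell φ l j) / n := by
      intro j _
      refine le_trans (le_of_eq ?_)
        (integral_sq_empMeasure_sub_le p hn0 (measurableSet_cell hφ l j))
      exact integral_congr_ae (Filter.Eventually.of_forall fun x => by
        simp only; ring)
    refine (Finset.sum_le_sum this).trans ?_
    rw [← Finset.sum_div, ← measureReal_biUnion_cell hφ]
    gcongr
    exact measureReal_le_one
  have hDE : ∫ x, D x ∂P ≤ L / n := by
    simp only [hD]
    rw [integral_finsetSum (Finset.range L) (f := fun l x => levelDev φ L p (empMeasure n x) l)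
      fun l _ => integrable_finsetSum _ fun j _ => hint l j]
    refine (Finset.sum_le_sum fun l _ => hlev l).trans ?_
    simp [div_eq_mul_inv]
  have hD0 : 0 ≤ᵐ[P] D := Filter.Eventually.of_forall fun x =>
    Finset.sum_nonneg fun l _ => levelDev_nonneg _ _ _ _ _
  have hmarkov : P.real {x | 20 * L / n ≤ D x} ≤ 1 / 20 := by
    have := mul_meas_ge_le_integral_of_nonneg hD0 hDint (20 * L / n)
    have hL0 : (0 : ℝ) < L := by rw [hLdef]; positivity
    have hpos : (0 : ℝ) < L / n := by positivity
    have h2 : (L / n : ℝ) * (20 * P.real {x | 20 * L / n ≤ D x}) ≤ (L / n) * 1 := by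
      calc (L / n : ℝ) * (20 * P.real {x | 20 * L / n ≤ D x})
          = 20 * L / n * P.real {x | 20 * L / n ≤ D x} := by ring
        _ ≤ _ := this
        _ ≤ _ := by linarith
    have := le_of_mul_le_mul_left h2 hpos
    linarith
  have hmarkov' : P {x | 20 * L / n ≤ D x} ≤ 1 / 20 := by
    rw [← ofReal_measureReal]
    refine (ENNReal.ofReal_le_ofReal hmarkov).trans (le_of_eq ?_)
    rw [ENNReal.ofReal_div_of_pos (by norm_num)]
    simp
  refine (measure_mono fun x hx => ?_).trans hmarkov'
  simp only [mem_ofPred_eq] at hx ⊢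
  by_contra hlt
  push Not at hlt
  refine hx fun E A hAm hA hE => ?_
  have := empMeasure_isProbability hn0 x
  have h := abs_dev_le_of_cut hφ hφL p (empMeasure n x) (by positivity) hφs hAm hA hE hlt.le
  refine h.trans (le_of_eq ?_)
  have e1 : (n : ℝ) = 2 ^ m := by rw [hn]; push_cast; ring
  have e2 : (L : ℝ) * (R * (20 * L / n)) = ((m : ℝ) + 2) ^ 2 * (20 * R / 2 ^ m) := by
    rw [← e1, hLdef]; push_cast; ring
  rw [e2, Real.sqrt_mul (by positivity), Real.sqrt_sq (by positivity), e1]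
  ring

/-! ## Partitions and histograms -/

theorem breaks_mono {m : ℕ} {a : ℕ → ℝ} (ha : ∀ i < m, a i < a (i + 1)) {i j : ℕ} (hij : i ≤ j)
    (hj : j ≤ m) : a i ≤ a j := by
  induction j, hij using Nat.le_induction with
  | base => exact le_rfl
  | succ j _ ih => exact (ih (by omega)).trans (ha j (by omega)).le

theorem breaks_index_unique {m : ℕ} {a : ℕ → ℝ} (ha : ∀ i < m, a i < a (i + 1)) {i j : ℕ}
    (hi : i < m) (hj : j < m) {x : ℝ} (hxi : x ∈ Ico (a i) (a (i + 1)))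
    (hxj : x ∈ Ico (a j) (a (j + 1))) : i = j := by
  rcases lt_trichotomy i j with h | h | h
  · have := breaks_mono ha (show i + 1 ≤ j from h) hj.le
    linarith [hxi.2, hxj.1]
  · exact h
  · have := breaks_mono ha (show j + 1 ≤ i from h) hi.le
    linarith [hxj.2, hxi.1]

theorem exists_breaks_index {m : ℕ} {a : ℕ → ℝ} {x : ℝ} (hx : x ∈ Ico (a 0) (a m)) :
    ∃ i < m, x ∈ Ico (a i) (a (i + 1)) := by
  induction m with
  | zero => exact absurd hx.2 (not_lt.2 hx.1)
  | succ m ih =>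
    by_cases h : x < a m
    · obtain ⟨i, hi, h⟩ := ih ⟨hx.1, h⟩
      exact ⟨i, by omega, h⟩
    · exact ⟨m, by omega, not_lt.1 h, hx.2⟩

theorem measureReal_eq_sum_pieces (ρ : Measure ℝ) [IsFiniteMeasure ρ] {a : ℕ → ℝ} {m : ℕ}
    (ha : ∀ i < m, a i < a (i + 1)) {S : Set ℝ} (hS : S ⊆ Ico (a 0) (a m)) :
    ρ.real S = ∑ i ∈ Finset.range m, ρ.real (S ∩ Ico (a i) (a (i + 1))) := by
  have h : ∀ j ≤ m, ρ.real (S ∩ Ico (a 0) (a j)) =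
      ∑ i ∈ Finset.range j, ρ.real (S ∩ Ico (a i) (a (i + 1))) := by
    intro j hj
    induction j with
    | zero => simp
    | succ j ih =>
      rw [Finset.sum_range_succ, ← ih (by omega)]
      have h1 := breaks_mono ha (Nat.zero_le j) (by omega)
      have h2 := (ha j (by omega)).le
      rw [← measureReal_inter_add_sdiff (s := S ∩ Ico (a 0) (a (j + 1))) (t := Iio (a j))
        measurableSet_Iio]
      congr 2 <;> ext x <;> simp only [mem_inter_iff, mem_Ico, mem_Iio, mem_sdiff, not_lt]
      · constructor
        · rintro ⟨⟨hs, h3, h4⟩, h5⟩; exact ⟨hs, h3, h5⟩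
        · rintro ⟨hs, h3, h4⟩; exact ⟨⟨hs, h3, by linarith⟩, h4⟩
      · constructor
        · rintro ⟨⟨hs, h3, h4⟩, h5⟩; exact ⟨hs, h5, h4⟩
        · rintro ⟨hs, h3, h4⟩; exact ⟨⟨hs, by linarith, h4⟩, h3⟩
  rw [← h m le_rfl, inter_eq_self_of_subset_left hS]

theorem histDensity_eq {k : ℕ} {a c : ℕ → ℝ} (ha : ∀ i < k, a i < a (i + 1)) {i : ℕ} (hi : i < k)
    {x : ℝ} (hx : x ∈ Ico (a i) (a (i + 1))) : histDensity k a c x = c i := by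
  rw [histDensity, Finset.sum_eq_single i]
  · rw [indicator_of_mem hx]
  · intro j hj hne
    refine indicator_of_notMem (fun h => hne ?_) _
    exact breaks_index_unique ha (Finset.mem_range.1 hj) hi h hx
  · intro h; exact absurd (Finset.mem_range.2 hi) h

theorem histDensity_eq_zero {k : ℕ} {a c : ℕ → ℝ} (ha : ∀ i < k, a i < a (i + 1)) {x : ℝ}
    (hx : x ∉ Ico (a 0) (a k)) : histDensity k a c x = 0 := by
  refine Finset.sum_eq_zero fun i hi => indicator_of_notMem (fun h => hx ?_) _
  rw [Finset.mem_range] at hi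
  exact ⟨(breaks_mono ha (Nat.zero_le i) hi.le).trans h.1,
    h.2.trans_le (breaks_mono ha (show i + 1 ≤ k from hi) le_rfl)⟩

theorem measurable_histDensity (k : ℕ) (a c : ℕ → ℝ) : Measurable (histDensity k a c) := by
  have : histDensity k a c = fun x => ∑ i ∈ Finset.range k,
      (Ico (a i) (a (i + 1))).indicator (fun _ => c i) x := rfl
  rw [this]
  exact Finset.measurable_sum _ fun i _ => measurable_const.indicator measurableSet_Ico

theorem histMeasure_absolutelyContinuous (k : ℕ) (a c : ℕ → ℝ) : histMeasure k a c ≪ volume :=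
  withDensity_absolutelyContinuous _ _

theorem histMeasure_Ico {k : ℕ} {a c : ℕ → ℝ} (ha : ∀ i < k, a i < a (i + 1))
    {i : ℕ} (hi : i < k) (hc : 0 ≤ c i) {u v : ℝ} (huv : u ≤ v) (hu : a i ≤ u)
    (hv : v ≤ a (i + 1)) :
    (histMeasure k a c).real (Ico u v) = c i * (v - u) := by
  rw [Measure.real, histMeasure, withDensity_apply _ measurableSet_Ico,
    setLIntegral_congr_fun (g := fun _ => ENNReal.ofReal (c i)) measurableSet_Ico
      fun x hx => by
        rw [histDensity_eq ha hi ⟨hu.trans hx.1, hx.2.trans_le hv⟩]]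
  rw [setLIntegral_const, Real.volume_Ico, ENNReal.toReal_mul, ENNReal.toReal_ofReal hc,
    ENNReal.toReal_ofReal (by linarith)]

theorem IsHistogram.isProbabilityMeasure {k : ℕ} {a c : ℕ → ℝ} (h : IsHistogram k a c) :
    IsProbabilityMeasure (histMeasure k a c) := by
  have hfun : ∀ x, ENNReal.ofReal (histDensity k a c x) = ∑ i ∈ Finset.range k,
      (Ico (a i) (a (i + 1))).indicator (fun _ => ENNReal.ofReal (c i)) x := by
    intro x
    rw [histDensity, ENNReal.ofReal_sum_of_nonneg]
    · refine Finset.sum_congr rfl fun i _ => ?_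
      by_cases hx : x ∈ Ico (a i) (a (i + 1)) <;> simp only [indicator, hx, if_true, if_false,
        ENNReal.ofReal_zero]
    · intro i hi
      exact indicator_nonneg (fun _ _ => h.nonneg i (Finset.mem_range.1 hi)) x
  constructor
  rw [histMeasure, withDensity_apply _ MeasurableSet.univ, setLIntegral_univ]
  simp_rw [hfun]
  rw [lintegral_finsetSum _ fun i _ => measurable_const.indicator measurableSet_Ico]
  have : ∀ i ∈ Finset.range k, ∫⁻ x, (Ico (a i) (a (i + 1))).indicator
      (fun _ => ENNReal.ofReal (c i)) x = ENNReal.ofReal (c i * (a (i + 1) - a i)) := by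
    intro i hi
    have hi := Finset.mem_range.1 hi
    rw [lintegral_indicator_const measurableSet_Ico, Real.volume_Ico,
      ENNReal.ofReal_mul (h.nonneg i hi)]
  rw [Finset.sum_congr rfl this, ← ENNReal.ofReal_sum_of_nonneg, h.total, ENNReal.ofReal_one]
  intro i hi
  have hi := Finset.mem_range.1 hi
  exact mul_nonneg (h.nonneg i hi) (by linarith [h.lt i hi])

/-! ## Total variation distance -/

theorem abs_sub_real_le_one (p q : Measure ℝ) [IsProbabilityMeasure p] [IsProbabilityMeasure q]
    (A : Set ℝ) : |p.real A - q.real A| ≤ 1 := by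
  have h1 : p.real A ≤ 1 := measureReal_le_one
  have h2 : q.real A ≤ 1 := measureReal_le_one
  have h3 : 0 ≤ p.real A := measureReal_nonneg
  have h4 : 0 ≤ q.real A := measureReal_nonneg
  rw [abs_le]; constructor <;> linarith

theorem abs_sub_le_tvDist (p q : Measure ℝ) [IsProbabilityMeasure p] [IsProbabilityMeasure q]
    {A : Set ℝ} (hA : MeasurableSet A) : |p.real A - q.real A| ≤ tvDist p q := by
  refine le_ciSup (f := fun A : {A : Set ℝ // MeasurableSet A} => |p.real A.1 - q.real A.1|)
    ⟨1, ?_⟩ ⟨A, hA⟩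
  rintro _ ⟨B, rfl⟩
  exact abs_sub_real_le_one p q B.1

theorem tvDist_le {p q : Measure ℝ} {δ : ℝ}
    (h : ∀ A, MeasurableSet A → |p.real A - q.real A| ≤ δ) : tvDist p q ≤ δ := by
  have : Nonempty {A : Set ℝ // MeasurableSet A} := ⟨⟨∅, MeasurableSet.empty⟩⟩
  exact ciSup_le fun A => h A.1 A.2

theorem tvDist_nonneg (p q : Measure ℝ) : 0 ≤ tvDist p q := Real.iSup_nonneg fun _ => abs_nonneg _

/-! ## Cut sets -/

theorem Cut.singleton_finset (E : Finset ℝ) : Cut E (E : Set ℝ) :=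
  fun x hx _ _ => ⟨x, hx, left_mem_uIcc⟩

theorem cut_Ioo (a y : ℝ) : Cut {a, y} (Ioo a y) := by
  intro u hu v hv
  simp only [mem_Ioo, not_and_or, not_lt] at hu hv
  rcases hv with hv | hv
  · exact ⟨a, by simp, by rw [mem_uIcc]; right; exact ⟨hv, hu.1.le⟩⟩
  · exact ⟨y, by simp, by rw [mem_uIcc]; left; exact ⟨hu.2.le, hv⟩⟩

theorem cut_Ioc (a y : ℝ) : Cut {a, y} (Ioc a y) := by
  intro u hu v hv
  simp only [mem_Ioc, not_and_or, not_lt, not_le] at hu hv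
  rcases hv with hv | hv
  · exact ⟨a, by simp, by rw [mem_uIcc]; right; exact ⟨hv, hu.1.le⟩⟩
  · exact ⟨y, by simp, by rw [mem_uIcc]; left; exact ⟨hu.2, hv.le⟩⟩

theorem Cut.biUnion {S : Finset ℕ} {E : ℕ → Finset ℝ} {B : ℕ → Set ℝ}
    (h : ∀ j ∈ S, Cut (E j) (B j)) : Cut (S.biUnion E) (⋃ j ∈ S, B j) := by
  intro x hx y hy
  simp only [mem_iUnion, exists_prop, not_exists, not_and] at hx hy
  obtain ⟨j, hj, hx⟩ := hx
  obtain ⟨e, he, hxy⟩ := h j hj x hx y (hy j hj)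
  exact ⟨e, Finset.mem_biUnion.2 ⟨j, hj, he⟩, hxy⟩

theorem le_iff_of_notMem_uIcc {b x y : ℝ} (h : b ∉ uIcc x y) : b ≤ x ↔ b ≤ y := by
  rw [mem_uIcc] at h
  push Not at h
  constructor
  · intro hx
    by_contra hy
    exact absurd (h.2 (not_le.1 hy).le) (not_lt.2 hx)
  · intro hy
    by_contra hx
    exact absurd (h.1 (not_le.1 hx).le) (not_lt.2 hy)

theorem histDensity_congr {k : ℕ} {a c : ℕ → ℝ} {x y : ℝ} (h : ∀ i ≤ k, a i ≤ x ↔ a i ≤ y) :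
    histDensity k a c x = histDensity k a c y := by
  refine Finset.sum_congr rfl fun i hi => ?_
  have hi := Finset.mem_range.1 hi
  have : x ∈ Ico (a i) (a (i + 1)) ↔ y ∈ Ico (a i) (a (i + 1)) := by
    rw [mem_Ico, mem_Ico, ← not_le, ← not_le, h i hi.le, h (i + 1) hi]
  by_cases hx : x ∈ Ico (a i) (a (i + 1))
  · rw [indicator_of_mem hx, indicator_of_mem (this.1 hx)]
  · rw [indicator_of_notMem hx, indicator_of_notMem (fun h => hx (this.2 h))]

/-- The set where the histogram `(k, a, c)` is larger than the histogram `(l, b, d)`. -/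
def largerSet (k : ℕ) (a c : ℕ → ℝ) (l : ℕ) (b d : ℕ → ℝ) : Set ℝ :=
  {x | histDensity l b d x < histDensity k a c x}

theorem measurableSet_largerSet (k : ℕ) (a c : ℕ → ℝ) (l : ℕ) (b d : ℕ → ℝ) :
    MeasurableSet (largerSet k a c l b d) :=
  measurableSet_lt (measurable_histDensity l b d) (measurable_histDensity k a c)

theorem cut_largerSet (k : ℕ) (a c : ℕ → ℝ) (l : ℕ) (b d : ℕ → ℝ) :
    Cut ((Finset.range (k + 1)).image a ∪ (Finset.range (l + 1)).image b)
      (largerSet k a c l b d) := by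
  intro x hx y hy
  by_contra hno
  push Not at hno
  have h1 : histDensity k a c x = histDensity k a c y := histDensity_congr fun i hi =>
    le_iff_of_notMem_uIcc (hno _ (Finset.mem_union_left _
      (Finset.mem_image_of_mem _ (Finset.mem_range.2 (by omega)))))
  have h2 : histDensity l b d x = histDensity l b d y := histDensity_congr fun i hi =>
    le_iff_of_notMem_uIcc (hno _ (Finset.mem_union_right _
      (Finset.mem_image_of_mem _ (Finset.mem_range.2 (by omega)))))
  simp only [largerSet, mem_ofPred_eq, h1, h2] at hx hy
  exact hy hx

theorem sub_le_largerSet {k : ℕ} {a c : ℕ → ℝ} {l : ℕ} {b d : ℕ → ℝ} (hq : IsHistogram k a c)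
    (hh : IsHistogram l b d) {A : Set ℝ} (hA : MeasurableSet A) :
    (histMeasure k a c).real A - (histMeasure l b d).real A ≤
      (histMeasure k a c).real (largerSet k a c l b d) -
        (histMeasure l b d).real (largerSet k a c l b d) := by
  have := hq.isProbabilityMeasure
  have := hh.isProbabilityMeasure
  set S := largerSet k a c l b d with hSdef
  have hS : MeasurableSet S := measurableSet_largerSet _ _ _ _ _ _
  have h1 : (histMeasure k a c).real (A \ S) ≤ (histMeasure l b d).real (A \ S) := by
    refine ENNReal.toReal_mono (measure_ne_top _ _) ?_
    rw [histMeasure, histMeasure, withDensity_apply _ (hA.diff hS),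
      withDensity_apply _ (hA.diff hS)]
    refine setLIntegral_mono' (hA.diff hS) fun x hx => ENNReal.ofReal_le_ofReal ?_
    exact not_lt.1 hx.2
  have h2 : (histMeasure l b d).real (S \ A) ≤ (histMeasure k a c).real (S \ A) := by
    refine ENNReal.toReal_mono (measure_ne_top _ _) ?_
    rw [histMeasure, histMeasure, withDensity_apply _ (hS.diff hA),
      withDensity_apply _ (hS.diff hA)]
    refine setLIntegral_mono' (hS.diff hA) fun x hx => ENNReal.ofReal_le_ofReal ?_
    exact le_of_lt hx.1
  have e1 := measureReal_inter_add_sdiff (μ := histMeasure k a c) (s := A) hS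
  have e2 := measureReal_inter_add_sdiff (μ := histMeasure l b d) (s := A) hS
  have e3 := measureReal_inter_add_sdiff (μ := histMeasure k a c) (s := S) hA
  have e4 := measureReal_inter_add_sdiff (μ := histMeasure l b d) (s := S) hA
  rw [inter_comm] at e3 e4
  linarith

theorem abs_sub_le_largerSet {k : ℕ} {a c : ℕ → ℝ} {l : ℕ} {b d : ℕ → ℝ} (hq : IsHistogram k a c)
    (hh : IsHistogram l b d) {A : Set ℝ} (hA : MeasurableSet A) :
    |(histMeasure k a c).real A - (histMeasure l b d).real A| ≤
      (histMeasure k a c).real (largerSet k a c l b d) -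
        (histMeasure l b d).real (largerSet k a c l b d) := by
  have := hq.isProbabilityMeasure
  have := hh.isProbabilityMeasure
  have h1 := sub_le_largerSet hq hh hA
  have h2 := sub_le_largerSet hq hh hA.compl
  rw [probReal_compl_eq_one_sub hA, probReal_compl_eq_one_sub hA] at h2
  rw [abs_le]
  constructor <;> linarith

/-! ## Flat pieces fitted to a measure -/

/-- On `(a, a']` the measure `ν` is within `τ` of a multiple of Lebesgue measure. -/
def Fit (ν : Measure ℝ) (τ a a' : ℝ) : Prop :=
  ∃ c, 0 ≤ c ∧ ∀ y, a < y → y ≤ a' → |c * (y - a) - ν.real (Ioo a y)| ≤ τ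

/-- On `(a, a']` the measure `ν` is at distance at least `τ` from all multiples of Lebesgue
measure. -/
def Misfit (ν : Measure ℝ) (τ a a' : ℝ) : Prop :=
  ∀ c, 0 ≤ c → ∃ y, a < y ∧ y ≤ a' ∧
    (ν.real (Ioo a y) + τ ≤ c * (y - a) ∨ c * (y - a) + τ ≤ ν.real (Ioc a y))

/-- The empirical-type deviation bound: `ν` and `p` differ by at most `η` on sets with at most `R`
boundary points. -/
def CloseOnCuts (ν p : Measure ℝ) (R : ℕ) (η : ℝ) : Prop :=
  ∀ (E : Finset ℝ) (A : Set ℝ), MeasurableSet A → Cut E A → E.card ≤ R → |ν.real A - p.real A| ≤ η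

theorem card_le_of_separated {ν p q : Measure ℝ} [IsFiniteMeasure ν] [IsFiniteMeasure q]
    {R N : ℕ} {η Δ τ : ℝ} (hclose : CloseOnCuts ν p R η)
    (hΔ : ∀ A, MeasurableSet A → |p.real A - q.real A| ≤ Δ) (hR : 2 * (N + 1) ≤ R)
    (hN : η + Δ < τ * (N + 1)) {s : ℝ} (hs : |s| = 1) {S : Finset ℕ} {E : ℕ → Finset ℝ}
    {B : ℕ → Set ℝ} (hE : ∀ j ∈ S, (E j).card ≤ 2) (hcut : ∀ j ∈ S, Cut (E j) (B j))
    (hm : ∀ j ∈ S, MeasurableSet (B j)) (hd : ∀ i ∈ S, ∀ j ∈ S, i ≠ j → Disjoint (B i) (B j))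
    (hsep : ∀ j ∈ S, τ ≤ s * (ν.real (B j) - q.real (B j))) : S.card ≤ N := by
  by_contra hlt
  obtain ⟨S', hS', hcard⟩ := Finset.exists_subset_card_eq (show N + 1 ≤ S.card by omega)
  set A := ⋃ j ∈ S', B j with hA
  have hAm : MeasurableSet A := S'.measurableSet_biUnion fun j hj => hm j (hS' hj)
  have hAc : Cut (S'.biUnion E) A := Cut.biUnion fun j hj => hcut j (hS' hj)
  have hEc : (S'.biUnion E).card ≤ R := by
    refine (Finset.card_biUnion_le_card_mul S' E 2 fun j hj => hE j (hS' hj)).trans ?_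
    rw [hcard]; omega
  have hsum : ∀ ρ : Measure ℝ, IsFiniteMeasure ρ → ρ.real A = ∑ j ∈ S', ρ.real (B j) := by
    intro ρ _
    exact measureReal_biUnion_finset (fun i hi j hj hij => hd i (hS' hi) j (hS' hj) hij)
      fun j hj => hm j (hS' hj)
  have h1 : (N + 1 : ℝ) * τ ≤ s * (ν.real A - q.real A) := by
    rw [hsum ν inferInstance, hsum q inferInstance, ← Finset.sum_sub_distrib, Finset.mul_sum]
    have := Finset.card_nsmul_le_sum S' _ τ fun j hj => hsep j (hS' hj)
    rw [hcard, nsmul_eq_mul] at this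
    push_cast at this
    exact this
  have h2 := hclose _ A hAm hAc hEc
  have h3 := hΔ A hAm
  have h4 : s * (ν.real A - q.real A) ≤ |ν.real A - q.real A| := by
    refine (le_abs_self _).trans ?_
    rw [abs_mul, hs, one_mul]
  have h5 : |ν.real A - q.real A| ≤ η + Δ := by
    have := abs_sub_le (ν.real A) (p.real A) (q.real A)
    linarith
  linarith [mul_comm τ (N + 1 : ℝ)]

theorem card_jumps_le {l k : ℕ} {a e : ℕ → ℝ} (ha : ∀ i < l, a i < a (i + 1)) :
    ((Finset.range l).filter fun j => ∃ i < k, e (i + 1) ∈ Ioo (a j) (a (j + 1))).card ≤ k := by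
  classical
  set J := (Finset.range l).filter fun j => ∃ i < k, e (i + 1) ∈ Ioo (a j) (a (j + 1))
  have h : ∀ j ∈ J, ∃ i < k, e (i + 1) ∈ Ioo (a j) (a (j + 1)) := fun j hj =>
    (Finset.mem_filter.1 hj).2
  choose! f hf hfe using h
  have := Finset.card_le_card_of_injOn f (s := J) (t := Finset.range k)
    (fun j hj => Finset.mem_range.2 (hf j hj)) (fun i hi j hj hij => by
      refine breaks_index_unique ha (Finset.mem_range.1 (Finset.mem_filter.1 hi).1)
        (Finset.mem_range.1 (Finset.mem_filter.1 hj).1) (Ioo_subset_Ico_self (hfe i hi)) ?_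
      rw [hij]
      exact Ioo_subset_Ico_self (hfe j hj))
  simpa using this

/-- The number of misfitting pieces is bounded in terms of the distance to a histogram. -/
theorem card_misfit_le {ν p : Measure ℝ} [IsFiniteMeasure ν] {k : ℕ} {e d : ℕ → ℝ}
    (hq : IsHistogram k e d) {R N : ℕ} {η Δ τ : ℝ} (hclose : CloseOnCuts ν p R η)
    (hΔ : ∀ A, MeasurableSet A → |p.real A - (histMeasure k e d).real A| ≤ Δ)
    (hR : 2 * (N + 1) ≤ R) (hN : η + Δ < τ * (N + 1)) {l : ℕ} {a : ℕ → ℝ}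
    (ha : ∀ i < l, a i < a (i + 1)) (ha0 : 0 ≤ a 0) (ha1 : a l ≤ 1)
    (hmis : ∀ j < l, Misfit ν τ (a j) (a (j + 1))) : l ≤ k + 2 * N := by
  classical
  have := hq.isProbabilityMeasure
  set q := histMeasure k e d with hqdef
  have hatom : ∀ x : ℝ, q {x} = 0 := fun x =>
    histMeasure_absolutelyContinuous k e d (by simp)
  have : NullSingletonClass q := ⟨hatom⟩
  set J := (Finset.range l).filter fun j => ∃ i < k, e (i + 1) ∈ Ioo (a j) (a (j + 1)) with hJ
  have hflat : ∀ j ∈ (Finset.range l) \ J, ∃ y, a j < y ∧ y ≤ a (j + 1) ∧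
      (τ ≤ (-1) * (ν.real (Ioo (a j) y) - q.real (Ioo (a j) y)) ∨
        τ ≤ 1 * (ν.real (Ioc (a j) y) - q.real (Ioc (a j) y))) := by
    intro j hj
    simp only [hJ, Finset.mem_sdiff, Finset.mem_range, Finset.mem_filter, not_and, not_exists] at hj
    obtain ⟨hjl, hj⟩ := hj
    have hj := hj hjl
    have hj0 : 0 ≤ a j := ha0.trans (breaks_mono ha (Nat.zero_le j) hjl.le)
    have hj1 : a (j + 1) ≤ 1 := (breaks_mono ha hjl le_rfl).trans ha1
    obtain ⟨t, ht, hat⟩ := exists_breaks_index (a := e) (m := k) (x := a j)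
      ⟨by rw [hq.left]; exact hj0, by rw [hq.right]; linarith [ha j hjl]⟩
    have hte : a (j + 1) ≤ e (t + 1) := by
      by_contra hlt
      exact hj t ht ⟨hat.2, not_le.1 hlt⟩
    obtain ⟨y, hy0, hy1, hy⟩ := hmis j hjl (d t) (hq.nonneg t ht)
    refine ⟨y, hy0, hy1, ?_⟩
    have h1 : q.real (Ico (a j) y) = d t * (y - a j) :=
      histMeasure_Ico hq.lt ht (hq.nonneg t ht) hy0.le hat.1 (hy1.trans hte)
    have h2 : q.real (Ioo (a j) y) = d t * (y - a j) := by
      rw [← h1]; exact measureReal_congr Ioo_ae_eq_Ico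
    have h3 : q.real (Ioc (a j) y) = d t * (y - a j) := by
      rw [← h2]; exact measureReal_congr Ioo_ae_eq_Ioc.symm
    rw [h2, h3]
    rcases hy with h | h
    · left; linarith
    · right; linarith
  choose! y hy0 hy1 hy using hflat
  set S1 := ((Finset.range l) \ J).filter fun j =>
    τ ≤ (-1) * (ν.real (Ioo (a j) (y j)) - q.real (Ioo (a j) (y j))) with hS1
  set S2 := ((Finset.range l) \ J).filter fun j =>
    τ ≤ 1 * (ν.real (Ioc (a j) (y j)) - q.real (Ioc (a j) (y j))) with hS2
  have hdisj : ∀ i ∈ (Finset.range l) \ J, ∀ j ∈ (Finset.range l) \ J, i ≠ j →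
      Disjoint (Ioc (a i) (y i)) (Ioc (a j) (y j)) := by
    intro i hi j hj hij
    refine disjoint_left.2 fun x hx hx' => ?_
    have hil := Finset.mem_range.1 (Finset.mem_sdiff.1 hi).1
    have hjl := Finset.mem_range.1 (Finset.mem_sdiff.1 hj).1
    have hyi := hy1 i hi
    have hyj := hy1 j hj
    rcases lt_or_gt_of_ne hij with h | h
    · have := breaks_mono ha (show i + 1 ≤ j from h) hjl.le
      linarith [hx.2, hx'.1]
    · have := breaks_mono ha (show j + 1 ≤ i from h) hil.le
      linarith [hx.1, hx'.2]
  have c1 : S1.card ≤ N := by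
    refine card_le_of_separated (E := fun j => {a j, y j}) (B := fun j => Ioo (a j) (y j)) hclose hΔ
      hR hN (s := -1) (by norm_num) (fun j _ => Finset.card_le_two) (fun j _ => cut_Ioo _ _)
      (fun j _ => measurableSet_Ioo) ?_ (fun j hj => (Finset.mem_filter.1 hj).2)
    intro i hi j hj hij
    exact (hdisj i (Finset.mem_filter.1 hi).1 j (Finset.mem_filter.1 hj).1 hij).mono
      Ioo_subset_Ioc_self Ioo_subset_Ioc_self
  have c2 : S2.card ≤ N := by
    refine card_le_of_separated (E := fun j => {a j, y j}) (B := fun j => Ioc (a j) (y j)) hclose hΔ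
      hR hN (s := 1) (by norm_num) (fun j _ => Finset.card_le_two) (fun j _ => cut_Ioc _ _)
      (fun j _ => measurableSet_Ioc) ?_ (fun j hj => (Finset.mem_filter.1 hj).2)
    intro i hi j hj hij
    exact hdisj i (Finset.mem_filter.1 hi).1 j (Finset.mem_filter.1 hj).1 hij
  have c3 : J.card ≤ k := card_jumps_le ha
  have hcover : Finset.range l ⊆ J ∪ (S1 ∪ S2) := by
    intro j hj
    by_cases hjJ : j ∈ J
    · exact Finset.mem_union_left _ hjJ
    · have hj' : j ∈ (Finset.range l) \ J := Finset.mem_sdiff.2 ⟨hj, hjJ⟩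
      refine Finset.mem_union_right _ ?_
      rcases hy j hj' with h | h
      · exact Finset.mem_union_left _ (Finset.mem_filter.2 ⟨hj', h⟩)
      · exact Finset.mem_union_right _ (Finset.mem_filter.2 ⟨hj', h⟩)
  have := Finset.card_le_card hcover
  rw [Finset.card_range] at this
  have h1 := Finset.card_union_le J (S1 ∪ S2)
  have h2 := Finset.card_union_le S1 S2
  omega

/-- The excess of `ν` over its flattening on a subinterval of a fitted piece. -/
theorem fit_excess_le {ν : Measure ℝ} [IsFiniteMeasure ν] {τ a a' u v : ℝ} (hfit : Fit ν τ a a')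
    (haa : a < a') (hu : a ≤ u) (huv : u < v) (hv : v ≤ a') :
    ν.real (Ico u v) - ν.real (Ico a a') / (a' - a) * (v - u) ≤
      (if v < a' then 2 * τ else 0) + (if a < u then 2 * τ else 0) +
        (if u = a ∧ v < a' then ν.real {a} else 0) := by
  obtain ⟨c, hc, hfit⟩ := hfit
  have hw : 0 < a' - a := by linarith
  set r := ν.real (Ioo a a') / (a' - a) with hr
  have hrw : r * (a' - a) = ν.real (Ioo a a') := by rw [hr]; field_simp
  have hsplit : ∀ y, a < y → ν.real (Ico a y) = ν.real {a} + ν.real (Ioo a y) := by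
    intro y hy
    rw [← measureReal_union (by simp) measurableSet_Ioo]
    congr 1
    exact (insert_eq a (Ioo a y)).symm.trans (Ioo_insert_left hy) |>.symm
  have hG : ∀ y, a < y → y ≤ a' → |ν.real (Ioo a y) - r * (y - a)| ≤ 2 * τ := by
    intro y hy hy'
    have h1 := hfit y hy hy'
    have h2 := hfit a' haa le_rfl
    rw [← hrw, ← sub_mul, abs_mul, abs_of_pos hw] at h2
    have h3 : |(c - r) * (y - a)| ≤ τ := by
      rw [abs_mul, abs_of_pos (show 0 < y - a by linarith)]
      exact (mul_le_mul_of_nonneg_left (by linarith) (abs_nonneg _)).trans h2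
    have : ν.real (Ioo a y) - r * (y - a) =
        (c - r) * (y - a) - (c * (y - a) - ν.real (Ioo a y)) := by ring
    rw [this]
    exact (abs_sub _ _).trans (by linarith)
  have hrle : r ≤ ν.real (Ico a a') / (a' - a) := by
    rw [hr]
    exact div_le_div_of_nonneg_right (measureReal_mono Ioo_subset_Ico_self) hw.le
  have hmul : r * (v - u) ≤ ν.real (Ico a a') / (a' - a) * (v - u) :=
    mul_le_mul_of_nonneg_right hrle (by linarith)
  have hGv : ν.real (Ioo a v) - r * (v - a) ≤ if v < a' then 2 * τ else 0 := by
    split_ifs with h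
    · exact (le_abs_self _).trans (hG v (by linarith) hv)
    · have : v = a' := le_antisymm hv (not_lt.1 h)
      rw [this, hrw, sub_self]
  rcases hu.eq_or_lt with rfl | hau
  · rw [hsplit v huv]
    by_cases hva : v < a'
    · rw [if_pos hva] at hGv
      rw [if_pos hva, if_neg (lt_irrefl _), if_pos ⟨rfl, hva⟩]
      linarith
    · have : v = a' := le_antisymm hv (not_lt.1 hva)
      subst this
      rw [if_neg hva, if_neg (lt_irrefl _), if_neg (by simp), div_mul_cancel₀ _ hw.ne', hsplit _ haa]
      linarith
  · have h1 : ν.real (Ico u v) = ν.real (Ioo a v) - ν.real (Ioo a u) := by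
      rw [← measureReal_sdiff (Ioo_subset_Ioo_right huv.le) measurableSet_Ioo]
      congr 1
      ext x
      simp only [mem_Ico, mem_sdiff, mem_Ioo, not_and, not_lt]
      constructor
      · rintro ⟨h1, h2⟩; exact ⟨⟨by linarith, h2⟩, fun _ => h1⟩
      · rintro ⟨⟨h1, h2⟩, h3⟩; exact ⟨h3 h1, h2⟩
    have h2 := (abs_le.1 (hG u hau (by linarith))).1
    rw [h1, if_pos hau, if_neg (show ¬(u = a ∧ v < a') from fun h => hau.ne' h.1)]
    have : r * (v - a) - r * (u - a) = r * (v - u) := by ring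
    linarith

theorem sum_indicator_Ioo_le_one {l : ℕ} {a : ℕ → ℝ} (ha : ∀ i < l, a i < a (i + 1)) (x : ℝ) :
    ∑ j ∈ Finset.range l, (if x ∈ Ioo (a j) (a (j + 1)) then (1 : ℝ) else 0) ≤ 1 := by
  rw [Finset.sum_boole]
  have : ((Finset.range l).filter fun j => x ∈ Ioo (a j) (a (j + 1))).card ≤ 1 := by
    refine Finset.card_le_one.2 fun i hi j hj => ?_
    rw [Finset.mem_filter, Finset.mem_range] at hi hj
    exact breaks_index_unique ha hi.1 hj.1 (Ioo_subset_Ico_self hi.2) (Ioo_subset_Ico_self hj.2)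
  exact_mod_cast this

/-- The flattening of `ν` along fitted pieces is almost as close to a histogram as `p` is. -/
theorem flattening_close {ν p : Measure ℝ} [IsFiniteMeasure ν] [IsFiniteMeasure p]
    {k : ℕ} {e d : ℕ → ℝ}
    (hq : IsHistogram k e d) {R : ℕ} {η Δ τ κ : ℝ} (hτ : 0 ≤ τ) (hclose : CloseOnCuts ν p R η)
    (hΔ : ∀ A, MeasurableSet A → |p.real A - (histMeasure k e d).real A| ≤ Δ)
    {l : ℕ} {a ht : ℕ → ℝ} (hh : IsHistogram l a ht)
    (hht : ∀ j < l, ht j = ν.real (Ico (a j) (a (j + 1))) / (a (j + 1) - a j))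
    (hfit : ∀ j < l, Fit ν τ (a j) (a (j + 1)))
    (hR : l + k + 2 ≤ R) (hκ0 : 0 ≤ κ) (hκ : WellBehaved κ p) {A : Set ℝ} (hA : MeasurableSet A) :
    |(histMeasure k e d).real A - (histMeasure l a ht).real A| ≤
      Δ + 2 * η + 4 * k * τ + k * κ := by
  classical
  have := hq.isProbabilityMeasure
  have := hh.isProbabilityMeasure
  refine (abs_sub_le_largerSet hq hh hA).trans ?_
  set q := histMeasure k e d with hqdef
  set h := histMeasure l a ht with hhdef
  set S := largerSet k e d l a ht with hSdef
  have hSm : MeasurableSet S := measurableSet_largerSet _ _ _ _ _ _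
  have h1 := (abs_le.1 (hΔ S hSm)).1
  have h2 : |ν.real S - p.real S| ≤ η := by
    refine hclose _ S hSm (cut_largerSet _ _ _ _ _ _) ?_
    refine (Finset.card_union_le _ _).trans ?_
    have c1 := Finset.card_image_le (s := Finset.range (k + 1)) (f := e)
    have c2 := Finset.card_image_le (s := Finset.range (l + 1)) (f := a)
    rw [Finset.card_range] at c1 c2
    omega
  have h2 := (abs_le.1 h2).1
  suffices hmain : ν.real S - h.real S ≤ 4 * k * τ + k * κ + η by linarith
  set P : ℕ → ℕ → Set ℝ := fun t j => Ico (e t) (e (t + 1)) ∩ Ico (a j) (a (j + 1)) with hP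
  have hSI : S ⊆ Ico 0 1 := by
    intro x hx
    by_contra hx'
    have z1 := histDensity_eq_zero (c := d) hq.lt (x := x) (by rwa [hq.left, hq.right])
    have z2 := histDensity_eq_zero (c := ht) hh.lt (x := x) (by rwa [hh.left, hh.right])
    simp only [hSdef, largerSet, mem_ofPred_eq, z1, z2, lt_irrefl] at hx
  have hdecomp : ∀ ρ : Measure ℝ, IsFiniteMeasure ρ → ρ.real S =
      ∑ t ∈ Finset.range k, ∑ j ∈ Finset.range l, ρ.real (S ∩ P t j) := by
    intro ρ _
    rw [measureReal_eq_sum_pieces ρ hq.lt (by rwa [hq.left, hq.right])]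
    refine Finset.sum_congr rfl fun t _ => ?_
    rw [measureReal_eq_sum_pieces ρ hh.lt (S := S ∩ Ico (e t) (e (t + 1)))
      (by rw [hh.left, hh.right]; exact inter_subset_left.trans hSI)]
    refine Finset.sum_congr rfl fun j _ => ?_
    rw [inter_assoc]
  set J := (Finset.range l).filter fun j => ∃ i < k, e (i + 1) ∈ Ioo (a j) (a (j + 1)) with hJ
  set f1 : ℕ → ℕ → ℝ := fun t j => if e (t + 1) ∈ Ioo (a j) (a (j + 1)) then 1 else 0 with hf1
  set f2 : ℕ → ℕ → ℝ := fun t j => if e t ∈ Ioo (a j) (a (j + 1)) then 1 else 0 with hf2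
  set f3 : ℕ → ℕ → ℝ := fun t j =>
    if a j ∈ Ico (e t) (e (t + 1)) ∧ j ∈ J then ν.real {a j} else 0 with hf3
  have f1_nonneg : ∀ t j, 0 ≤ f1 t j := fun t j => by simp only [hf1]; split_ifs <;> norm_num
  have f2_nonneg : ∀ t j, 0 ≤ f2 t j := fun t j => by simp only [hf2]; split_ifs <;> norm_num
  have f3_nonneg : ∀ t j, 0 ≤ f3 t j := fun t j => by
    simp only [hf3]; split_ifs <;> first | exact measureReal_nonneg | exact le_rfl
  have hpiece : ∀ t < k, ∀ j < l, ν.real (S ∩ P t j) - h.real (S ∩ P t j) ≤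
      2 * τ * f1 t j + 2 * τ * f2 t j + f3 t j := by
    intro t ht' j hj
    have hpos : 0 ≤ 2 * τ * f1 t j + 2 * τ * f2 t j + f3 t j := by
      have := f1_nonneg t j
      have := f2_nonneg t j
      have := f3_nonneg t j
      positivity
    rcases (S ∩ P t j).eq_empty_or_nonempty with hem | ⟨x, hxS, hxP⟩
    · rw [hem]; simpa using hpos
    have hall : S ∩ P t j = P t j := by
      refine inter_eq_self_of_subset_right fun z hz => ?_
      simp only [hSdef, largerSet, mem_ofPred_eq] at hxS ⊢
      rw [histDensity_eq hq.lt ht' hxP.1, histDensity_eq hh.lt hj hxP.2] at hxS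
      rw [histDensity_eq hq.lt ht' hz.1, histDensity_eq hh.lt hj hz.2]
      exact hxS
    have hPe : P t j = Ico (max (e t) (a j)) (min (e (t + 1)) (a (j + 1))) := Ico_inter_Ico
    rw [hall, hPe]
    have hx : x ∈ Ico (max (e t) (a j)) (min (e (t + 1)) (a (j + 1))) := hPe ▸ hxP
    have huv := hx.1.trans_lt hx.2
    rw [hhdef, histMeasure_Ico hh.lt hj (hh.nonneg j hj) huv.le (le_max_right _ _)
      (min_le_right _ _), hht j hj]
    refine (fit_excess_le (hfit j hj) (hh.lt j hj) (le_max_right _ _) huv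
      (min_le_right _ _)).trans ?_
    have x1 := hxP.1.1
    have x2 := hxP.1.2
    have x3 := hxP.2.1
    have x4 := hxP.2.2
    refine add_le_add (add_le_add ?_ ?_) ?_
    · split_ifs with hlt
      · have : e (t + 1) ∈ Ioo (a j) (a (j + 1)) := by
          rw [min_lt_iff] at hlt
          exact ⟨by linarith, by rcases hlt with h | h; exacts [h, absurd h (lt_irrefl _)]⟩
        simp only [hf1, if_pos this]; linarith
      · have := f1_nonneg t j; positivity
    · split_ifs with hlt
      · have : e t ∈ Ioo (a j) (a (j + 1)) := by
          rw [lt_max_iff] at hlt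
          exact ⟨by rcases hlt with h | h; exacts [h, absurd h (lt_irrefl _)], by linarith⟩
        simp only [hf2, if_pos this]; linarith
      · have := f2_nonneg t j; positivity
    · split_ifs with hlt
      · have hj1 : e (t + 1) ∈ Ioo (a j) (a (j + 1)) := by
          have := hlt.2
          rw [min_lt_iff] at this
          exact ⟨by linarith, by rcases this with h | h; exacts [h, absurd h (lt_irrefl _)]⟩
        have hj2 : a j ∈ Ico (e t) (e (t + 1)) := ⟨max_eq_right_iff.1 hlt.1, hj1.1⟩
        have hjJ : j ∈ J := Finset.mem_filter.2 ⟨Finset.mem_range.2 hj, t, ht', hj1⟩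
        simp only [hf3, if_pos (show _ ∧ _ from ⟨hj2, hjJ⟩)]; exact le_rfl
      · exact f3_nonneg t j
  have s1 : ∑ t ∈ Finset.range k, ∑ j ∈ Finset.range l, f1 t j ≤ k := by
    refine (Finset.sum_le_sum fun t _ => sum_indicator_Ioo_le_one hh.lt (e (t + 1))).trans ?_
    simp
  have s2 : ∑ t ∈ Finset.range k, ∑ j ∈ Finset.range l, f2 t j ≤ k := by
    refine (Finset.sum_le_sum fun t _ => sum_indicator_Ioo_le_one hh.lt (e t)).trans ?_
    simp
  have s3 : ∑ t ∈ Finset.range k, ∑ j ∈ Finset.range l, f3 t j ≤ k * κ + η := by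
    rw [Finset.sum_comm]
    have hinner : ∀ j ∈ Finset.range l, ∑ t ∈ Finset.range k, f3 t j ≤
        if j ∈ J then ν.real {a j} else 0 := by
      intro j _
      by_cases hjJ : j ∈ J
      · simp only [hf3, hjJ, and_true, if_true]
        have : ∀ t ∈ Finset.range k, (if a j ∈ Ico (e t) (e (t + 1)) then ν.real {a j} else 0) =
            ν.real {a j} * (if a j ∈ Ico (e t) (e (t + 1)) then 1 else 0) := by
          intro t _; split_ifs <;> simp
        rw [Finset.sum_congr rfl this, ← Finset.mul_sum, Finset.sum_boole]
        refine mul_le_of_le_one_right measureReal_nonneg ?_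
        have : ((Finset.range k).filter fun t => a j ∈ Ico (e t) (e (t + 1))).card ≤ 1 := by
          refine Finset.card_le_one.2 fun s hs t ht => ?_
          rw [Finset.mem_filter, Finset.mem_range] at hs ht
          exact breaks_index_unique hq.lt hs.1 ht.1 hs.2 ht.2
        exact_mod_cast this
      · simp [hf3, hjJ]
    refine (Finset.sum_le_sum hinner).trans ?_
    rw [← Finset.sum_filter]
    have hfilt : (Finset.range l).filter (fun j => j ∈ J) = J := by
      ext j; simp only [Finset.mem_filter, Finset.mem_range, hJ]; tauto
    rw [hfilt]
    have hJl : ∀ j ∈ J, j < l := fun j hj => Finset.mem_range.1 (Finset.mem_filter.1 hj).1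
    have hinj : ∀ i ∈ J, ∀ j ∈ J, a i = a j → i = j := fun i hi j hj hij =>
      breaks_index_unique hh.lt (hJl i hi) (hJl j hj) ⟨le_rfl, hh.lt i (hJl i hi)⟩
        (by rw [hij]; exact ⟨le_rfl, hh.lt j (hJl j hj)⟩)
    have hsum : ∀ ρ : Measure ℝ, IsFiniteMeasure ρ →
        ρ.real (↑(J.image a) : Set ℝ) = ∑ j ∈ J, ρ.real {a j} := by
      intro ρ _
      rw [← sum_measureReal_singleton, Finset.sum_image hinj]
    have hJk : J.card ≤ k := card_jumps_le hh.lt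
    have hp : p.real (↑(J.image a) : Set ℝ) ≤ k * κ := by
      rw [hsum p inferInstance]
      have : ∀ j ∈ J, p.real {a j} ≤ κ := by
        intro j hj
        refine hκ _ ⟨?_, ?_⟩
        · rw [← hh.left]; exact breaks_mono hh.lt (Nat.zero_le j) (hJl j hj).le
        · rw [← hh.right]
          exact (hh.lt j (hJl j hj)).trans_le (breaks_mono hh.lt (hJl j hj) le_rfl)
      refine (Finset.sum_le_card_nsmul _ _ _ this).trans ?_
      rw [nsmul_eq_mul]
      exact mul_le_mul_of_nonneg_right (by exact_mod_cast hJk) hκ0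
    have hc := hclose (J.image a) _ (J.image a).measurableSet (Cut.singleton_finset _)
      (Finset.card_image_le.trans (by omega))
    rw [← hsum ν inferInstance]
    linarith [(abs_le.1 hc).2]
  rw [hdecomp ν inferInstance, hdecomp h inferInstance, ← Finset.sum_sub_distrib]
  simp_rw [← Finset.sum_sub_distrib]
  calc _ ≤ ∑ t ∈ Finset.range k, ∑ j ∈ Finset.range l,
        (2 * τ * f1 t j + 2 * τ * f2 t j + f3 t j) :=
        Finset.sum_le_sum fun t ht' => Finset.sum_le_sum fun j hj =>
          hpiece t (Finset.mem_range.1 ht') j (Finset.mem_range.1 hj)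
    _ = 2 * τ * ∑ t ∈ Finset.range k, ∑ j ∈ Finset.range l, f1 t j +
        2 * τ * ∑ t ∈ Finset.range k, ∑ j ∈ Finset.range l, f2 t j +
        ∑ t ∈ Finset.range k, ∑ j ∈ Finset.range l, f3 t j := by
        simp only [Finset.sum_add_distrib, Finset.mul_sum]
    _ ≤ 2 * τ * k + 2 * τ * k + (k * κ + η) := by gcongr
    _ = _ := by ring

/-! ## The one-pass scan of the sorted samples -/

theorem empMeasure_perm {n : ℕ} {x s : ℕ → ℝ}
    (h : ((List.range n).map s).Perm ((List.range n).map x)) : empMeasure n s = empMeasure n x := by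
  have key : ∀ g : ℕ → ℝ, ∑ i ∈ Finset.range n, Measure.dirac (g i) =
      (((List.range n).map g).map fun y => Measure.dirac y).sum := by
    intro g
    rw [List.map_map, Finset.sum_list_map_count]
    rw [List.toFinset_range]
    refine Finset.sum_congr rfl fun i hi => ?_
    rw [List.count_eq_one_of_mem (List.nodup_range) (by simpa using hi), one_smul]
    rfl
  rw [empMeasure, empMeasure, key, key, (h.map _).sum_eq]

theorem le_empMeasure_real {n : ℕ} {s : ℕ → ℝ} {B : Set ℝ} (hB : MeasurableSet B) {u v : ℕ}
    (hv : v ≤ n) (h : ∀ j, u ≤ j → j < v → s j ∈ B) :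
    ((v : ℝ) - u) / n ≤ (empMeasure n s).real B := by
  rw [empMeasure_real n s hB]
  refine div_le_div_of_nonneg_right ?_ (Nat.cast_nonneg n)
  have h1 : ∑ j ∈ Finset.Ico u v, B.indicator (fun _ => (1 : ℝ)) (s j) ≤
      ∑ i ∈ Finset.range n, B.indicator (fun _ => (1 : ℝ)) (s i) := by
    refine Finset.sum_le_sum_of_subset_of_nonneg (fun j hj => ?_) fun j _ _ =>
      indicator_nonneg (fun _ _ => zero_le_one) _
    rw [Finset.mem_Ico] at hj
    exact Finset.mem_range.2 (by omega)
  refine le_trans ?_ h1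
  rw [Finset.sum_congr rfl (g := fun _ => (1 : ℝ)) fun j hj => by
    rw [Finset.mem_Ico] at hj; exact indicator_of_mem (h j hj.1 hj.2) _]
  simp only [Finset.sum_const, Nat.card_Ico, nsmul_eq_mul, mul_one]
  rcases le_total u v with huv | huv
  · rw [Nat.cast_sub huv]
  · have : (v : ℝ) ≤ u := by exact_mod_cast huv
    have : (0 : ℝ) ≤ ((v - u : ℕ) : ℝ) := Nat.cast_nonneg _
    linarith

theorem empMeasure_real_le {n : ℕ} {s : ℕ → ℝ} {B : Set ℝ} (hB : MeasurableSet B) {u v : ℕ}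
    (huv : u ≤ v) (h : ∀ j < n, s j ∈ B → u ≤ j ∧ j < v) :
    (empMeasure n s).real B ≤ ((v : ℝ) - u) / n := by
  rw [empMeasure_real n s hB]
  refine div_le_div_of_nonneg_right ?_ (Nat.cast_nonneg n)
  have h1 : ∀ i ∈ Finset.range n, B.indicator (fun _ => (1 : ℝ)) (s i) ≤
      if i ∈ Finset.Ico u v then 1 else 0 := by
    intro i hi
    by_cases hiB : s i ∈ B
    · rw [if_pos (Finset.mem_Ico.2 (h i (Finset.mem_range.1 hi) hiB)), indicator_of_mem hiB]
    · rw [indicator_of_notMem hiB]; split_ifs <;> norm_num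
  refine (Finset.sum_le_sum h1).trans ?_
  rw [Finset.sum_boole, ← Nat.cast_sub huv]
  have : ((Finset.range n).filter fun i => i ∈ Finset.Ico u v).card ≤ (Finset.Ico u v).card :=
    Finset.card_le_card fun i hi => (Finset.mem_filter.1 hi).2
  rw [Nat.card_Ico] at this
  exact_mod_cast this

theorem empMeasure_real_eq {n : ℕ} {s : ℕ → ℝ} {B : Set ℝ} (hB : MeasurableSet B) {u v : ℕ}
    (huv : u ≤ v) (hv : v ≤ n) (h : ∀ j < n, s j ∈ B ↔ u ≤ j ∧ j < v) :
    (empMeasure n s).real B = ((v : ℝ) - u) / n :=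
  le_antisymm (empMeasure_real_le hB huv fun j hj hjB => (h j hj).1 hjB)
    (le_empMeasure_real hB hv fun j h1 h2 => (h j (by omega)).2 ⟨h1, h2⟩)

/-- `N` is the number of entries of the sorted sequence `s` below `y`. -/
def IsRank (s : ℕ → ℝ) (n : ℕ) (y : ℝ) (N : ℕ) : Prop := N ≤ n ∧ ∀ j < n, s j < y ↔ j < N

/-- `N` is the number of entries of the sorted sequence `s` that are at most `y`. -/
def IsRankLE (s : ℕ → ℝ) (n : ℕ) (y : ℝ) (N : ℕ) : Prop := N ≤ n ∧ ∀ j < n, s j ≤ y ↔ j < N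

/-- `s` is nondecreasing on `{0, …, n - 1}`. -/
def SortedUpTo (s : ℕ → ℝ) (n : ℕ) : Prop := ∀ i j, i ≤ j → j < n → s i ≤ s j

theorem SortedUpTo.exists_isRank {s : ℕ → ℝ} {n : ℕ} (hs : SortedUpTo s n) (y : ℝ) :
    ∃ N, IsRank s n y N := by
  classical
  have hex : ∃ N, N = n ∨ (N < n ∧ y ≤ s N) := ⟨n, Or.inl rfl⟩
  have hmin := fun m => Nat.find_min hex (m := m)
  refine ⟨Nat.find hex, ?_, fun j hj => ⟨fun h => ?_, fun h => ?_⟩⟩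
  · rcases Nat.find_spec hex with h | h <;> omega
  · by_contra hle
    rcases Nat.find_spec hex with h' | h'
    · omega
    · linarith [hs _ j (not_lt.1 hle) hj]
  · have := hmin j h
    push Not at this
    exact this.2 hj

theorem IsRankLE.le_isRank {s : ℕ → ℝ} {n : ℕ} {a y : ℝ} {u v : ℕ} (hu : IsRankLE s n a u)
    (hv : IsRank s n y v) (hay : a < y) : u ≤ v := by
  by_contra hlt
  have h1 := (hu.2 v (by have := hu.1; omega)).2 (by omega)
  exact lt_irrefl _ ((hv.2 v (by have := hu.1; omega)).1 (by linarith))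

theorem IsRank.le_isRank {s : ℕ → ℝ} {n : ℕ} {a y : ℝ} {u v : ℕ} (hu : IsRank s n a u)
    (hv : IsRank s n y v) (hay : a < y) : u ≤ v := by
  by_contra hlt
  have h1 := (hu.2 v (by have := hu.1; omega)).2 (by omega)
  exact lt_irrefl _ ((hv.2 v (by have := hu.1; omega)).1 (by linarith))

theorem empMeasure_Ioo {s : ℕ → ℝ} {n : ℕ} {a y : ℝ} {u v : ℕ} (hu : IsRankLE s n a u)
    (hv : IsRank s n y v) (hay : a < y) :
    (empMeasure n s).real (Ioo a y) = ((v : ℝ) - u) / n :=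
  empMeasure_real_eq measurableSet_Ioo (hu.le_isRank hv hay) hv.1 fun j hj => by
    rw [mem_Ioo, hv.2 j hj, ← not_le, hu.2 j hj, not_lt]

theorem empMeasure_Ico {s : ℕ → ℝ} {n : ℕ} {a y : ℝ} {u v : ℕ} (hu : IsRank s n a u)
    (hv : IsRank s n y v) (hay : a < y) :
    (empMeasure n s).real (Ico a y) = ((v : ℝ) - u) / n :=
  empMeasure_real_eq measurableSet_Ico (hu.le_isRank hv hay) hv.1 fun j hj => by
    rw [mem_Ico, hv.2 j hj, ← not_lt, hu.2 j hj, not_lt]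

/-- The slope `lo` fits the samples in `(a, e]` if it meets the constraints at all of them. -/
theorem fit_of_constraints {s : ℕ → ℝ} {n : ℕ} (hs : SortedUpTo s n) (hn : 0 < n) {T a e lo : ℝ}
    {y0 N : ℕ} (hT : 0 ≤ T) (hy0 : IsRankLE s n a y0) (hN : IsRank s n e N)
    (hlo : 0 ≤ lo) (hup : ∀ j < N, a < s j → lo * (s j - a) ≤ j - y0 + T)
    (hlow : ∀ j < N, a < s j → (j : ℝ) + 1 - y0 - T ≤ lo * (s j - a))
    (hend : lo * (e - a) ≤ N - y0 + T) :
    Fit (empMeasure n s) (T / n) a e := by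
  have hn' : (0 : ℝ) < n := by exact_mod_cast hn
  refine ⟨lo / n, by positivity, fun y hay hye => ?_⟩
  obtain ⟨M, hM⟩ := hs.exists_isRank y
  have hy0M := hy0.le_isRank hM hay
  have hMN : M ≤ N := by
    by_contra hlt
    have hNn : N < n := by have := hM.1; omega
    have h1 := (hM.2 N hNn).2 (by omega)
    exact lt_irrefl _ ((hN.2 N hNn).1 (by linarith))
  rw [empMeasure_Ioo hy0 hM hay]
  have : lo / n * (y - a) - ((M : ℝ) - y0) / n = (lo * (y - a) - (M - y0)) / n := by ring
  rw [this, abs_div, abs_of_pos hn']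
  refine div_le_div_of_nonneg_right ?_ hn'.le
  rw [abs_le]
  constructor
  · rcases hy0M.eq_or_lt with h | h
    · rw [h]
      have : 0 ≤ lo * (y - a) := mul_nonneg hlo (by linarith)
      linarith
    · obtain ⟨m, rfl⟩ : ∃ m, M = m + 1 := ⟨M - 1, by omega⟩
      have hmn : m < n := by have := hM.1; omega
      have h1 := (hM.2 m hmn).2 (by omega)
      have h2 : a < s m := by
        by_contra hle
        have := (hy0.2 m hmn).1 (not_lt.1 hle)
        omega
      have h3 := hlow m (by omega) h2
      have h4 : lo * (s m - a) ≤ lo * (y - a) := mul_le_mul_of_nonneg_left (by linarith) hlo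
      push_cast
      linarith
  · rcases hMN.eq_or_lt with h | h
    · have h4 : lo * (y - a) ≤ lo * (e - a) := mul_le_mul_of_nonneg_left (by linarith) hlo
      rw [h]; linarith
    · have hMn : M < n := by have := hN.1; omega
      have h1 : y ≤ s M := by
        by_contra hlt
        exact lt_irrefl _ ((hM.2 M hMn).1 (not_le.1 hlt))
      have h3 := hup M h (by linarith)
      have h4 : lo * (y - a) ≤ lo * (s M - a) := mul_le_mul_of_nonneg_left (by linarith) hlo
      linarith

theorem misfit_of_violations {s : ℕ → ℝ} {n : ℕ} (hs : SortedUpTo s n) (hn : 0 < n) {T a e : ℝ}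
    {y0 N : ℕ} (hae : a < e) (hy0 : IsRankLE s n a y0) (hN : IsRank s n e N)
    (h : ∀ c, 0 ≤ c → (∃ j < n, a < s j ∧ s j ≤ e ∧ (j : ℝ) - y0 + T ≤ c * (s j - a)) ∨
      (∃ j < n, a < s j ∧ s j ≤ e ∧ c * (s j - a) ≤ j + 1 - y0 - T) ∨
      (N : ℝ) - y0 + T ≤ c * (e - a)) :
    Misfit (empMeasure n s) (T / n) a e := by
  have hn' : (0 : ℝ) < n := by exact_mod_cast hn
  intro c hc
  have hcn : ∀ w, c * w = c * n * w / n := fun w => by field_simp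
  rcases h (c * n) (by positivity) with ⟨j, hj, h1, h2, h3⟩ | ⟨j, hj, h1, h2, h3⟩ | h3
  · refine ⟨s j, h1, h2, Or.inl ?_⟩
    have hy0j : y0 ≤ j := by
      by_contra hlt
      linarith [(hy0.2 j hj).2 (by omega)]
    have : (empMeasure n s).real (Ioo a (s j)) ≤ ((j : ℝ) - y0) / n := by
      refine empMeasure_real_le measurableSet_Ioo hy0j fun i hi hmem => ?_
      refine ⟨?_, ?_⟩
      · by_contra hlt
        linarith [(hy0.2 i hi).2 (by omega), hmem.1]
      · by_contra hlt
        linarith [hs j i (by omega) hi, hmem.2]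
    rw [hcn]
    calc _ ≤ ((j : ℝ) - y0) / n + T / n := by linarith
      _ = ((j : ℝ) - y0 + T) / n := by ring
      _ ≤ _ := div_le_div_of_nonneg_right h3 hn'.le
  · refine ⟨s j, h1, h2, Or.inr ?_⟩
    have : (((j + 1 : ℕ) : ℝ) - y0) / n ≤ (empMeasure n s).real (Ioc a (s j)) := by
      refine le_empMeasure_real measurableSet_Ioc hj fun i hi hij => ⟨?_, hs i j (by omega) hj⟩
      by_contra hle
      have := (hy0.2 i (by omega)).1 (not_lt.1 hle)
      omega
    refine le_trans ?_ this
    rw [hcn]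
    calc _ = (c * n * (s j - a) + T) / n := by ring
      _ ≤ _ := div_le_div_of_nonneg_right (by push_cast; linarith) hn'.le
  · refine ⟨e, hae, le_rfl, Or.inl ?_⟩
    rw [empMeasure_Ioo hy0 hN hae, hcn]
    calc _ = ((N : ℝ) - y0 + T) / n := by ring
      _ ≤ _ := div_le_div_of_nonneg_right h3 hn'.le

/-- The variables of the scan: `len` pieces are closed, with breakpoints `brk` and heights `ht`.
The open piece starts at `a`; `st` samples are below `a`, and `y0` of those read are at most `a`.
The slopes `c` with `lo ≤ c` and `c * r ≤ 1` fit the samples read since. The last sample read is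
`prev`, and the first sample equal to it is number `f`. -/
structure Scan where
  len : ℕ
  st : ℕ
  y0 : ℕ
  f : ℕ
  brk : ℕ → ℝ
  ht : ℕ → ℝ
  a : ℝ
  prev : ℝ
  lo : ℝ
  r : ℝ

namespace Scan

/-- The scan before the first sample. -/
def start : Scan := ⟨0, 0, 0, 0, fun _ => 0, fun _ => 0, 0, 0, 0, 0⟩

/-- Close the current piece at `e`, with `N` samples below `e`. -/
def close (n : ℕ) (G : Scan) (e : ℝ) (N : ℕ) : Scan :=
  { G with
    len := G.len + 1
    st := N
    a := e
    brk := Function.update G.brk (G.len + 1) e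
    ht := Function.update G.ht G.len (((N - G.st : ℕ) : ℝ) / ((e - G.a) * n)) }

/-- Forget the constraints, keeping the closed pieces. -/
def reset (G : Scan) (i : ℕ) : Scan := { G with y0 := i, lo := 0, r := 0 }

/-- If too few samples lie in `(a, x)`, close the piece before `x`. -/
def upper (n : ℕ) (T x : ℝ) (i : ℕ) (G : Scan) : Scan :=
  if ((i - G.y0 : ℕ) : ℝ) + T < (x - G.a) * G.lo then
    (G.close n (G.a + (((i - G.y0 : ℕ) : ℝ) + T) / G.lo) i).reset i
  else G

/-- Record the upper constraint on the slope at `x`. -/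
def widen (T x : ℝ) (i : ℕ) (G : Scan) : Scan :=
  if G.r < (x - G.a) / (((i - G.y0 : ℕ) : ℝ) + T) then
    { G with r := (x - G.a) / (((i - G.y0 : ℕ) : ℝ) + T) }
  else G

/-- If too many samples lie in `(a, x]`, close the piece at `x`; otherwise record the lower
constraint on the slope at `x`. -/
def lower (n : ℕ) (T x : ℝ) (i : ℕ) (G : Scan) : Scan :=
  if x - G.a < (((i + 1 - G.y0 : ℕ) : ℝ) - T) * G.r then
    (G.close n x G.f).reset (i + 1)
  else if G.lo < (((i + 1 - G.y0 : ℕ) : ℝ) - T) / (x - G.a) then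
    { G with lo := (((i + 1 - G.y0 : ℕ) : ℝ) - T) / (x - G.a) }
  else G

/-- Remember the sample `x` and its number. -/
def track (x : ℝ) (i : ℕ) (G : Scan) : Scan :=
  if G.prev < x then { G with f := i, prev := x } else G

/-- Process the sample `x` with number `i`. -/
def step (n : ℕ) (T x : ℝ) (i : ℕ) (G : Scan) : Scan :=
  if (G.track x i).a < x then ((((G.track x i).upper n T x i).widen T x i).lower n T x i)
  else { G.track x i with y0 := i + 1 }

/-- Close the last piece at `1`. -/
def finish (n : ℕ) (T : ℝ) (G : Scan) : Scan := (G.upper n T 1 n).close n 1 n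

/-- The closed pieces are correct. -/
structure Pieces (s : ℕ → ℝ) (n : ℕ) (T : ℝ) (G : Scan) : Prop where
  left : G.brk 0 = 0
  right : G.brk G.len = G.a
  lt : ∀ j < G.len, G.brk j < G.brk (j + 1)
  ht : ∀ j < G.len, G.ht j =
    (empMeasure n s).real (Ico (G.brk j) (G.brk (j + 1))) / (G.brk (j + 1) - G.brk j)
  fit : ∀ j < G.len, Fit (empMeasure n s) (T / n) (G.brk j) (G.brk (j + 1))
  rank : IsRank s n G.a G.st

/-- The closed pieces are not too short. -/
def Maximal (s : ℕ → ℝ) (n : ℕ) (T : ℝ) (G : Scan) : Prop :=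
  ∀ j < G.len, Misfit (empMeasure n s) (T / n) (G.brk j) (G.brk (j + 1))

/-- The recorded constraints on the slope: the upper ones at the samples before `iu`, and the lower
ones at the samples before `il`. -/
structure Cone (s : ℕ → ℝ) (T : ℝ) (iu il : ℕ) (G : Scan) : Prop where
  y0_le : G.y0 ≤ il
  y0_iff : ∀ j < il, s j ≤ G.a ↔ j < G.y0
  lo_nonneg : 0 ≤ G.lo
  r_nonneg : 0 ≤ G.r
  lo_mul_r : G.lo * G.r ≤ 1
  up : ∀ j < iu, G.a < s j → s j - G.a ≤ G.r * (j - G.y0 + T)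
  low : ∀ j < il, G.a < s j → (j : ℝ) + 1 - G.y0 - T ≤ G.lo * (s j - G.a)
  lo_att : G.lo = 0 ∨ ∃ j < il, G.a < s j ∧ G.lo * (s j - G.a) = j + 1 - G.y0 - T
  r_att : G.r = 0 ∨ ∃ j < iu, G.a < s j ∧ G.r * (j - G.y0 + T) = s j - G.a

/-- The data on the last sample read are correct. -/
structure Track (s : ℕ → ℝ) (n i : ℕ) (G : Scan) : Prop where
  f_le : G.f ≤ i
  rank : IsRank s n G.prev G.f
  le_prev : ∀ j < i, s j ≤ G.prev
  prev_le : ∀ j < n, i ≤ j → G.prev ≤ s j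

variable {s : ℕ → ℝ} {n : ℕ} {T : ℝ} {G : Scan}

theorem Pieces.close (hG : G.Pieces s n T) {e : ℝ} {N : ℕ} (hae : G.a < e) (hN : IsRank s n e N)
    (hfit : Fit (empMeasure n s) (T / n) G.a e) : (G.close n e N).Pieces s n T := by
  have hbrk : ∀ j ≤ G.len, (G.close n e N).brk j = G.brk j := fun j hj =>
    Function.update_of_ne (by omega) _ _
  have hlast : (G.close n e N).brk (G.len + 1) = e := Function.update_self _ _ _
  have hht : ∀ j < G.len, (G.close n e N).ht j = G.ht j := fun j hj =>
    Function.update_of_ne (by omega) _ _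
  have hcases : ∀ j < G.len + 1, j < G.len ∨ j = G.len := fun j hj => by omega
  refine ⟨?_, hlast, ?_, ?_, ?_, hN⟩
  · rw [hbrk 0 (Nat.zero_le _), hG.left]
  · intro j hj
    rcases hcases j hj with h | rfl
    · rw [hbrk j h.le, hbrk (j + 1) h]; exact hG.lt j h
    · rw [hbrk _ le_rfl, hlast, hG.right]; exact hae
  · intro j hj
    rcases hcases j hj with h | rfl
    · rw [hbrk j h.le, hbrk (j + 1) h, hht j h]; exact hG.ht j h
    · rw [hbrk _ le_rfl, hlast, hG.right, empMeasure_Ico hG.rank hN hae]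
      simp only [Scan.close, Function.update_self]
      rw [Nat.cast_sub (hG.rank.le_isRank hN hae), div_div, mul_comm (n : ℝ)]
  · intro j hj
    rcases hcases j hj with h | rfl
    · rw [hbrk j h.le, hbrk (j + 1) h]; exact hG.fit j h
    · rw [hbrk _ le_rfl, hlast, hG.right]; exact hfit

theorem Maximal.close (hm : G.Maximal s n T) (hG : G.Pieces s n T) {e : ℝ} {N : ℕ}
    (hmis : Misfit (empMeasure n s) (T / n) G.a e) : (G.close n e N).Maximal s n T := by
  have hbrk : ∀ j ≤ G.len, (G.close n e N).brk j = G.brk j := fun j hj =>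
    Function.update_of_ne (by omega) _ _
  have hlast : (G.close n e N).brk (G.len + 1) = e := Function.update_self _ _ _
  intro j hj
  rcases (show j < G.len ∨ j = G.len by have : j < G.len + 1 := hj; omega) with h | rfl
  · rw [hbrk j h.le, hbrk (j + 1) h]; exact hm j h
  · rw [hbrk _ le_rfl, hlast, hG.right]; exact hmis

theorem Pieces.reset (hG : G.Pieces s n T) (i : ℕ) : (G.reset i).Pieces s n T :=
  ⟨hG.left, hG.right, hG.lt, hG.ht, hG.fit, hG.rank⟩

theorem Maximal.reset (hm : G.Maximal s n T) (i : ℕ) : (G.reset i).Maximal s n T := hm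

theorem cone_reset {iu i : ℕ} (hle : ∀ j < i, s j ≤ G.a) (hlt : ∀ j < iu, G.a < s j → False) :
    (G.reset i).Cone s T iu i where
  y0_le := le_rfl
  y0_iff := fun j hj => ⟨fun _ => hj, fun _ => hle j hj⟩
  lo_nonneg := le_rfl
  r_nonneg := le_rfl
  lo_mul_r := by simp [Scan.reset]
  up := fun j hj h => (hlt j hj h).elim
  low := fun j hj h => absurd (hle j hj) (not_le.2 h)
  lo_att := Or.inl rfl
  r_att := Or.inl rfl

theorem Cone.isRankLE {iu i : ℕ} (hc : G.Cone s T iu i) {x : ℝ} (hax : G.a < x) (hi : i ≤ n)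
    (hx : ∀ j < n, i ≤ j → x ≤ s j) : IsRankLE s n G.a G.y0 := by
  refine ⟨hc.y0_le.trans hi, fun j hj => ?_⟩
  rcases lt_or_ge j i with h | h
  · exact hc.y0_iff j h
  · refine iff_of_false (not_le.2 (hax.trans_le (hx j hj h))) ?_
    have := hc.y0_le; omega

theorem Cone.lo_mul_le {iu i : ℕ} (hc : G.Cone s T iu i) (hT : 0 < T) {j : ℕ} (hj : j < iu)
    (haj : G.a < s j) (hy : G.y0 ≤ j) : G.lo * (s j - G.a) ≤ j - G.y0 + T := by
  have hy' : (G.y0 : ℝ) ≤ j := by exact_mod_cast hy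
  calc G.lo * (s j - G.a) ≤ G.lo * (G.r * (j - G.y0 + T)) :=
        mul_le_mul_of_nonneg_left (hc.up j hj haj) hc.lo_nonneg
    _ = G.lo * G.r * (j - G.y0 + T) := by ring
    _ ≤ 1 * (j - G.y0 + T) := mul_le_mul_of_nonneg_right hc.lo_mul_r (by linarith)
    _ = _ := one_mul _

theorem Cone.y0_le_of_lt {iu i : ℕ} (hc : G.Cone s T iu i) {j : ℕ} (haj : G.a < s j) :
    G.y0 ≤ j := by
  by_contra hlt
  have hji : j < i := by have := hc.y0_le; omega
  linarith [(hc.y0_iff j hji).2 (by omega)]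

theorem upper_spec (hs : SortedUpTo s n) (hn : 0 < n) (hT : 0 < T) {i : ℕ} (hi : i ≤ n) {x : ℝ}
    (hG : G.Pieces s n T) (hm : G.Maximal s n T) (hc : G.Cone s T i i) (hax : G.a < x)
    (hx : ∀ j < n, i ≤ j → x ≤ s j) :
    (G.upper n T x i).Pieces s n T ∧ (G.upper n T x i).Maximal s n T ∧
      (G.upper n T x i).Cone s T i i ∧ (G.upper n T x i).a < x ∧
      (G.upper n T x i).lo * (x - (G.upper n T x i).a) ≤ i - (G.upper n T x i).y0 + T ∧
      (G.upper n T x i).f = G.f ∧ (G.upper n T x i).prev = G.prev := by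
  have hy := hc.isRankLE hax hi hx
  have hyi : (G.y0 : ℝ) ≤ i := by exact_mod_cast hc.y0_le
  unfold upper
  rw [Nat.cast_sub hc.y0_le]
  split_ifs with hif
  · have hu : 0 < (i : ℝ) - G.y0 + T := by linarith
    have hlo : 0 < G.lo := by
      refine hc.lo_nonneg.lt_of_ne fun h => ?_
      rw [← h, mul_zero] at hif
      linarith
    set z := G.a + ((i : ℝ) - G.y0 + T) / G.lo with hz
    have hzlo : G.lo * (z - G.a) = i - G.y0 + T := by rw [hz]; field_simp; ring
    have haz : G.a < z := by
      have : 0 < ((i : ℝ) - G.y0 + T) / G.lo := by positivity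
      linarith
    have hzx : z < x := by
      have : ((i : ℝ) - G.y0 + T) / G.lo < x - G.a := by rwa [div_lt_iff₀ hlo]
      linarith
    have hsz : ∀ j < i, s j < z := by
      intro j hj
      rcases le_or_gt (s j) G.a with h | h
      · linarith
      · have h1 := hc.lo_mul_le hT hj h (hc.y0_le_of_lt h)
        have hj' : (j : ℝ) < i := by exact_mod_cast hj
        have h2 : G.lo * (s j - G.a) < G.lo * (z - G.a) := by rw [hzlo]; linarith
        have := lt_of_mul_lt_mul_left h2 hlo.le
        linarith
    have hN : IsRank s n z i := by
      refine ⟨hi, fun j hj => ⟨fun h => ?_, fun h => hsz j h⟩⟩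
      by_contra hle
      linarith [hx j hj (not_lt.1 hle)]
    have hfit : Fit (empMeasure n s) (T / n) G.a z :=
      fit_of_constraints hs hn hT.le hy hN hlo.le
        (fun j hj h => hc.lo_mul_le hT hj h (hc.y0_le_of_lt h)) hc.low hzlo.le
    have hmis : Misfit (empMeasure n s) (T / n) G.a z := by
      refine misfit_of_violations hs hn haz hy hN fun c hc0 => ?_
      rcases le_or_gt G.lo c with h | h
      · right; right
        rw [← hzlo]
        exact mul_le_mul_of_nonneg_right h (by linarith)
      · rcases hc.lo_att with h0 | ⟨j, hj, haj, hj'⟩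
        · linarith
        · right; left
          refine ⟨j, by omega, haj, (hsz j hj).le, ?_⟩
          rw [← hj']
          exact mul_le_mul_of_nonneg_right h.le (by linarith)
    refine ⟨(hG.close haz hN hfit).reset i, (hm.close hG hmis).reset i,
      cone_reset (fun j hj => (hsz j hj).le) (fun j hj h => ?_), hzx, ?_, rfl, rfl⟩
    · exact absurd (hsz j hj) (not_lt.2 (le_of_lt h))
    · simp only [Scan.reset, zero_mul, sub_self, zero_add]; exact hT.le
  · refine ⟨hG, hm, hc, hax, ?_, rfl, rfl⟩
    rw [mul_comm]; exact not_lt.1 hif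

theorem widen_spec (hT : 0 < T) {i : ℕ} (hc : G.Cone s T i i) (hax : G.a < s i)
    (hend : G.lo * (s i - G.a) ≤ i - G.y0 + T) :
    (G.widen T (s i) i).Cone s T (i + 1) i := by
  have hyi : (G.y0 : ℝ) ≤ i := by exact_mod_cast hc.y0_le
  have hu : 0 < (i : ℝ) - G.y0 + T := by linarith
  unfold widen
  rw [Nat.cast_sub hc.y0_le]
  split_ifs with hif
  · refine ⟨hc.y0_le, hc.y0_iff, hc.lo_nonneg, hc.r_nonneg.trans hif.le, ?_, ?_, hc.low,
      hc.lo_att, Or.inr ⟨i, by omega, hax, ?_⟩⟩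
    · change G.lo * ((s i - G.a) / (i - G.y0 + T)) ≤ 1
      rw [← mul_div_assoc, div_le_one hu]; exact hend
    · intro j hj haj
      change s j - G.a ≤ (s i - G.a) / (i - G.y0 + T) * (j - G.y0 + T)
      rcases Nat.lt_succ_iff_lt_or_eq.1 hj with h | rfl
      · have hyj : (G.y0 : ℝ) ≤ j := by exact_mod_cast hc.y0_le_of_lt haj
        exact (hc.up j h haj).trans (mul_le_mul_of_nonneg_right hif.le (by linarith))
      · rw [div_mul_cancel₀ _ hu.ne']
    · change (s i - G.a) / (i - G.y0 + T) * (i - G.y0 + T) = s i - G.a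
      rw [div_mul_cancel₀ _ hu.ne']
  · refine ⟨hc.y0_le, hc.y0_iff, hc.lo_nonneg, hc.r_nonneg, hc.lo_mul_r, ?_, hc.low, hc.lo_att, ?_⟩
    · intro j hj haj
      rcases Nat.lt_succ_iff_lt_or_eq.1 hj with h | rfl
      · exact hc.up j h haj
      · rw [not_lt, div_le_iff₀ hu] at hif
        exact hif
    · rcases hc.r_att with h | ⟨j, hj, h⟩
      · exact Or.inl h
      · exact Or.inr ⟨j, by omega, h⟩

theorem lower_spec (hs : SortedUpTo s n) (hn : 0 < n) (hT : 0 < T) {i : ℕ} (hi : i < n)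
    (hG : G.Pieces s n T) (hm : G.Maximal s n T) (hc : G.Cone s T (i + 1) i) (hax : G.a < s i)
    (hf : IsRank s n (s i) G.f) (hfi : G.f ≤ i) :
    (G.lower n T (s i) i).Pieces s n T ∧ (G.lower n T (s i) i).Maximal s n T ∧
      (G.lower n T (s i) i).Cone s T (i + 1) (i + 1) ∧ (G.lower n T (s i) i).a ≤ s i ∧
      (G.lower n T (s i) i).f = G.f ∧ (G.lower n T (s i) i).prev = G.prev := by
  have hy := hc.isRankLE hax hi.le (fun j hj h => hs i j h hj)
  have hyi : (G.y0 : ℝ) ≤ i := by exact_mod_cast hc.y0_le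
  have hw : 0 < s i - G.a := by linarith
  unfold lower
  rw [Nat.cast_sub (hc.y0_le.trans (Nat.le_succ i))]
  push_cast
  set v := (i : ℝ) + 1 - G.y0 - T with hv
  split_ifs with hif hif2
  · have hr : 0 < G.r := by
      refine hc.r_nonneg.lt_of_ne fun h => ?_
      rw [← h, mul_zero] at hif
      linarith
    have hv0 : 0 < v := by
      by_contra hle
      have := mul_nonpos_of_nonpos_of_nonneg (not_lt.1 hle) hr.le
      linarith
    have hle : ∀ j < i + 1, s j ≤ s i := fun j hj => hs j i (by omega) hi
    have hfit : Fit (empMeasure n s) (T / n) G.a (s i) := by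
      refine fit_of_constraints hs hn hT.le hy hf hc.lo_nonneg
        (fun j hj h => hc.lo_mul_le hT (by omega) h (hc.y0_le_of_lt h))
        (fun j hj h => hc.low j (by omega) h) ?_
      have hsf : s G.f = s i := by
        refine le_antisymm (hs _ _ hfi hi) ?_
        by_contra hlt
        exact lt_irrefl _ ((hf.2 G.f (by omega)).1 (not_le.1 hlt))
      have h1 : G.a < s G.f := by rw [hsf]; exact hax
      have := hc.lo_mul_le hT (show G.f < i + 1 by omega) h1 (hc.y0_le_of_lt h1)
      rwa [hsf] at this
    have hmis : Misfit (empMeasure n s) (T / n) G.a (s i) := by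
      refine misfit_of_violations hs hn hax hy hf fun c hc0 => ?_
      rcases le_or_gt 1 (c * G.r) with h | h
      · rcases hc.r_att with h0 | ⟨j, hj, haj, hj'⟩
        · exact absurd h0 hr.ne'
        · left
          refine ⟨j, by omega, haj, hle j hj, ?_⟩
          have hyj : (G.y0 : ℝ) ≤ j := by exact_mod_cast hc.y0_le_of_lt haj
          rw [← hj', ← mul_assoc]
          exact le_mul_of_one_le_left (by linarith) h
      · right; left
        refine ⟨i, hi, hax, le_rfl, ?_⟩
        calc c * (s i - G.a) ≤ c * (v * G.r) := mul_le_mul_of_nonneg_left hif.le hc0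
          _ = c * G.r * v := by ring
          _ ≤ 1 * v := mul_le_mul_of_nonneg_right h.le hv0.le
          _ = _ := by rw [one_mul, hv]
    refine ⟨(hG.close hax hf hfit).reset _, (hm.close hG hmis).reset _,
      cone_reset (fun j hj => hle j hj) (fun j hj h => ?_), le_rfl, rfl, rfl⟩
    exact absurd (hle j hj) (not_le.2 h)
  · have hlo' : v / (s i - G.a) * G.r ≤ 1 := by
      rw [div_mul_eq_mul_div, div_le_one hw]; exact not_lt.1 hif
    refine ⟨⟨hG.left, hG.right, hG.lt, hG.ht, hG.fit, hG.rank⟩, hm, ⟨?_, ?_, ?_, hc.r_nonneg, hlo',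
      hc.up, ?_, Or.inr ⟨i, by omega, hax, ?_⟩, hc.r_att⟩, hax.le, rfl, rfl⟩
    · exact hc.y0_le.trans (Nat.le_succ i)
    · intro j hj
      exact hy.2 j (by omega)
    · exact hc.lo_nonneg.trans hif2.le
    · intro j hj haj
      change (j : ℝ) + 1 - G.y0 - T ≤ v / (s i - G.a) * (s j - G.a)
      rcases Nat.lt_succ_iff_lt_or_eq.1 hj with h | rfl
      · have haj' : G.a < s j := haj
        exact (hc.low j h haj').trans (mul_le_mul_of_nonneg_right hif2.le (by linarith))
      · rw [div_mul_cancel₀ _ hw.ne']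
    · change v / (s i - G.a) * (s i - G.a) = i + 1 - G.y0 - T
      rw [div_mul_cancel₀ _ hw.ne']
  · refine ⟨hG, hm, ⟨hc.y0_le.trans (Nat.le_succ i), fun j hj => hy.2 j (by omega), hc.lo_nonneg,
      hc.r_nonneg, hc.lo_mul_r, hc.up, ?_, ?_, hc.r_att⟩, hax.le, rfl, rfl⟩
    · intro j hj haj
      rcases Nat.lt_succ_iff_lt_or_eq.1 hj with h | rfl
      · exact hc.low j h haj
      · rw [not_lt, div_le_iff₀ hw] at hif2
        exact hif2
    · rcases hc.lo_att with h | ⟨j, hj, h⟩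
      · exact Or.inl h
      · exact Or.inr ⟨j, by omega, h⟩

theorem track_spec (hs : SortedUpTo s n) {i : ℕ} (hi : i < n) (ht : G.Track s n i) :
    (G.track (s i) i).Track s n (i + 1) ∧ (G.track (s i) i).prev = s i ∧
      (G.track (s i) i).f ≤ i := by
  unfold track
  split_ifs with hif
  · refine ⟨⟨Nat.le_succ i, ⟨hi.le, fun j hj => ⟨fun h => ?_, fun h => ?_⟩⟩,
      fun j hj => hs j i (by omega) hi, fun j hj h => hs i j (by omega) hj⟩, rfl, le_rfl⟩
    · by_contra hle
      exact absurd (hs i j (not_lt.1 hle) hj) (not_le.2 h)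
    · exact (ht.le_prev j h).trans_lt hif
  · have hp : G.prev = s i := le_antisymm (ht.prev_le i hi le_rfl) (not_lt.1 hif)
    refine ⟨⟨ht.f_le.trans (Nat.le_succ i), ht.rank, fun j hj => ?_, fun j hj h => ?_⟩, hp, ht.f_le⟩
    · rw [hp]; exact hs j i (by omega) hi
    · rw [hp]; exact hs i j (by omega) hj

/-- The invariant of the scan before sample number `i` is read. -/
structure Inv (s : ℕ → ℝ) (n : ℕ) (T : ℝ) (i : ℕ) (G : Scan) : Prop where
  pieces : G.Pieces s n T
  maximal : G.Maximal s n T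
  cone : G.Cone s T i i
  trk : G.Track s n i
  lt_one : G.a < 1

theorem inv_start (h0 : ∀ j < n, 0 ≤ s j) : start.Inv s n T 0 where
  pieces := ⟨rfl, rfl, fun j hj => absurd hj (Nat.not_lt_zero j),
    fun j hj => absurd hj (Nat.not_lt_zero j), fun j hj => absurd hj (Nat.not_lt_zero j),
    Nat.zero_le n, fun j hj => iff_of_false (not_lt.2 (h0 j hj)) (Nat.not_lt_zero j)⟩
  maximal := fun j hj => absurd hj (Nat.not_lt_zero j)
  cone := cone_reset (G := start) (fun j hj => absurd hj (Nat.not_lt_zero j))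
    (fun j hj => absurd hj (Nat.not_lt_zero j))
  trk := ⟨le_rfl, ⟨Nat.zero_le n, fun j hj => iff_of_false (not_lt.2 (h0 j hj))
    (Nat.not_lt_zero j)⟩, fun j hj => absurd hj (Nat.not_lt_zero j), fun j hj _ => h0 j hj⟩
  lt_one := zero_lt_one

theorem Inv.step (hs : SortedUpTo s n) (hT : 0 < T) {i : ℕ} (hi : i < n) (h1 : ∀ j < n, s j < 1)
    (hG : G.Inv s n T i) : (G.step n T (s i) i).Inv s n T (i + 1) := by
  have hn : 0 < n := by omega
  obtain ⟨ht, hp, hf⟩ := track_spec hs hi hG.trk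
  set G1 := G.track (s i) i with hG1
  have hfields : G1.len = G.len ∧ G1.st = G.st ∧ G1.y0 = G.y0 ∧ G1.brk = G.brk ∧ G1.ht = G.ht ∧
      G1.a = G.a ∧ G1.lo = G.lo ∧ G1.r = G.r := by
    rw [hG1]; unfold track; split_ifs <;> simp
  obtain ⟨e1, e2, e3, e4, e5, e6, e7, e8⟩ := hfields
  have hP : G1.Pieces s n T := by
    have h := hG.pieces
    constructor
    · rw [e4]; exact h.left
    · rw [e4, e1, e6]; exact h.right
    · rw [e1, e4]; exact h.lt
    · rw [e1, e4, e5]; exact h.ht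
    · rw [e1, e4]; exact h.fit
    · rw [e6, e2]; exact h.rank
  have hM : G1.Maximal s n T := by
    have := hG.maximal
    unfold Maximal at this ⊢
    rwa [e1, e4]
  have hC : G1.Cone s T i i := by
    have h := hG.cone
    constructor
    · rw [e3]; exact h.y0_le
    · rw [e3, e6]; exact h.y0_iff
    · rw [e7]; exact h.lo_nonneg
    · rw [e8]; exact h.r_nonneg
    · rw [e7, e8]; exact h.lo_mul_r
    · rw [e3, e6, e8]; exact h.up
    · rw [e3, e6, e7]; exact h.low
    · rw [e3, e6, e7]; exact h.lo_att
    · rw [e3, e6, e8]; exact h.r_att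
  have hTr : ∀ G' : Scan, G'.f = G1.f → G'.prev = G1.prev → G'.Track s n (i + 1) := by
    intro G' h1 h2
    exact ⟨h1 ▸ ht.f_le, by rw [h1, h2]; exact ht.rank, by rw [h2]; exact ht.le_prev,
      by rw [h2]; exact ht.prev_le⟩
  unfold Scan.step
  rw [← hG1]
  split_ifs with hax
  · obtain ⟨p1, m1, c1, a1, u1, f1, q1⟩ :=
      upper_spec hs hn hT hi.le hP hM hC hax (fun j hj h => hs i j h hj)
    set G2 := G1.upper n T (s i) i
    have c2 := widen_spec hT c1 a1 u1
    set G3 := G2.widen T (s i) i with hG3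
    have hf3 : G3.len = G2.len ∧ G3.st = G2.st ∧ G3.brk = G2.brk ∧ G3.ht = G2.ht ∧
        G3.a = G2.a ∧ G3.f = G2.f ∧ G3.prev = G2.prev := by
      rw [hG3]; unfold widen; split_ifs <;> simp
    obtain ⟨d1, d2, d3, d4, d5, d6, d7⟩ := hf3
    have p2 : G3.Pieces s n T := by
      constructor
      · rw [d3]; exact p1.left
      · rw [d3, d1, d5]; exact p1.right
      · rw [d1, d3]; exact p1.lt
      · rw [d1, d3, d4]; exact p1.ht
      · rw [d1, d3]; exact p1.fit
      · rw [d5, d2]; exact p1.rank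
    have m2 : G3.Maximal s n T := by
      unfold Maximal at m1 ⊢
      rwa [d1, d3]
    obtain ⟨p3, m3, c3, a3, f3, q3⟩ := lower_spec hs hn hT hi p2 m2 c2 (by rw [d5]; exact a1)
      (by rw [d6, f1, ← hp]; exact ht.rank) (by rw [d6, f1]; exact hf)
    exact ⟨p3, m3, c3, hTr _ (by rw [f3, d6, f1]) (by rw [q3, d7, q1]), a3.trans_lt (h1 i hi)⟩
  · have hle : ∀ j < i + 1, s j ≤ G1.a := fun j hj =>
      (hs j i (by omega) hi).trans (not_lt.1 hax)
    have hno : ∀ j < i + 1, G1.a < s j → False := fun j hj h => absurd (hle j hj) (not_le.2 h)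
    have hlo : G1.lo = 0 := by
      rcases hC.lo_att with h | ⟨j, hj, h, _⟩
      · exact h
      · exact (hno j (by omega) h).elim
    have hr : G1.r = 0 := by
      rcases hC.r_att with h | ⟨j, hj, h, _⟩
      · exact h
      · exact (hno j (by omega) h).elim
    have heq : ({ G1 with y0 := i + 1 } : Scan) = G1.reset (i + 1) := by
      simp only [Scan.reset, hlo, hr]
    rw [heq]
    exact ⟨hP.reset _, hM.reset _, cone_reset hle hno, hTr _ rfl rfl, e6 ▸ hG.lt_one⟩

/-- The output of the scan. -/
theorem Inv.finish (hs : SortedUpTo s n) (hn : 0 < n) (hT : 0 < T) (h1 : ∀ j < n, s j < 1)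
    (hG : G.Inv s n T n) :
    (G.finish n T).Pieces s n T ∧ (G.finish n T).a = 1 ∧ 0 < (G.finish n T).len ∧
      ∀ j < (G.finish n T).len - 1, Misfit (empMeasure n s) (T / n) ((G.finish n T).brk j)
        ((G.finish n T).brk (j + 1)) := by
  have hx : ∀ j < n, n ≤ j → (1 : ℝ) ≤ s j := fun j h h' => by omega
  obtain ⟨p, m, c, a1, u, -, -⟩ := upper_spec hs hn hT le_rfl hG.pieces hG.maximal hG.cone
    hG.lt_one hx
  unfold Scan.finish
  set G2 := G.upper n T 1 n
  have hN : IsRank s n 1 n := ⟨le_rfl, fun j hj => iff_of_true (h1 j hj) hj⟩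
  have hfit := fit_of_constraints hs hn hT.le (c.isRankLE a1 le_rfl hx) hN c.lo_nonneg
    (fun j hj h => c.lo_mul_le hT hj h (c.y0_le_of_lt h)) c.low u
  refine ⟨p.close a1 hN hfit, rfl, Nat.succ_pos _, fun j hj => ?_⟩
  have hj' : j < G2.len := hj
  have hbrk : ∀ j ≤ G2.len, (G2.close n 1 n).brk j = G2.brk j := fun j hj =>
    Function.update_of_ne (by omega) _ _
  rw [hbrk j hj'.le, hbrk (j + 1) hj']
  exact m j hj'

end Scan

/-! ## Total correctness of programs with time bounds -/

/-- Started in `σ`, the program halts within `T` steps in a state satisfying `Q`. -/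
def Runs (x : ℕ → ℝ) (P : Prog) (σ : State) (T : ℕ) (Q : State → Prop) : Prop :=
  ∃ t τ, Exec x P σ t τ ∧ t ≤ T ∧ Q τ

variable {x : ℕ → ℝ}

theorem Runs.mono {P : Prog} {σ : State} {T T' : ℕ} {Q Q' : State → Prop} (h : Runs x P σ T Q)
    (hT : T ≤ T') (hQ : ∀ τ, Q τ → Q' τ) : Runs x P σ T' Q' := by
  obtain ⟨t, τ, he, ht, hq⟩ := h
  exact ⟨t, τ, he, ht.trans hT, hQ τ hq⟩

theorem Runs.seq {P P' : Prog} {σ : State} {T T' : ℕ} {Q Q' : State → Prop} (h : Runs x P σ T Q)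
    (h' : ∀ τ, Q τ → Runs x P' τ T' Q') : Runs x (.seq P P') σ (T + T') Q' := by
  obtain ⟨t, τ, he, ht, hq⟩ := h
  obtain ⟨t', τ', he', ht', hq'⟩ := h' τ hq
  exact ⟨t + t', τ', .seq he he', by omega, hq'⟩

theorem Runs.cond {b : Test} {P P' : Prog} {σ : State} {T : ℕ} {Q : State → Prop}
    (h : b.Holds σ → Runs x P σ T Q) (h' : ¬ b.Holds σ → Runs x P' σ T Q) :
    Runs x (.cond b P P') σ (T + 1) Q := by
  by_cases hb : b.Holds σ
  · obtain ⟨t, τ, he, ht, hq⟩ := h hb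
    exact ⟨t + 1, τ, .cond_true hb he, by omega, hq⟩
  · obtain ⟨t, τ, he, ht, hq⟩ := h' hb
    exact ⟨t + 1, τ, .cond_false hb he, by omega, hq⟩

/-- A loop whose body takes an invariant from `j` to `j + 1`, until `j = N`. -/
theorem Runs.loop {b : Test} {P : Prog} {T N : ℕ} {I : ℕ → State → Prop}
    (hbody : ∀ j < N, ∀ σ, I j σ → b.Holds σ ∧ Runs x P σ T (I (j + 1)))
    (hend : ∀ σ, I N σ → ¬ b.Holds σ) {j : ℕ} (hj : j ≤ N) {σ : State} (h0 : I j σ) :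
    Runs x (.loop b P) σ ((N - j) * (T + 1) + 1) (I N) := by
  induction hm : N - j generalizing j σ with
  | zero =>
    obtain rfl : j = N := by omega
    exact ⟨1, σ, .loop_false (hend σ h0), by omega, h0⟩
  | succ m ih =>
    obtain ⟨hb, t, τ, he, ht, hq⟩ := hbody j (by omega) σ h0
    obtain ⟨t', τ', he', ht', hq'⟩ := ih (by omega) hq (by omega)
    refine ⟨t + t' + 1, τ', .loop_true hb he he', ?_, hq'⟩
    have : (m + 1) * (T + 1) = m * (T + 1) + T + 1 := by ring
    omega

/-- A loop controlled by a counter. -/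
theorem Runs.count {c d : ℕ} {P : Prog} {T N : ℕ} {I : ℕ → State → Prop} {σ : State} (h0 : I 0 σ)
    (hcount : ∀ j σ, I j σ → (σ.nreg c < σ.nreg d ↔ j < N))
    (hbody : ∀ j < N, ∀ σ, I j σ → Runs x P σ T (I (j + 1))) :
    Runs x (.loop (.nlt c d) P) σ (N * (T + 1) + 1) (I N) :=
  Runs.loop (b := .nlt c d) (fun j hj σ hσ => ⟨(hcount j σ hσ).2 hj, hbody j hj σ hσ⟩)
    (fun σ hσ h => lt_irrefl _ ((hcount N σ hσ).1 h)) (Nat.zero_le N) h0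

theorem Runs.instr {I : Instr} {σ : State} {Q : State → Prop} (h : Q (I.run x σ)) :
    Runs x (.instr I) σ 1 Q := ⟨1, _, .instr I σ, le_rfl, h⟩

/-- Straight-line code. -/
def block : Instr → List Instr → Prog
  | I, [] => .instr I
  | I, J :: l => .seq (.instr I) (block J l)

theorem Runs.block {I : Instr} {l : List Instr} {σ : State} {Q : State → Prop}
    (h : Q ((I :: l).foldl (fun ρ J => J.run x ρ) σ)) : Runs x (block I l) σ (l.length + 1) Q := by
  induction l generalizing I σ with
  | nil => exact Runs.instr h
  | cons J l ih =>
    have := Runs.seq (Runs.instr (x := x) (I := I) (σ := σ) (Q := fun ρ => ρ = I.run x σ) rfl)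
      (P' := HistLearn.block J l) (T' := l.length + 1) (Q' := Q) (by
        rintro _ rfl
        exact ih h)
    refine this.mono ?_ fun _ h => h
    simp only [List.length_cons]; omega

theorem writeMem_same {α : Type} (m : ℕ → ℕ → α) (b i : ℕ) (v : α) :
    writeMem m b i v b = Function.update (m b) i v := Function.update_self _ _ _

theorem writeMem_ne {α : Type} (m : ℕ → ℕ → α) {b b' : ℕ} (i : ℕ) (v : α) (h : b' ≠ b) :
    writeMem m b i v b' = m b' := Function.update_of_ne h _ _

/-! ## The sample size -/

/-- The registers and banks that all phases of the program leave alone. -/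
structure Base (k n : ℕ) (ε : ℝ) (d : ℕ) (σ : State) : Prop where
  k_eq : σ.nreg 0 = k
  n_eq : σ.nreg 1 = n
  one : σ.nreg 3 = 1
  zero : σ.nreg 10 = 0
  eps : σ.rreg 0 = ε
  rzero : σ.rreg 17 = 0
  brk : σ.rmem 0 = fun _ => 0
  ht : σ.rmem 1 = fun _ => 0
  drawn : σ.drawn = d

/-- Initialization: register `1` holds the candidate sample size `2 ^ m`, register `2` holds `m + 2`,
and the two sides of the test for the sample size are in real registers `4` and `5`. -/
def sizeInit : Prog :=
  block (.nconst 1 1) [.nconst 2 2, .nconst 3 1, .rmul 1 0 0, .rcast 2 0, .rconst 3 25600,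
    .rmul 2 2 3, .rcast 4 1, .rmul 4 4 1, .rcast 5 2, .rmul 5 5 5, .rmul 5 5 2]

/-- Find the least power of two that is a large enough sample size. -/
def sizeProg : Prog :=
  .seq sizeInit (.loop (.rlt 4 5) (block (.nadd 1 1 1) [.nadd 2 2 3, .rcast 4 1, .rmul 4 4 1,
    .rcast 5 2, .rmul 5 5 5, .rmul 5 5 2]))

/-- `2 ^ m` samples are enough. -/
def Enough (k : ℕ) (ε : ℝ) (m : ℕ) : Prop := 25600 * k * ((m : ℝ) + 2) ^ 2 ≤ 2 ^ m * ε ^ 2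

theorem sizeProg_runs {k : ℕ} {ε : ℝ} {m : ℕ} (hm : Enough k ε m) (hlt : ∀ j < m, ¬ Enough k ε j) :
    Runs x sizeProg (input k ε) (8 * m + 13) 
      (Base k (2 ^ m) ε 0) := by
  set I : ℕ → State → Prop := fun j σ =>
    σ.nreg 0 = k ∧ σ.nreg 1 = 2 ^ j ∧ σ.nreg 3 = 1 ∧ σ.nreg 10 = 0 ∧ σ.rreg 0 = ε ∧
      σ.rreg 17 = 0 ∧ σ.rmem 0 = (fun _ => 0) ∧ σ.rmem 1 = (fun _ => 0) ∧ σ.drawn = 0 ∧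
      σ.nreg 2 = j + 2 ∧ σ.rreg 1 = ε * ε ∧ σ.rreg 2 = k * 25600 ∧
      σ.rreg 4 = 2 ^ j * (ε * ε) ∧
      σ.rreg 5 = ((j : ℝ) + 2) * ((j : ℝ) + 2) * (k * 25600) with hI
  have hinit : Runs x sizeInit (input k ε) 12 (I 0) := by
    refine Runs.block ?_
    simp [hI, Instr.run, input]
  have hbody : ∀ j, ∀ σ, I j σ → Runs x (block (.nadd 1 1 1) [.nadd 2 2 3, .rcast 4 1, .rmul 4 4 1,
    .rcast 5 2, .rmul 5 5 5, .rmul 5 5 2]) σ 7 (I (j + 1)) := by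
    rintro j σ ⟨h0, h1, h3, h10, r0, r17, m0, m1, hd, h2, r1, r2, r4, r5⟩
    refine Runs.block ?_
    simp [Instr.run, *]
    exact ⟨by ring, Or.inl (by ring), Or.inl (by ring)⟩
  have htest : ∀ j σ, I j σ → ((Test.rlt 4 5).Holds σ ↔ ¬ Enough k ε j) := by
    rintro j σ ⟨h0, h1, h3, h10, r0, r17, m0, m1, hd, h2, r1, r2, r4, r5⟩
    simp only [Test.Holds, r4, r5, Enough, not_le]
    constructor <;> intro h <;> nlinarith
  have := Runs.seq hinit (Q' := I m) (T' := (m - 0) * (7 + 1) + 1) fun τ hτ =>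
    Runs.loop (N := m) (fun j hj σ hσ => ⟨(htest j σ hσ).2 (hlt j hj), hbody j σ hσ⟩)
      (fun σ hσ h => (htest m σ hσ).1 h hm) (Nat.zero_le m) hτ
  refine this.mono (by omega) fun τ hτ => ?_
  obtain ⟨h0, h1, h3, h10, r0, r17, m0, m1, hd, h2, r1, r2, r4, r5⟩ := hτ
  exact ⟨h0, h1, h3, h10, r0, r17, m0, m1, hd⟩

/-! ## Drawing the samples -/

def drawProg : Prog :=
  .seq (.instr (.nconst 4 0)) (.loop (.nlt 4 1) (block (.draw 6) [.rstore 2 4 6, .nadd 4 4 3]))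

theorem drawProg_runs {k n : ℕ} {ε : ℝ} {σ : State} (hσ : Base k n ε 0 σ) :
    Runs x drawProg σ (4 * n + 2) fun τ => Base k n ε n τ ∧ ∀ i < n, τ.rmem 2 i = x i := by
  set I : ℕ → State → Prop := fun j τ =>
    Base k n ε j τ ∧ τ.nreg 4 = j ∧ ∀ i < j, τ.rmem 2 i = x i with hI
  have hinit : Runs x (.instr (.nconst 4 0)) σ 1 (I 0) := by
    refine Runs.instr ?_
    obtain ⟨h1, h2, h3, h4, h5, h6, h7, h8, h9⟩ := hσ
    refine ⟨⟨?_, ?_, ?_, ?_, ?_, ?_, ?_, ?_, ?_⟩, ?_, ?_⟩ <;> simp [Instr.run, *]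
  have hbody : ∀ j, ∀ τ, I j τ →
      Runs x (block (.draw 6) [.rstore 2 4 6, .nadd 4 4 3]) τ 3 (I (j + 1)) := by
    rintro j τ ⟨⟨h1, h2, h3, h4, h5, h6, h7, h8, h9⟩, hj, hx⟩
    refine Runs.block ⟨⟨?_, ?_, ?_, ?_, ?_, ?_, ?_, ?_, ?_⟩, ?_, fun i hi => ?_⟩
    case refine_11 =>
      simp only [List.foldl, Instr.run, writeMem_same, Function.update_apply, hj, h9, if_true]
      split_ifs with h
      · rw [h]
      · exact hx i (by omega)
    all_goals simp [Instr.run, writeMem_ne, *]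
  have := Runs.seq hinit fun τ hτ => Runs.count (x := x) (c := 4) (d := 1) (N := n) hτ
    (fun j σ hσ => by rw [hσ.2.1, hσ.1.n_eq]) fun j _ => hbody j
  exact this.mono (by omega) fun τ hτ => ⟨hτ.1, hτ.2.2⟩

/-! ## Merge sort -/

/-- The entries of `A` with addresses in `[a, b)`. -/
def seg (A : ℕ → ℝ) (a b : ℕ) : List ℝ := (List.range' a (b - a)).map A

theorem seg_self (A : ℕ → ℝ) (a : ℕ) : seg A a a = [] := by simp [seg]

theorem seg_cons (A : ℕ → ℝ) {a b : ℕ} (h : a < b) : seg A a b = A a :: seg A (a + 1) b := by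
  obtain ⟨c, rfl⟩ : ∃ c, b = a + 1 + c := ⟨b - a - 1, by omega⟩
  simp only [seg, show a + 1 + c - a = c + 1 by omega, Nat.add_sub_cancel_left, List.range'_succ,
    List.map_cons]

theorem seg_append (A : ℕ → ℝ) {a b c : ℕ} (h : a ≤ b) (h' : b ≤ c) :
    seg A a b ++ seg A b c = seg A a c := by
  obtain ⟨d, rfl⟩ := Nat.exists_eq_add_of_le h
  obtain ⟨e, rfl⟩ := Nat.exists_eq_add_of_le h'
  simp only [seg, Nat.add_sub_cancel_left, show a + d + e - a = d + e by omega]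
  rw [← List.map_append, List.range'_append_1]

theorem seg_snoc (A : ℕ → ℝ) {a b : ℕ} (h : a ≤ b) : seg A a (b + 1) = seg A a b ++ [A b] := by
  rw [← seg_append A h (Nat.le_succ b), seg_cons A (Nat.lt_succ_self b), seg_self]

theorem seg_congr {A B : ℕ → ℝ} {a b : ℕ} (h : ∀ i, a ≤ i → i < b → A i = B i) :
    seg A a b = seg B a b := by
  refine List.map_congr_left fun i hi => ?_
  rw [List.mem_range'_1] at hi
  exact h i hi.1 (by omega)

theorem seg_zero (A : ℕ → ℝ) (n : ℕ) : seg A 0 n = (List.range n).map A := by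
  rw [seg, List.range_eq_range', Nat.sub_zero]

theorem sortedUpTo_of_pairwise {A : ℕ → ℝ} {n : ℕ} (h : (seg A 0 n).Pairwise (· ≤ ·)) :
    SortedUpTo A n := by
  intro i j hij hj
  rw [seg_zero, List.pairwise_map] at h
  rcases hij.eq_or_lt with rfl | hlt
  · exact le_rfl
  · have := List.pairwise_iff_getElem.1 h i j (by simpa using by omega) (by simpa using hj) hlt
    simpa using this

/-- The comparison used for sorting. -/
def leBool (a b : ℝ) : Bool := decide (a ≤ b)

theorem merge_sorted {l l' : List ℝ} (h : l.Pairwise (· ≤ ·)) (h' : l'.Pairwise (· ≤ ·)) :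
    (l.merge l' leBool).Pairwise (· ≤ ·) := by
  have := List.pairwise_merge (le := leBool) (l₁ := l) (l₂ := l')
    (fun a b c h1 h2 => by
      simp only [leBool, decide_eq_true_eq] at *; exact h1.trans h2)
    (fun a b => by simp [leBool, le_total])
    (h.imp fun h => by simpa [leBool] using h) (h'.imp fun h => by simpa [leBool] using h)
  exact this.imp fun h => by simpa [leBool] using h

def takeLeft : Prog := block (.rload 6 2 9) [.rstore 3 12 6, .nadd 9 9 3, .nadd 12 12 3]

def takeRight : Prog := block (.rload 6 2 11) [.rstore 3 12 6, .nadd 11 11 3, .nadd 12 12 3]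

/-- One step of merging `[r9, r7)` and `[r11, r8)` of bank `2` to address `r12` of bank `3`. -/
def mergeStep : Prog :=
  .cond (.nlt 9 7)
    (.cond (.nlt 11 8)
      (.seq (block (.rload 6 2 9) [.rload 7 2 11]) (.cond (.rle 6 7) takeLeft takeRight)) takeLeft)
    takeRight

structure MergeInv (k n : ℕ) (ε : ℝ) (w lo mid hi : ℕ) (A T : ℕ → ℝ) (t : ℕ) (i j : ℕ)
    (σ : State) : Prop where
  base : Base k n ε n σ
  w_eq : σ.nreg 5 = w
  lo_eq : σ.nreg 6 = lo
  mid_eq : σ.nreg 7 = mid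
  hi_eq : σ.nreg 8 = hi
  i_eq : σ.nreg 9 = i
  j_eq : σ.nreg 11 = j
  o_eq : σ.nreg 12 = lo + t
  A_eq : σ.rmem 2 = A
  lo_le : lo ≤ i
  i_le : i ≤ mid
  mid_le : mid ≤ j
  j_le : j ≤ hi
  t_eq : i + j = lo + mid + t
  merged : seg (σ.rmem 3) lo (lo + t) ++ (seg A i mid).merge (seg A j hi) leBool =
    (seg A lo mid).merge (seg A mid hi) leBool
  keep : ∀ p < lo, σ.rmem 3 p = T p

variable {x : ℕ → ℝ} {k n : ℕ} {ε : ℝ}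

theorem seg_update_snoc (A : ℕ → ℝ) {a b : ℕ} (h : a ≤ b) (v : ℝ) :
    seg (Function.update A b v) a (b + 1) = seg A a b ++ [v] := by
  rw [seg_snoc _ h, Function.update_self]
  congr 1
  exact seg_congr fun i _ hi => Function.update_of_ne (by omega) _ _

theorem takeLeft_runs {w lo mid hi : ℕ} {A T : ℕ → ℝ} {t i j : ℕ} {σ : State}
    (h : MergeInv k n ε w lo mid hi A T t i j σ) (hi' : i < mid)
    (hm : (seg A i mid).merge (seg A j hi) leBool =
      A i :: (seg A (i + 1) mid).merge (seg A j hi) leBool) :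
    Runs x takeLeft σ 4 fun τ => ∃ i j, MergeInv k n ε w lo mid hi A T (t + 1) i j τ := by
  obtain ⟨⟨h1, h2, h3, h4, h5, h6, h7, h8, h9⟩, hw, hlo, hmid, hhi, hi1, hj1, ho, hA, b1, b2, b3,
    b4, ht, hmg, hk⟩ := h
  refine Runs.block ⟨i + 1, j, ⟨?_, ?_, ?_, ?_, ?_, ?_, ?_, ?_, ?_⟩, ?_, ?_, ?_, ?_, ?_, ?_, ?_, ?_,
    by omega, by omega, b3, b4, by omega, ?_, fun p hp => ?_⟩
  case refine_18 =>
    simp only [List.foldl, Instr.run, writeMem_same, Function.update_self, ho, hA, hi1]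
    rw [← add_assoc, seg_update_snoc _ (by omega), ← hmg, hm]
    simp
  case refine_19 =>
    simp only [List.foldl, Instr.run, writeMem_same, ho]
    rw [Function.update_of_ne (by omega)]
    exact hk p hp
  all_goals simp [Instr.run, writeMem_ne, add_assoc, *]

theorem takeRight_runs {w lo mid hi : ℕ} {A T : ℕ → ℝ} {t i j : ℕ} {σ : State}
    (h : MergeInv k n ε w lo mid hi A T t i j σ) (hj' : j < hi)
    (hm : (seg A i mid).merge (seg A j hi) leBool =
      A j :: (seg A i mid).merge (seg A (j + 1) hi) leBool) :
    Runs x takeRight σ 4 fun τ => ∃ i j, MergeInv k n ε w lo mid hi A T (t + 1) i j τ := by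
  obtain ⟨⟨h1, h2, h3, h4, h5, h6, h7, h8, h9⟩, hw, hlo, hmid, hhi, hi1, hj1, ho, hA, b1, b2, b3,
    b4, ht, hmg, hk⟩ := h
  refine Runs.block ⟨i, j + 1, ⟨?_, ?_, ?_, ?_, ?_, ?_, ?_, ?_, ?_⟩, ?_, ?_, ?_, ?_, ?_, ?_, ?_, ?_,
    by omega, by omega, by omega, by omega, by omega, ?_, fun p hp => ?_⟩
  case refine_18 =>
    simp only [List.foldl, Instr.run, writeMem_same, Function.update_self, ho, hA, hj1]
    rw [← add_assoc, seg_update_snoc _ (by omega), ← hmg, hm]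
    simp
  case refine_19 =>
    simp only [List.foldl, Instr.run, writeMem_same, ho]
    rw [Function.update_of_ne (by omega)]
    exact hk p hp
  all_goals simp [Instr.run, writeMem_ne, add_assoc, *]

theorem mergeStep_runs {w lo mid hi : ℕ} {A T : ℕ → ℝ} {t i j : ℕ} {σ : State}
    (h : MergeInv k n ε w lo mid hi A T t i j σ) (ht : lo + t < hi) :
    Runs x mergeStep σ 9 fun τ => ∃ i j, MergeInv k n ε w lo mid hi A T (t + 1) i j τ := by
  have hte := h.t_eq
  refine Runs.cond (T := 8) (fun hb => ?_) fun hb => ?_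
  · simp only [Test.Holds, h.i_eq, h.mid_eq] at hb
    refine Runs.cond (T := 7) (fun hb' => ?_) fun hb' => ?_
    · simp only [Test.Holds, h.j_eq, h.hi_eq] at hb'
      refine Runs.seq (T := 2) (T' := 5) (Runs.block (Q := fun τ =>
        MergeInv k n ε w lo mid hi A T t i j τ ∧ τ.rreg 6 = A i ∧ τ.rreg 7 = A j) ?_) ?_
      · obtain ⟨⟨h1, h2, h3, h4, h5, h6, h7, h8, h9⟩, hw, hlo, hmid, hhi, hi1, hj1, ho, hA, b1, b2,
          b3, b4, ht, hmg, hk⟩ := h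
        refine ⟨⟨⟨?_, ?_, ?_, ?_, ?_, ?_, ?_, ?_, ?_⟩, ?_, ?_, ?_, ?_, ?_, ?_, ?_, ?_,
          b1, b2, b3, b4, hte, hmg, hk⟩, ?_, ?_⟩ <;> simp [Instr.run, *]
      · rintro τ ⟨hτ, r6, r7⟩
        refine Runs.cond (T := 4) (fun hb'' => ?_) fun hb'' => ?_
        · simp only [Test.Holds, r6, r7] at hb''
          refine takeLeft_runs hτ hb ?_
          rw [seg_cons A hb, seg_cons A hb', List.cons_merge_cons_pos]
          simpa [leBool] using hb''
        · simp only [Test.Holds, r6, r7] at hb''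
          refine takeRight_runs hτ hb' ?_
          rw [seg_cons A hb, seg_cons A hb', List.cons_merge_cons_neg]
          simpa [leBool] using hb''
    · simp only [Test.Holds, h.j_eq, h.hi_eq] at hb'
      obtain rfl : j = hi := by have := h.j_le; omega
      refine (takeLeft_runs h hb ?_).mono (by norm_num) fun _ h => h
      rw [seg_self, List.merge_right, List.merge_right, seg_cons A hb]
  · simp only [Test.Holds, h.i_eq, h.mid_eq] at hb
    obtain rfl : i = mid := by have := h.i_le; omega
    refine (takeRight_runs h (by omega) ?_).mono (by norm_num) fun _ h => h
    rw [seg_self, List.nil_merge, List.nil_merge, seg_cons A (by omega)]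

/-- Merge the blocks `[r6, r6 + r5)` and `[r6 + r5, r6 + 2 r5)` of bank `2` into bank `3`, and
advance `r6`. -/
def mergeBlocks : Prog :=
  .seq (block (.nadd 7 6 5) [.nadd 8 7 5, .nadd 9 6 10, .nadd 11 7 10, .nadd 12 6 10])
    (.seq (.loop (.nlt 12 8) mergeStep) (.instr (.nadd 6 8 10)))

/-- The part of bank `3` below `r6` is a rearrangement of bank `2`, in sorted blocks. -/
structure PassInv (k n : ℕ) (ε : ℝ) (w : ℕ) (A : ℕ → ℝ) (b : ℕ) (σ : State) : Prop where
  base : Base k n ε n σ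
  w_eq : σ.nreg 5 = w
  lo_eq : σ.nreg 6 = 2 * w * b
  A_eq : σ.rmem 2 = A
  perm : (seg (σ.rmem 3) 0 (2 * w * b)).Perm (seg A 0 (2 * w * b))
  sorted : ∀ c < b, (seg (σ.rmem 3) (2 * w * c) (2 * w * (c + 1))).Pairwise (· ≤ ·)

theorem mergeBlocks_runs {w b : ℕ} {A : ℕ → ℝ} {σ : State} (h : PassInv k n ε w A b σ)
    (hA1 : (seg A (w * (2 * b)) (w * (2 * b + 1))).Pairwise (· ≤ ·))
    (hA2 : (seg A (w * (2 * b + 1)) (w * (2 * b + 1 + 1))).Pairwise (· ≤ ·)) :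
    Runs x mergeBlocks σ (20 * w + 7) (PassInv k n ε w A (b + 1)) := by
  set lo := 2 * w * b with hlo
  have e1 : w * (2 * b) = lo := by rw [hlo]; ring
  have e2 : w * (2 * b + 1) = lo + w := by rw [hlo]; ring
  have e3 : w * (2 * b + 1 + 1) = lo + w + w := by rw [hlo]; ring
  have e4 : 2 * w * (b + 1) = lo + w + w := by rw [hlo]; ring
  rw [e1, e2] at hA1
  rw [e2, e3] at hA2
  set T := σ.rmem 3 with hT
  set I : ℕ → State → Prop := fun t τ =>
    ∃ i j, MergeInv k n ε w lo (lo + w) (lo + w + w) A T t i j τ with hI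
  have hinit : Runs x (block (.nadd 7 6 5) [.nadd 8 7 5, .nadd 9 6 10, .nadd 11 7 10,
      .nadd 12 6 10]) σ 5 (I 0) := by
    obtain ⟨⟨h1, h2, h3, h4, h5, h6, h7, h8, h9⟩, hw, hl, hA, -, -⟩ := h
    refine Runs.block ⟨lo, lo + w, ⟨?_, ?_, ?_, ?_, ?_, ?_, ?_, ?_, ?_⟩, ?_, ?_, ?_, ?_, ?_, ?_, ?_,
      ?_, le_rfl, by omega, le_rfl, by omega, by omega, ?_, fun p hp => ?_⟩
    case refine_18 => rw [add_zero, seg_self, List.nil_append]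
    all_goals simp [Instr.run, *]
  have hloop : ∀ τ, I 0 τ → Runs x (.loop (.nlt 12 8) mergeStep) τ ((w + w) * (9 + 1) + 1)
      (I (w + w)) := by
    intro τ hτ
    refine Runs.count hτ (fun t σ hσ => ?_) fun t ht σ hσ => ?_
    · obtain ⟨i, j, hσ⟩ := hσ
      rw [hσ.o_eq, hσ.hi_eq]; omega
    · obtain ⟨i, j, hσ⟩ := hσ
      exact mergeStep_runs hσ (by omega)
  refine (Runs.seq hinit fun τ hτ => Runs.seq (hloop τ hτ) (Q' := PassInv k n ε w A (b + 1))
    (T' := 1) fun ρ hρ => Runs.instr ?_).mono (by omega) fun _ h => h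
  obtain ⟨i, j, ⟨h1, h2, h3, h4, h5, h6, h7, h8, h9⟩, hw, hl, hmid, hhi, hi1, hj1, ho, hA', b1, b2,
    b3, b4, ht, hmg, hk⟩ := hρ
  obtain rfl : i = lo + w := by omega
  obtain rfl : j = lo + w + w := by omega
  rw [seg_self, seg_self, List.nil_merge, List.append_nil, ← add_assoc] at hmg
  have hlow : seg (ρ.rmem 3) 0 lo = seg T 0 lo := seg_congr fun i _ hi => hk i hi
  refine ⟨⟨?_, ?_, ?_, ?_, ?_, ?_, ?_, ?_, ?_⟩, ?_, ?_, ?_, ?_, ?_⟩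
  case refine_13 =>
    rw [e4]
    change (seg (ρ.rmem 3) 0 (lo + w + w)).Perm _
    rw [← seg_append (ρ.rmem 3) (Nat.zero_le lo) (by omega),
      ← seg_append A (Nat.zero_le lo) (show lo ≤ lo + w + w by omega), hlow, hmg]
    refine h.perm.append ((List.merge_perm_append leBool).trans (List.Perm.of_eq ?_))
    exact seg_append A (by omega) (by omega)
  case refine_14 =>
    intro c hc
    change (seg (ρ.rmem 3) _ _).Pairwise _
    rcases Nat.lt_succ_iff_lt_or_eq.1 hc with hcb | rfl
    · have : 2 * w * (c + 1) ≤ lo := Nat.mul_le_mul_left _ hcb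
      rw [seg_congr (B := T) fun i _ hi => hk i (by omega)]
      exact h.sorted c hcb
    · rw [e4, ← hlo, hmg]
      exact merge_sorted hA1 hA2
  all_goals simp [Instr.run, *]

/-- Copy bank `3` to bank `2`. -/
def copyBack : Prog :=
  .seq (.instr (.nconst 4 0)) (.loop (.nlt 4 1) (block (.rload 6 3 4) [.rstore 2 4 6, .nadd 4 4 3]))

theorem copyBack_runs {w : ℕ} {σ : State} (hσ : Base k n ε n σ) (hw : σ.nreg 5 = w) :
    Runs x copyBack σ (4 * n + 2) fun τ =>
      Base k n ε n τ ∧ τ.nreg 5 = w ∧ ∀ i < n, τ.rmem 2 i = σ.rmem 3 i := by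
  set I : ℕ → State → Prop := fun j τ =>
    Base k n ε n τ ∧ τ.nreg 5 = w ∧ τ.nreg 4 = j ∧ τ.rmem 3 = σ.rmem 3 ∧
      ∀ i < j, τ.rmem 2 i = σ.rmem 3 i with hI
  have hinit : Runs x (.instr (.nconst 4 0)) σ 1 (I 0) := by
    refine Runs.instr ?_
    obtain ⟨h1, h2, h3, h4, h5, h6, h7, h8, h9⟩ := hσ
    refine ⟨⟨?_, ?_, ?_, ?_, ?_, ?_, ?_, ?_, ?_⟩, ?_, ?_, ?_, ?_⟩ <;> simp [Instr.run, *]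
  have hbody : ∀ j, ∀ τ, I j τ →
      Runs x (block (.rload 6 3 4) [.rstore 2 4 6, .nadd 4 4 3]) τ 3 (I (j + 1)) := by
    rintro j τ ⟨⟨h1, h2, h3, h4, h5, h6, h7, h8, h9⟩, hw, hj, hm, hx⟩
    refine Runs.block ⟨⟨?_, ?_, ?_, ?_, ?_, ?_, ?_, ?_, ?_⟩, ?_, ?_, ?_, fun i hi => ?_⟩
    case refine_13 =>
      simp only [List.foldl, Instr.run, writeMem_same, Function.update_apply, hj, hm, if_true]
      split_ifs with h
      · rw [h]
      · exact hx i (by omega)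
    all_goals simp [Instr.run, writeMem_ne, *]
  have := Runs.seq hinit fun τ hτ => Runs.count (x := x) (c := 4) (d := 1) (N := n) hτ
    (fun j σ hσ => by rw [hσ.2.2.1, hσ.1.n_eq]) fun j _ => hbody j
  exact this.mono (by omega) fun τ hτ => ⟨hτ.1, hτ.2.1, hτ.2.2.2.2⟩

/-- Merge neighbouring sorted blocks of length `r5`, and double `r5`. -/
def sortPass : Prog :=
  .seq (.instr (.nconst 6 0)) (.seq (.loop (.nlt 6 1) mergeBlocks)
    (.seq copyBack (.instr (.nadd 5 5 5))))

/-- Bank `2` is a rearrangement of `X` in `2 ^ (m - s)` sorted blocks of length `2 ^ s`. -/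
structure SortInv (k : ℕ) (ε : ℝ) (m : ℕ) (X : ℕ → ℝ) (s : ℕ) (σ : State) : Prop where
  base : Base k (2 ^ m) ε (2 ^ m) σ
  w_eq : σ.nreg 5 = 2 ^ s
  perm : (seg (σ.rmem 2) 0 (2 ^ m)).Perm (seg X 0 (2 ^ m))
  sorted : ∀ c < 2 ^ (m - s), (seg (σ.rmem 2) (2 ^ s * c) (2 ^ s * (c + 1))).Pairwise (· ≤ ·)

theorem sortPass_runs {m s : ℕ} {X : ℕ → ℝ} {σ : State} (hs : s < m)
    (h : SortInv k ε m X s σ) :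
    Runs x sortPass σ (18 * 2 ^ m + 5) (SortInv k ε m X (s + 1)) := by
  set w := 2 ^ s with hw
  set N := 2 ^ (m - (s + 1)) with hN
  have hwN : 2 * w * N = 2 ^ m := by
    rw [hw, hN, ← pow_succ', ← pow_add]; congr 1; omega
  have h2N : 2 ^ (m - s) = 2 * N := by
    rw [hN, ← pow_succ']; congr 1; omega
  have hw0 : 0 < w := by positivity
  set A := σ.rmem 2 with hA
  have hinit : Runs x (.instr (.nconst 6 0)) σ 1 (PassInv k (2 ^ m) ε w A 0) := by
    refine Runs.instr ?_
    obtain ⟨⟨h1, h2, h3, h4, h5, h6, h7, h8, h9⟩, hw', -, -⟩ := h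
    refine ⟨⟨?_, ?_, ?_, ?_, ?_, ?_, ?_, ?_, ?_⟩, ?_, ?_, ?_, ?_, fun c hc => by omega⟩
    case refine_13 => rw [mul_zero, seg_self, seg_self]
    all_goals simp [Instr.run, *]
  have hloop : ∀ τ, PassInv k (2 ^ m) ε w A 0 τ → Runs x (.loop (.nlt 6 1) mergeBlocks) τ
      (N * (20 * w + 7 + 1) + 1) (PassInv k (2 ^ m) ε w A N) := by
    intro τ hτ
    refine Runs.count hτ (fun b ρ hρ => ?_) fun b hb ρ hρ => ?_
    · rw [hρ.lo_eq, hρ.base.n_eq, ← hwN]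
      exact Nat.mul_lt_mul_left (by omega)
    · exact mergeBlocks_runs hρ (h.sorted (2 * b) (by omega)) (h.sorted (2 * b + 1) (by omega))
  have hlast : ∀ ρ, PassInv k (2 ^ m) ε w A N ρ → Runs x (.seq copyBack (.instr (.nadd 5 5 5))) ρ
      (4 * 2 ^ m + 2 + 1) (SortInv k ε m X (s + 1)) := by
    refine fun ρ hρ => Runs.seq (copyBack_runs hρ.base hρ.w_eq) fun π hπ => Runs.instr ?_
    obtain ⟨⟨h1, h2, h3, h4, h5, h6, h7, h8, h9⟩, hw', hcopy⟩ := hπ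
    refine ⟨⟨?_, ?_, ?_, ?_, ?_, ?_, ?_, ?_, ?_⟩, ?_, ?_, ?_⟩
    case refine_11 =>
      change (seg (π.rmem 2) 0 _).Perm _
      rw [seg_congr fun i _ hi => hcopy i hi]
      have := hρ.perm
      rw [hwN] at this
      exact this.trans h.perm
    case refine_12 =>
      intro c hc
      change (seg (π.rmem 2) _ _).Pairwise _
      have e : ∀ c, 2 ^ (s + 1) * c = 2 * w * c := fun c => by rw [pow_succ', hw]
      rw [e, e]
      have hle : 2 * w * (c + 1) ≤ 2 ^ m := by
        rw [← hwN]; exact Nat.mul_le_mul_left _ hc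
      rw [seg_congr fun i _ hi => hcopy i (by omega)]
      exact hρ.sorted c hc
    case refine_10 => simp [Instr.run, hw', hw, pow_succ']; ring
    all_goals simp [Instr.run, *]
  have hall := Runs.seq hinit fun τ hτ => Runs.seq (hloop τ hτ) hlast
  refine hall.mono ?_ fun _ h => h
  have : N * (20 * w + 7 + 1) ≤ 14 * (2 * w * N) := by
    have : N * 1 ≤ N * w := Nat.mul_le_mul_left _ hw0
    nlinarith
  rw [hwN] at this
  omega

def sortProg : Prog := .seq (.instr (.nconst 5 1)) (.loop (.nlt 5 1) sortPass)

theorem sortProg_runs {m : ℕ} {σ : State} (hσ : Base k (2 ^ m) ε (2 ^ m) σ) :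
    Runs x sortProg σ (m * (18 * 2 ^ m + 6) + 2) fun τ => Base k (2 ^ m) ε (2 ^ m) τ ∧
      (seg (τ.rmem 2) 0 (2 ^ m)).Perm (seg (σ.rmem 2) 0 (2 ^ m)) ∧
      SortedUpTo (τ.rmem 2) (2 ^ m) := by
  have hinit : Runs x (.instr (.nconst 5 1)) σ 1 (SortInv k ε m (σ.rmem 2) 0) := by
    refine Runs.instr ?_
    obtain ⟨h1, h2, h3, h4, h5, h6, h7, h8, h9⟩ := hσ
    refine ⟨⟨?_, ?_, ?_, ?_, ?_, ?_, ?_, ?_, ?_⟩, ?_, ?_, ?_⟩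
    case refine_11 => exact List.Perm.refl _
    case refine_12 =>
      intro c _
      rw [pow_zero, one_mul, one_mul, seg_cons _ (Nat.lt_succ_self c), seg_self]
      exact List.pairwise_singleton _ _
    all_goals simp [Instr.run, *]
  have := Runs.seq hinit fun τ hτ => Runs.count (x := x) (c := 5) (d := 1) (N := m) hτ
    (fun j ρ hρ => by
      rw [hρ.w_eq, hρ.base.n_eq]; exact Nat.pow_lt_pow_iff_right (by norm_num))
    fun j hj ρ hρ => sortPass_runs hj hρ
  refine this.mono (le_of_eq (by ring)) fun τ hτ => ⟨hτ.base, hτ.perm, ?_⟩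
  have := hτ.sorted 0 (by positivity)
  rw [mul_zero, zero_add, mul_one] at this
  exact sortedUpTo_of_pairwise this

/-! ## The program for the scan -/

/-- The state of the machine represents the scan `G` at sample number `i`; the current sample `y`
is in register `15`. -/
structure Rep (s : ℕ → ℝ) (n d : ℕ) (T y : ℝ) (i : ℕ) (G : Scan) (σ : State) : Prop where
  len : σ.nreg 0 = G.len
  n_eq : σ.nreg 1 = n
  one : σ.nreg 3 = 1
  i_eq : σ.nreg 4 = i
  f : σ.nreg 5 = G.f
  y0 : σ.nreg 6 = G.y0
  st : σ.nreg 7 = G.st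
  zero : σ.nreg 10 = 0
  T_eq : σ.rreg 8 = T
  rn : σ.rreg 10 = n
  a : σ.rreg 11 = G.a
  prev : σ.rreg 12 = G.prev
  lo : σ.rreg 13 = G.lo
  r : σ.rreg 14 = G.r
  y_eq : σ.rreg 15 = y
  rzero : σ.rreg 17 = 0
  brk : σ.rmem 0 = G.brk
  ht : σ.rmem 1 = G.ht
  s_eq : σ.rmem 2 = s
  drawn : σ.drawn = d

variable {x : ℕ → ℝ} {s : ℕ → ℝ} {n d : ℕ} {T y : ℝ} {i : ℕ} {G : Scan} {σ : State}

def skip : Prog := .instr (.nconst 9 0)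

theorem skip_runs (h : Rep s n d T y i G σ) : Runs x skip σ 1 (Rep s n d T y i G) := by
  obtain ⟨h1, h2, h3, h4, h5, h6, h7, h8, h9, h10, h11, h12, h13, h14, h15, h16, h17, h18, h19,
    h20⟩ := h
  refine Runs.instr ?_
  constructor <;> simp [Instr.run, *]

/-- Close the current piece at the point in register `18`; register `8` holds the number of
samples below it. -/
def closeProg : Prog :=
  block (.nsub 9 8 7) [.rcast 19 9, .rsub 20 18 11, .rmul 20 20 10, .rdiv 19 19 20, .rstore 1 0 19,
    .nadd 0 0 3, .rstore 0 0 18, .radd 11 18 17, .nadd 7 8 10]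

theorem closeProg_runs {e : ℝ} {N : ℕ} (h : Rep s n d T y i G σ) (he : σ.rreg 18 = e)
    (hN : σ.nreg 8 = N) : Runs x closeProg σ 10 (Rep s n d T y i (G.close n e N)) := by
  obtain ⟨h1, h2, h3, h4, h5, h6, h7, h8, h9, h10, h11, h12, h13, h14, h15, h16, h17, h18, h19,
    h20⟩ := h
  refine Runs.block ?_
  constructor <;> simp [Instr.run, Scan.close, writeMem_ne, writeMem_same, *]

def upperProg : Prog :=
  .seq (block (.nsub 9 4 6) [.rcast 16 9, .radd 16 16 8, .rsub 21 15 11, .rmul 21 21 13])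
    (.cond (.rlt 16 21)
      (.seq (block (.rdiv 18 16 13) [.radd 18 11 18, .nadd 8 4 10])
        (.seq closeProg (block (.nadd 6 4 10) [.rconst 13 0, .rconst 14 0])))
      skip)

theorem resetBlock_runs {c j : ℕ} {J : Instr} (hJ : J = .nadd 6 4 c) (hc : i + σ.nreg c = j)
    (h : Rep s n d T y i G σ) :
    Runs x (block J [.rconst 13 0, .rconst 14 0]) σ 3 (Rep s n d T y i (G.reset j)) := by
  subst hJ
  obtain ⟨h1, h2, h3, h4, h5, h6, h7, h8, h9, h10, h11, h12, h13, h14, h15, h16, h17, h18, h19,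
    h20⟩ := h
  refine Runs.block ?_
  constructor <;> simp [Instr.run, Scan.reset, *]

theorem upperProg_runs (h : Rep s n d T y i G σ) :
    Runs x upperProg σ 22 (Rep s n d T y i (G.upper n T y i)) := by
  refine Runs.seq (T := 5) (T' := 17) (Q := fun τ => Rep s n d T y i G τ ∧
    τ.rreg 16 = ((i - G.y0 : ℕ) : ℝ) + T ∧ τ.rreg 21 = (y - G.a) * G.lo) (Runs.block ?_) ?_
  · obtain ⟨h1, h2, h3, h4, h5, h6, h7, h8, h9, h10, h11, h12, h13, h14, h15, h16, h17, h18, h19,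
      h20⟩ := h
    refine ⟨?_, ?_, ?_⟩
    · constructor <;> simp [Instr.run, *]
    all_goals simp [Instr.run, *]
  · rintro τ ⟨hτ, e16, e21⟩
    unfold Scan.upper
    refine Runs.cond (T := 16) (fun hb => ?_) fun hb => ?_
    · simp only [Test.Holds, e16, e21] at hb
      rw [if_pos hb]
      refine Runs.seq (T := 3) (T' := 13) (Q := fun ρ => Rep s n d T y i G ρ ∧
        ρ.rreg 18 = G.a + (((i - G.y0 : ℕ) : ℝ) + T) / G.lo ∧ ρ.nreg 8 = i) (Runs.block ?_) ?_
      · obtain ⟨h1, h2, h3, h4, h5, h6, h7, h8, h9, h10, h11, h12, h13, h14, h15, h16, h17, h18,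
          h19, h20⟩ := hτ
        refine ⟨?_, ?_, ?_⟩
        · constructor <;> simp [Instr.run, *]
        all_goals simp [Instr.run, *]
      · rintro ρ ⟨hρ, e18, e8⟩
        refine Runs.seq (T := 10) (T' := 3) (closeProg_runs hρ e18 e8) fun π hπ => ?_
        exact resetBlock_runs rfl (by rw [hπ.zero, add_zero]) hπ
    · simp only [Test.Holds, e16, e21] at hb
      rw [if_neg hb]
      exact (skip_runs hτ).mono (by norm_num) fun _ h => h

def widenProg : Prog :=
  .seq (block (.nsub 9 4 6) [.rcast 16 9, .radd 16 16 8, .rsub 21 15 11, .rdiv 22 21 16])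
    (.cond (.rlt 14 22) (.instr (.radd 14 22 17)) skip)

theorem widenProg_runs (h : Rep s n d T y i G σ) :
    Runs x widenProg σ 7 (Rep s n d T y i (G.widen T y i)) := by
  refine Runs.seq (T := 5) (T' := 2) (Q := fun τ => Rep s n d T y i G τ ∧
    τ.rreg 22 = (y - G.a) / (((i - G.y0 : ℕ) : ℝ) + T)) (Runs.block ?_) ?_
  · obtain ⟨h1, h2, h3, h4, h5, h6, h7, h8, h9, h10, h11, h12, h13, h14, h15, h16, h17, h18, h19,
      h20⟩ := h
    refine ⟨?_, ?_⟩
    · constructor <;> simp [Instr.run, *]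
    all_goals simp [Instr.run, *]
  · rintro τ ⟨hτ, e22⟩
    unfold Scan.widen
    refine Runs.cond (T := 1) (fun hb => ?_) fun hb => ?_
    · simp only [Test.Holds, hτ.r, e22] at hb
      rw [if_pos hb]
      refine Runs.instr ?_
      obtain ⟨h1, h2, h3, h4, h5, h6, h7, h8, h9, h10, h11, h12, h13, h14, h15, h16, h17, h18, h19,
        h20⟩ := hτ
      constructor <;> simp [Instr.run, *]
    · simp only [Test.Holds, hτ.r, e22] at hb
      rw [if_neg hb]
      exact skip_runs hτ

def lowerProg : Prog :=
  .seq (block (.nadd 9 4 3) [.nsub 9 9 6, .rcast 16 9, .rsub 16 16 8, .rsub 21 15 11,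
      .rmul 22 16 14])
    (.cond (.rlt 21 22)
      (.seq (block (.radd 18 15 17) [.nadd 8 5 10])
        (.seq closeProg (block (.nadd 6 4 3) [.rconst 13 0, .rconst 14 0])))
      (.seq (.instr (.rdiv 22 16 21)) (.cond (.rlt 13 22) (.instr (.radd 13 22 17)) skip)))

theorem lowerProg_runs (h : Rep s n d T y i G σ) :
    Runs x lowerProg σ 22 (Rep s n d T y i (G.lower n T y i)) := by
  refine Runs.seq (T := 6) (T' := 16) (Q := fun τ => Rep s n d T y i G τ ∧
    τ.rreg 16 = ((i + 1 - G.y0 : ℕ) : ℝ) - T ∧ τ.rreg 21 = y - G.a ∧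
    τ.rreg 22 = (((i + 1 - G.y0 : ℕ) : ℝ) - T) * G.r) (Runs.block ?_) ?_
  · obtain ⟨h1, h2, h3, h4, h5, h6, h7, h8, h9, h10, h11, h12, h13, h14, h15, h16, h17, h18, h19,
      h20⟩ := h
    refine ⟨?_, ?_, ?_, ?_⟩
    · constructor <;> simp [Instr.run, *]
    all_goals simp [Instr.run, *]
  · rintro τ ⟨hτ, e16, e21, e22⟩
    unfold Scan.lower
    refine Runs.cond (T := 15) (fun hb => ?_) fun hb => ?_
    · simp only [Test.Holds, e21, e22] at hb
      rw [if_pos hb]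
      refine Runs.seq (T := 2) (T' := 13) (Q := fun ρ => Rep s n d T y i G ρ ∧
        ρ.rreg 18 = y ∧ ρ.nreg 8 = G.f) (Runs.block ?_) ?_
      · obtain ⟨h1, h2, h3, h4, h5, h6, h7, h8, h9, h10, h11, h12, h13, h14, h15, h16, h17, h18,
          h19, h20⟩ := hτ
        refine ⟨?_, ?_, ?_⟩
        · constructor <;> simp [Instr.run, *]
        all_goals simp [Instr.run, *]
      · rintro ρ ⟨hρ, e18, e8⟩
        refine Runs.seq (T := 10) (T' := 3) (closeProg_runs hρ e18 e8) fun π hπ => ?_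
        exact resetBlock_runs rfl (by rw [hπ.one]) hπ
    · simp only [Test.Holds, e21, e22] at hb
      rw [if_neg hb]
      refine (Runs.seq (T := 1) (T' := 2) (Q := fun ρ => Rep s n d T y i G ρ ∧
        ρ.rreg 22 = (((i + 1 - G.y0 : ℕ) : ℝ) - T) / (y - G.a)) (Runs.instr ?_) ?_).mono
          (by norm_num) fun _ h => h
      · obtain ⟨h1, h2, h3, h4, h5, h6, h7, h8, h9, h10, h11, h12, h13, h14, h15, h16, h17, h18,
          h19, h20⟩ := hτ
        refine ⟨?_, ?_⟩
        · constructor <;> simp [Instr.run, *]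
        · simp [Instr.run, *]
      · rintro ρ ⟨hρ, e22'⟩
        refine Runs.cond (T := 1) (fun hb' => ?_) fun hb' => ?_
        · simp only [Test.Holds, hρ.lo, e22'] at hb'
          rw [if_pos hb']
          refine Runs.instr ?_
          obtain ⟨h1, h2, h3, h4, h5, h6, h7, h8, h9, h10, h11, h12, h13, h14, h15, h16, h17, h18,
            h19, h20⟩ := hρ
          constructor <;> simp [Instr.run, *]
        · simp only [Test.Holds, hρ.lo, e22'] at hb'
          rw [if_neg hb']
          exact skip_runs hρ

def stepProg : Prog :=
  .seq (.instr (.rload 15 2 4))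
    (.seq (.cond (.rlt 12 15) (block (.nadd 5 4 10) [.radd 12 15 17]) skip)
      (.seq (.cond (.rlt 11 15) (.seq upperProg (.seq widenProg lowerProg)) (.instr (.nadd 6 4 3)))
        (.instr (.nadd 4 4 3))))

theorem stepProg_runs (h : Rep s n d T y i G σ) :
    Runs x stepProg σ 57 (Rep s n d T (s i) (i + 1) (G.step n T (s i) i)) := by
  refine Runs.seq (T := 1) (T' := 56) (Q := Rep s n d T (s i) i G) (Runs.instr ?_) fun τ hτ => ?_
  · obtain ⟨h1, h2, h3, h4, h5, h6, h7, h8, h9, h10, h11, h12, h13, h14, h15, h16, h17, h18, h19,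
      h20⟩ := h
    constructor <;> simp [Instr.run, *]
  refine Runs.seq (T := 3) (T' := 53) (Q := Rep s n d T (s i) i (G.track (s i) i)) ?_
    fun ρ hρ => ?_
  · unfold Scan.track
    refine Runs.cond (T := 2) (fun hb => ?_) fun hb => ?_
    · simp only [Test.Holds, hτ.prev, hτ.y_eq] at hb
      rw [if_pos hb]
      obtain ⟨h1, h2, h3, h4, h5, h6, h7, h8, h9, h10, h11, h12, h13, h14, h15, h16, h17, h18, h19,
        h20⟩ := hτ
      refine Runs.block ?_
      constructor <;> simp [Instr.run, *]
    · simp only [Test.Holds, hτ.prev, hτ.y_eq] at hb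
      rw [if_neg hb]
      exact (skip_runs hτ).mono (by norm_num) fun _ h => h
  refine Runs.seq (T := 52) (T' := 1) (Q := Rep s n d T (s i) i (G.step n T (s i) i)) ?_
    fun π hπ => Runs.instr ?_
  · unfold Scan.step
    refine Runs.cond (T := 51) (fun hb => ?_) fun hb => ?_
    · simp only [Test.Holds, hρ.a, hρ.y_eq] at hb
      rw [if_pos hb]
      exact Runs.seq (T := 22) (T' := 29) (upperProg_runs hρ) fun π hπ =>
        Runs.seq (T := 7) (T' := 22) (widenProg_runs hπ) fun π' hπ' => lowerProg_runs hπ'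
    · simp only [Test.Holds, hρ.a, hρ.y_eq] at hb
      rw [if_neg hb]
      refine (Runs.instr ?_).mono (by norm_num) fun _ h => h
      obtain ⟨h1, h2, h3, h4, h5, h6, h7, h8, h9, h10, h11, h12, h13, h14, h15, h16, h17, h18, h19,
        h20⟩ := hρ
      constructor <;> simp [Instr.run, *]
  · obtain ⟨h1, h2, h3, h4, h5, h6, h7, h8, h9, h10, h11, h12, h13, h14, h15, h16, h17, h18, h19,
      h20⟩ := hπ
    constructor <;> simp [Instr.run, *]

def scanInit : Prog :=
  block (.rconst 9 4) [.rcast 10 0, .rmul 9 9 10, .rcast 10 1, .rmul 8 0 10, .rdiv 8 8 9,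
    .nconst 0 0, .nconst 4 0, .nconst 5 0, .nconst 6 0, .nconst 7 0, .rconst 11 0, .rconst 12 0,
    .rconst 13 0, .rconst 14 0, .rconst 15 0]

def scanProg : Prog :=
  .seq scanInit (.seq (.loop (.nlt 4 1) stepProg)
    (.seq (.instr (.rconst 15 1)) (.seq upperProg
      (.seq (block (.radd 18 15 17) [.nadd 8 1 10]) closeProg))))

/-- The scan state after the first `i` samples. -/
def scanSteps (s : ℕ → ℝ) (n : ℕ) (T : ℝ) : ℕ → Scan
  | 0 => Scan.start
  | i + 1 => (scanSteps s n T i).step n T (s i) i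

theorem scanSteps_inv (hs : SortedUpTo s n) (hT : 0 < T) (h0 : ∀ j < n, 0 ≤ s j)
    (h1 : ∀ j < n, s j < 1) {i : ℕ} (hi : i ≤ n) : (scanSteps s n T i).Inv s n T i := by
  induction i with
  | zero => exact Scan.inv_start h0
  | succ i ih => exact (ih (by omega)).step hs hT hi h1

theorem scanProg_runs {k : ℕ} {ε : ℝ} (hσ : Base k n ε d σ) (hs : σ.rmem 2 = s) :
    Runs x scanProg σ (58 * n + 52) fun τ => ∃ y,
      Rep s n d (ε * n / (4 * k)) y n ((scanSteps s n (ε * n / (4 * k)) n).finish n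
        (ε * n / (4 * k))) τ := by
  set T := ε * n / (4 * k) with hT
  have hinit : Runs x scanInit σ 16 (fun τ => ∃ y, Rep s n d T y 0 (scanSteps s n T 0) τ) := by
    obtain ⟨h1, h2, h3, h4, h5, h6, h7, h8, h9⟩ := hσ
    refine Runs.block ⟨0, ?_⟩
    constructor <;> simp [Instr.run, scanSteps, Scan.start, *]
  have hloop : ∀ τ, (∃ y, Rep s n d T y 0 (scanSteps s n T 0) τ) →
      Runs x (.loop (.nlt 4 1) stepProg) τ (n * (57 + 1) + 1)
        (fun τ => ∃ y, Rep s n d T y n (scanSteps s n T n) τ) := by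
    intro τ hτ
    refine Runs.count (I := fun i τ => ∃ y, Rep s n d T y i (scanSteps s n T i) τ) hτ
      (fun j ρ hρ => ?_) fun j _ ρ hρ => ?_
    · obtain ⟨y, hρ⟩ := hρ
      rw [hρ.i_eq, hρ.n_eq]
    · obtain ⟨y, hρ⟩ := hρ
      exact (stepProg_runs hρ).mono le_rfl fun π hπ => ⟨_, hπ⟩
  refine (Runs.seq hinit fun τ hτ => Runs.seq (hloop τ hτ) (T' := 1 + (22 + (2 + 10)))
    fun ρ hρ => ?_).mono (by omega) fun _ h => h
  obtain ⟨y, hρ⟩ := hρ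
  refine Runs.seq (Q := Rep s n d T 1 n (scanSteps s n T n)) (Runs.instr ?_) fun π hπ => ?_
  · obtain ⟨h1, h2, h3, h4, h5, h6, h7, h8, h9, h10, h11, h12, h13, h14, h15, h16, h17, h18, h19,
      h20⟩ := hρ
    constructor <;> simp [Instr.run, *]
  refine Runs.seq (upperProg_runs hπ) fun π hπ => ?_
  refine Runs.seq (Q := fun ρ => Rep s n d T 1 n ((scanSteps s n T n).upper n T 1 n) ρ ∧
    ρ.rreg 18 = 1 ∧ ρ.nreg 8 = n) (Runs.block ?_) ?_
  · obtain ⟨h1, h2, h3, h4, h5, h6, h7, h8, h9, h10, h11, h12, h13, h14, h15, h16, h17, h18, h19,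
      h20⟩ := hπ
    refine ⟨?_, ?_, ?_⟩
    · constructor <;> simp [Instr.run, *]
    all_goals simp [Instr.run, *]
  · rintro ρ ⟨hρ, e18, e8⟩
    exact (closeProg_runs hρ e18 e8).mono le_rfl fun _ h => ⟨1, h⟩

/-- The learning algorithm. -/
def learnProg : Prog := .seq sizeProg (.seq drawProg (.seq sortProg scanProg))

theorem learnProg_runs {k m : ℕ} {ε : ℝ} (hm : Enough k ε m) (hlt : ∀ j < m, ¬ Enough k ε j) :
    Runs x learnProg (input k ε) (140 * ((m + 1) * 2 ^ m)) fun τ => τ.drawn = 2 ^ m ∧ ∃ s : ℕ → ℝ,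
      ((List.range (2 ^ m)).map s).Perm ((List.range (2 ^ m)).map x) ∧ SortedUpTo s (2 ^ m) ∧
      τ.size = ((scanSteps s (2 ^ m) (ε * (2 ^ m : ℕ) / (4 * k)) (2 ^ m)).finish (2 ^ m)
        (ε * (2 ^ m : ℕ) / (4 * k))).len ∧
      τ.breaks = ((scanSteps s (2 ^ m) (ε * (2 ^ m : ℕ) / (4 * k)) (2 ^ m)).finish (2 ^ m)
        (ε * (2 ^ m : ℕ) / (4 * k))).brk ∧
      τ.heights = ((scanSteps s (2 ^ m) (ε * (2 ^ m : ℕ) / (4 * k)) (2 ^ m)).finish (2 ^ m)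
        (ε * (2 ^ m : ℕ) / (4 * k))).ht := by
  have hall := Runs.seq (sizeProg_runs (x := x) hm hlt) fun σ hσ =>
    Runs.seq (drawProg_runs hσ) (T' := m * (18 * 2 ^ m + 6) + 2 + (58 * 2 ^ m + 52))
      (P' := .seq sortProg scanProg) (Q' := fun τ => τ.drawn = 2 ^ m ∧ ∃ s : ℕ → ℝ,
      ((List.range (2 ^ m)).map s).Perm ((List.range (2 ^ m)).map x) ∧ SortedUpTo s (2 ^ m) ∧
      τ.size = ((scanSteps s (2 ^ m) (ε * (2 ^ m : ℕ) / (4 * k)) (2 ^ m)).finish (2 ^ m)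
        (ε * (2 ^ m : ℕ) / (4 * k))).len ∧
      τ.breaks = ((scanSteps s (2 ^ m) (ε * (2 ^ m : ℕ) / (4 * k)) (2 ^ m)).finish (2 ^ m)
        (ε * (2 ^ m : ℕ) / (4 * k))).brk ∧
      τ.heights = ((scanSteps s (2 ^ m) (ε * (2 ^ m : ℕ) / (4 * k)) (2 ^ m)).finish (2 ^ m)
        (ε * (2 ^ m : ℕ) / (4 * k))).ht) fun ρ hρ =>
      Runs.seq (sortProg_runs hρ.1) fun π hπ =>
        (scanProg_runs hπ.1 (s := π.rmem 2) rfl).mono le_rfl fun τ hτ => by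
          obtain ⟨y, hτ⟩ := hτ
          refine ⟨hτ.drawn, π.rmem 2, ?_, hπ.2.2, hτ.len, hτ.brk, hτ.ht⟩
          rw [← seg_zero, ← seg_zero]
          refine hπ.2.1.trans (List.Perm.of_eq ?_)
          exact seg_congr fun i _ hi => hρ.2 i hi
  refine hall.mono ?_ fun _ h => h
  have h1 : 1 ≤ 2 ^ m := Nat.one_le_two_pow
  have h2 : m * 1 ≤ m * 2 ^ m := Nat.mul_le_mul_left m h1
  nlinarith

/-! ## The sample size -/

theorem exists_enough {k : ℕ} (hk : 1 ≤ k) {ε : ℝ} (hε : 0 < ε) : ∃ m, Enough k ε m := by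
  have hk' : (0 : ℝ) < k := by exact_mod_cast hk
  have h := tendsto_pow_const_div_const_pow_of_one_lt 2 (show (1 : ℝ) < 2 by norm_num)
  have h2 := (h.comp (Filter.tendsto_add_atTop_nat 2)).eventually
    (gt_mem_nhds (show (0 : ℝ) < ε ^ 2 / (25600 * k * 4) by positivity))
  obtain ⟨m, hm⟩ := h2.exists
  refine ⟨m, ?_⟩
  simp only [Function.comp_apply, pow_add, Nat.cast_add, Nat.cast_ofNat] at hm
  rw [div_lt_div_iff₀ (by positivity) (by positivity)] at hm
  unfold Enough
  nlinarith

/-- The number of levels of the least sample size is logarithmic in `k / ε ^ 2`, and the sample size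
is nearly linear. -/
theorem sampleSize_le {k m : ℕ} (hk : 1 ≤ k) {ε : ℝ} (hε : 0 < ε) (hε1 : ε < 1)
    (hlt : ∀ j < m, ¬ Enough k ε j) :
    (m : ℝ) + 1 ≤ 32 * (1 + Real.log (k / ε ^ 2)) ∧
      (2 : ℝ) ^ m ≤ 51200 * (k / ε ^ 2) * (m + 1) ^ 2 ∧ 0 ≤ Real.log (k / ε ^ 2) ∧
      1 ≤ k / ε ^ 2 := by
  have hk' : (1 : ℝ) ≤ k := by exact_mod_cast hk
  have hε2 : 0 < ε ^ 2 := by positivity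
  have hy : 1 ≤ k / ε ^ 2 := by
    rw [le_div_iff₀ hε2]
    nlinarith
  set y := k / ε ^ 2 with hydef
  have hlog : 0 ≤ Real.log y := Real.log_nonneg hy
  rcases m with _ | m
  · refine ⟨by norm_num; linarith, by norm_num; linarith, hlog, hy⟩
  · have h := hlt m (Nat.lt_succ_self m)
    unfold Enough at h
    rw [not_le] at h
    have hpow : (2 : ℝ) ^ m < 25600 * y * ((m : ℝ) + 2) ^ 2 := by
      have : 25600 * y * ((m : ℝ) + 2) ^ 2 = 25600 * k * ((m : ℝ) + 2) ^ 2 / ε ^ 2 := by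
        rw [hydef]; ring
      rw [this, lt_div_iff₀ hε2]
      exact h
    refine ⟨?_, ?_, hlog, hy⟩
    · have hl := Real.log_lt_log (by positivity) hpow
      have hm2 : (0 : ℝ) < (m : ℝ) + 2 := by positivity
      rw [Real.log_pow, Real.log_mul (by positivity) (by positivity),
        Real.log_mul (by norm_num) (by linarith), Real.log_pow] at hl
      have h1 : Real.log 25600 ≤ 15 * Real.log 2 := by
        rw [← Real.log_rpow (by norm_num)]
        exact Real.log_le_log (by norm_num) (by norm_num)
      have h2 : Real.log ((m : ℝ) + 2) ≤ 3 * Real.log 2 + (((m : ℝ) + 2) / 8 - 1) := by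
        have e : (m : ℝ) + 2 = 8 * (((m : ℝ) + 2) / 8) := by ring
        have h8 : Real.log 8 = 3 * Real.log 2 := by
          rw [show (8 : ℝ) = 2 ^ (3 : ℕ) by norm_num, Real.log_pow]; norm_num
        calc Real.log ((m : ℝ) + 2) = Real.log 8 + Real.log (((m : ℝ) + 2) / 8) := by
              rw [← Real.log_mul (by norm_num) (by positivity), ← e]
          _ ≤ _ := by rw [h8]; linarith [Real.log_le_sub_one_of_pos (x := ((m : ℝ) + 2) / 8)
                        (by positivity)]
      have l1 := Real.log_two_gt_d9
      have l2 := Real.log_two_lt_d9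
      push_cast at hl ⊢
      have hm0 : (0 : ℝ) ≤ m := Nat.cast_nonneg m
      nlinarith
    · push_cast
      rw [pow_succ]
      have : ((m : ℝ) + 1 + 1) = m + 2 := by ring
      rw [this]
      linarith

/-! ## Accuracy -/

theorem exists_isFlat {k : ℕ} (hk : 1 ≤ k) : ∃ q, IsFlat k q := by
  have hk' : (0 : ℝ) < k := by exact_mod_cast hk
  refine ⟨_, fun i => (i : ℝ) / k, fun _ => 1, ⟨by simp, div_self hk'.ne', fun i _ => ?_,
    fun _ _ => zero_le_one, ?_⟩, rfl⟩
  · push_cast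
    exact div_lt_div_of_pos_right (by linarith) hk'
  · rw [Finset.sum_congr rfl (g := fun _ => 1 / (k : ℝ)) fun i _ => by push_cast; ring]
    rw [Finset.sum_const, Finset.card_range, nsmul_eq_mul, mul_one_div_cancel hk'.ne']

theorem opt_nonneg (k : ℕ) (p : Measure ℝ) : 0 ≤ opt k p :=
  Real.sInf_nonneg (by rintro _ ⟨q, -, rfl⟩; exact tvDist_nonneg p q)

theorem exists_near_opt {k : ℕ} (hk : 1 ≤ k) (p : Measure ℝ) {δ : ℝ} (hδ : 0 < δ) :
    ∃ e d, IsHistogram k e d ∧ tvDist p (histMeasure k e d) < opt k p + δ := by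
  obtain ⟨q0, hq0⟩ := exists_isFlat hk
  obtain ⟨_, ⟨q, ⟨e, d, hq, rfl⟩, rfl⟩, hlt⟩ := exists_lt_of_csInf_lt
    (s := tvDist p '' {q | IsFlat k q}) ⟨_, q0, hq0, rfl⟩
    (show sInf (tvDist p '' {q | IsFlat k q}) < opt k p + δ by
      change opt k p < _; linarith)
  exact ⟨e, d, hq, hlt⟩

theorem Scan.Pieces.isHistogram {s : ℕ → ℝ} {n : ℕ} {T : ℝ} {G : Scan} (hG : G.Pieces s n T)
    (hn : 0 < n) (ha : G.a = 1) (h0 : ∀ j < n, 0 ≤ s j) (h1 : ∀ j < n, s j < 1) :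
    IsHistogram G.len G.brk G.ht := by
  have hw : ∀ i < G.len, 0 < G.brk (i + 1) - G.brk i := fun i hi => by linarith [hG.lt i hi]
  have hright : G.brk G.len = 1 := hG.right.trans ha
  refine ⟨hG.left, hright, hG.lt, fun i hi => ?_, ?_⟩
  · rw [hG.ht i hi]
    exact div_nonneg measureReal_nonneg (hw i hi).le
  · have hn' : (0 : ℝ) < n := by exact_mod_cast hn
    have hone : (empMeasure n s).real (Ico 0 1) = 1 := by
      rw [empMeasure_real_eq (u := 0) (v := n) measurableSet_Ico (Nat.zero_le n) le_rfl
        fun j hj => iff_of_true ⟨h0 j hj, h1 j hj⟩ ⟨Nat.zero_le j, hj⟩]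
      rw [Nat.cast_zero, sub_zero, div_self hn'.ne']
    rw [← hone, measureReal_eq_sum_pieces _ hG.lt (by rw [hG.left, hright])]
    refine Finset.sum_congr rfl fun i hi => ?_
    have hi := Finset.mem_range.1 hi
    have hsub : Ico (G.brk i) (G.brk (i + 1)) ⊆ Ico 0 1 := by
      rw [← hG.left, ← hright]
      exact Ico_subset_Ico (breaks_mono hG.lt (Nat.zero_le i) hi.le)
        (breaks_mono hG.lt hi le_rfl)
    rw [hG.ht i hi, div_mul_cancel₀ _ (hw i hi).ne', inter_eq_self_of_subset_right hsub]

theorem scan_accurate {p : Measure ℝ} [IsProbabilityMeasure p] {k : ℕ} (hk : 1 ≤ k) {ε : ℝ}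
    (hε : 0 < ε) (hwb : WellBehaved (ε / Real.log (1 / ε) / (384 * k)) p)
    (hopt : opt k p ≤ ε) {s : ℕ → ℝ} {n : ℕ} (hn : 0 < n) (hs : SortedUpTo s n)
    (h0 : ∀ j < n, 0 ≤ s j) (h1 : ∀ j < n, s j < 1)
    (hclose : CloseOnCuts (empMeasure n s) p (20 * k) (ε / 4)) {G : Scan}
    (hG : G = (scanSteps s n (ε * n / (4 * k)) n).finish n (ε * n / (4 * k))) :
    IsHistogram G.len G.brk G.ht ∧ G.len ≤ 14 * k ∧
      tvDist p (histMeasure G.len G.brk G.ht) ≤ 2 * opt k p + 3 * ε := by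
  have hk' : (0 : ℝ) < k := by exact_mod_cast hk
  have hn' : (0 : ℝ) < n := by exact_mod_cast hn
  set T := ε * n / (4 * k) with hTdef
  have hT : 0 < T := by positivity
  have hTn : T / n = ε / (4 * k) := by rw [hTdef]; field_simp
  obtain ⟨hP, ha, hlen, hmis⟩ := (scanSteps_inv hs hT h0 h1 le_rfl).finish hs hn hT h1
  rw [← hG] at hP ha hlen hmis
  rw [hTn] at hmis
  have hfit := hP.fit
  rw [hTn] at hfit
  have hH := hP.isHistogram hn ha h0 h1
  have := hH.isProbabilityMeasure
  obtain ⟨e, d, hq, hqlt⟩ := exists_near_opt hk p (show 0 < ε / 8 by positivity)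
  have := hq.isProbabilityMeasure
  have hΔ : ∀ A, MeasurableSet A → |p.real A - (histMeasure k e d).real A| ≤ opt k p + ε / 8 :=
    fun A hA => (abs_sub_le_tvDist p _ hA).trans hqlt.le
  have hsize : G.len - 1 ≤ k + 2 * (6 * k) := by
    refine card_misfit_le hq hclose hΔ (by omega) ?_ (fun i hi => hH.lt i (by omega))
      hH.left.ge ?_ hmis
    · have : ε / (4 * k) * ((6 * k : ℕ) + 1 : ℝ) = 3 / 2 * ε + ε / (4 * k) := by
        push_cast; field_simp; ring
      rw [this]
      have : 0 < ε / (4 * k) := by positivity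
      linarith
    · rw [← hH.right]
      exact breaks_mono hH.lt (by omega) le_rfl
  have hsize' : G.len ≤ 14 * k := by omega
  refine ⟨hH, hsize', tvDist_le fun A hA => ?_⟩
  have hopt0 := opt_nonneg k p
  rcases le_or_gt (1 / 3) ε with hbig | hsmall
  · exact (abs_sub_real_le_one p _ A).trans (by linarith)
  · have hlog : 1 ≤ Real.log (1 / ε) := by
      rw [Real.le_log_iff_exp_le (by positivity)]
      have h3 : 3 ≤ 1 / ε := by rw [le_div_iff₀ hε]; linarith
      linarith [Real.exp_one_lt_d9]
    have hκ0 : 0 ≤ ε / Real.log (1 / ε) / (384 * k) := by positivity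
    have hkκ : k * (ε / Real.log (1 / ε) / (384 * k)) ≤ ε / 384 := by
      have e1 : k * (ε / Real.log (1 / ε) / (384 * k)) = ε / Real.log (1 / ε) / 384 := by
        field_simp
      rw [e1]
      have : ε / Real.log (1 / ε) ≤ ε := div_le_self hε.le hlog
      linarith
    have hflat := flattening_close hq (by positivity : 0 ≤ ε / (4 * k)) hclose hΔ hH
      hP.ht hfit (by omega) hκ0 hwb hA
    have e2 : 4 * k * (ε / (4 * k)) = ε := by field_simp
    rw [e2] at hflat
    have := abs_sub_le (p.real A) ((histMeasure k e d).real A)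
      ((histMeasure G.len G.brk G.ht).real A)
    have := hΔ A hA
    linarith

theorem closeOnCuts_of_enough {p : Measure ℝ} {k m : ℕ} (hk : 1 ≤ k) {ε : ℝ} (hε : 0 < ε)
    (hε1 : ε < 1) (hm : Enough k ε m) {ν : Measure ℝ}
    (h : CloseOnCuts ν p (20 * k) ((20 * k : ℕ) / 2 ^ m + (m + 2) * √(20 * (20 * k : ℕ) / 2 ^ m))) :
    CloseOnCuts ν p (20 * k) (ε / 4) := by
  intro E A hA hc hE
  refine (h E A hA hc hE).trans ?_
  have hk' : (0 : ℝ) < k := by exact_mod_cast hk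
  have hpow : (0 : ℝ) < 2 ^ m := by positivity
  unfold Enough at hm
  have hm0 : (0 : ℝ) ≤ m := Nat.cast_nonneg m
  have h1 : ((20 * k : ℕ) : ℝ) / 2 ^ m ≤ ε / 8 := by
    rw [div_le_iff₀ hpow]
    push_cast
    have : 25600 * k * (2 : ℝ) ^ 2 ≤ 25600 * k * ((m : ℝ) + 2) ^ 2 := by gcongr; linarith
    have : 2 ^ m * ε ^ 2 ≤ 2 ^ m * ε := by gcongr; nlinarith
    linarith
  have h2 : ((m : ℝ) + 2) * √(20 * (20 * k : ℕ) / 2 ^ m) ≤ ε / 8 := by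
    rw [← Real.sqrt_sq (show 0 ≤ (m : ℝ) + 2 by positivity), ← Real.sqrt_mul (by positivity)]
    refine Real.sqrt_le_iff.2 ⟨by positivity, ?_⟩
    rw [mul_div_assoc', div_le_iff₀ hpow]
    push_cast
    linarith
  linarith

end

end HistLearn

open HistLearn in
theorem theorem3 :
    ∃ (A : HistLearn.Prog) (C : ℝ) (c : ℕ), ∀ (k : ℕ) (ε : ℝ), 1 ≤ k → 0 < ε → ε < 1 →
      -- on every sequence of samples: running time and number of draws
      (∀ x : ℕ → ℝ, (∀ i, x i ∈ Set.Ico (0 : ℝ) 1) →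
        ∃ (t : ℕ) (σ : HistLearn.State), HistLearn.Exec x A (HistLearn.input k ε) t σ ∧
          (t : ℝ) ≤ C * (k / ε ^ 2) * (1 + Real.log (k / ε ^ 2)) ^ c ∧
          (σ.drawn : ℝ) ≤ C * (k / ε ^ 2) * (1 + Real.log (k / ε ^ 2)) ^ c) ∧
      -- on independent samples from `p`: failure has (outer) probability at most `1/20`
      (∀ (p : MeasureTheory.Measure ℝ) [MeasureTheory.IsProbabilityMeasure p],
        p (Set.Ico (0 : ℝ) 1) = 1 →
        HistLearn.WellBehaved (ε / Real.log (1 / ε) / (384 * k)) p →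
        HistLearn.opt k p ≤ ε →
        MeasureTheory.Measure.infinitePi (fun _ : ℕ => p)
          {x | ¬ ∃ (t : ℕ) (σ : HistLearn.State),
            HistLearn.Exec x A (HistLearn.input k ε) t σ ∧
            σ.Accurate p (C * k * (1 + Real.log (1 / ε)) ^ 2)
              (2 * HistLearn.opt k p + 3 * ε)} ≤ 1 / 20) := by
  classical
  refine ⟨learnProg, 140 * 51200 * 32 ^ 3, 3, fun k ε hk hε hε1 => ?_⟩
  have hk' : (1 : ℝ) ≤ k := by exact_mod_cast hk
  have hex := exists_enough hk hε
  set m := Nat.find hex with hmdef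
  have hm : Enough k ε m := Nat.find_spec hex
  have hlt : ∀ j < m, ¬ Enough k ε j := fun j hj => Nat.find_min hex hj
  obtain ⟨b1, b2, b3, b4⟩ := sampleSize_le hk hε hε1 hlt
  set y := k / ε ^ 2 with hy
  set L := Real.log y with hL
  refine ⟨fun x _ => ?_, fun p _ hp hwb hopt => ?_⟩
  · obtain ⟨t, σ, hexec, ht, hd, -⟩ := learnProg_runs (x := x) hm hlt
    have key : ((m : ℝ) + 1) * 2 ^ m ≤ 51200 * 32 ^ 3 * y * (1 + L) ^ 3 := by
      calc ((m : ℝ) + 1) * 2 ^ m ≤ (m + 1) * (51200 * y * (m + 1) ^ 2) := by gcongr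
        _ = 51200 * y * (m + 1) ^ 3 := by ring
        _ ≤ 51200 * y * (32 * (1 + L)) ^ 3 := by gcongr
        _ = _ := by ring
    have key0 : 0 ≤ ((m : ℝ) + 1) * 2 ^ m := by positivity
    refine ⟨t, σ, hexec, ?_, ?_⟩
    · have : (t : ℝ) ≤ 140 * (((m : ℝ) + 1) * 2 ^ m) := by exact_mod_cast ht
      nlinarith
    · rw [hd]
      push_cast
      have : (2 : ℝ) ^ m ≤ ((m : ℝ) + 1) * 2 ^ m :=
        le_mul_of_one_le_left (by positivity) (by linarith [Nat.cast_nonneg (α := ℝ) m])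
      nlinarith
  · set P := MeasureTheory.Measure.infinitePi (fun _ : ℕ => p)
    have hsupp : P {x | ¬ ∀ i, x i ∈ Set.Ico (0 : ℝ) 1} = 0 := by
      have : ∀ᵐ x ∂P, ∀ i, x i ∈ Set.Ico (0 : ℝ) 1 := by
        rw [MeasureTheory.ae_all_iff]
        intro i
        have h1 : ∀ᵐ z ∂p, z ∈ Set.Ico (0 : ℝ) 1 :=
          (MeasureTheory.prob_compl_eq_zero_iff measurableSet_Ico).2 hp
        exact (measurePreserving_eval_infinitePi
          (fun _ : ℕ => p) i).quasiMeasurePreserving.ae h1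
      exact this
    have hdev := empMeasure_deviation p m (20 * k)
    refine (MeasureTheory.measure_mono (t := {x | ¬ ∀ i, x i ∈ Set.Ico (0 : ℝ) 1} ∪
      {x | ¬ ∀ (E : Finset ℝ) (A : Set ℝ), MeasurableSet A → Cut E A → E.card ≤ 20 * k →
        |(empMeasure (2 ^ m) x).real A - p.real A| ≤
          (20 * k : ℕ) / 2 ^ m + (m + 2) * √(20 * (20 * k : ℕ) / 2 ^ m)}) fun x hx => ?_).trans
      ((MeasureTheory.measure_union_le _ _).trans (by rw [hsupp, zero_add]; exact hdev))
    by_contra hgood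
    simp only [Set.mem_union, Set.mem_ofPred_eq, not_or, not_not] at hgood
    obtain ⟨hx01, hcl⟩ := hgood
    refine hx ?_
    obtain ⟨t, σ, hexec, -, -, s, hperm, hs, hsz, hbr, hht⟩ := learnProg_runs (x := x) hm hlt
    have hmem : ∀ j < 2 ^ m, s j ∈ Set.Ico (0 : ℝ) 1 := by
      intro j hj
      have : s j ∈ (List.range (2 ^ m)).map x :=
        hperm.subset (List.mem_map_of_mem (List.mem_range.2 hj))
      obtain ⟨i, -, hi⟩ := List.mem_map.1 this
      rw [← hi]
      exact hx01 i
    have hcl' : CloseOnCuts (empMeasure (2 ^ m) s) p (20 * k) (ε / 4) := by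
      rw [empMeasure_perm hperm]
      exact closeOnCuts_of_enough hk hε hε1 hm hcl
    obtain ⟨r1, r2, r3⟩ := scan_accurate hk hε hwb hopt (by positivity) hs
      (fun j hj => (hmem j hj).1) (fun j hj => (hmem j hj).2) hcl' rfl
    refine ⟨t, σ, hexec, ?_⟩
    rw [State.Accurate, hsz, hbr, hht]
    refine ⟨r1, ?_, r3⟩
    have hlog : 0 ≤ Real.log (1 / ε) := Real.log_nonneg (by rw [le_div_iff₀ hε]; linarith)
    have h14 : ((14 * k : ℕ) : ℝ) ≤ 140 * 51200 * 32 ^ 3 * k * (1 + Real.log (1 / ε)) ^ 2 := by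
      have : 1 ≤ (1 + Real.log (1 / ε)) ^ 2 := one_le_pow₀ (by linarith)
      push_cast
      nlinarith
    refine le_trans ?_ h14
    exact_mod_cast r2
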